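/- **Setting.** Let $\mathcal X\subset[0,r]^{d_1}$ be compact and convex and let $\Omega$ be a finite nonempty set. Let $k$ be a kernel on $\mathcal X\times\Omega$ with $k(z,z)\le 1$, and let $f$ be a (measurable) centred Gaussian process on $\mathcal X\times\Omega$ with covariance $k$. The noises $\varepsilon_1,\varepsilon_2,\dots$ are $N(0,\sigma^2_{\rm noise})$ with $\sigma_{\rm noise}^2>0$, the variables $\xi_1,\xi_2,\dots$ are chi-squared with two degrees of freedom, and $f,\varepsilon_1,\varepsilon_2,\dots,\xi_1,\xi_2,\dots$ are mutually independent. Let $\rho:\mathbb R^\Omega\to\mathbb R$ be measurable and $F(x)=\rho(f(x,\cdot))$. **Assumptions on $f$ and $\rho$.** (i) Almost surely, $f(\cdot,w)$ is differentiable on $\mathcal X$ for every $w\in\Omega$, and for some $a_1,b_1>0$, all $j\in\{1,\dots,d_1\}$, $w\in\Omega$ and $L>0$, $$\mathbb P\Big(\sup_{x\in\mathcal X}\big|\partial f(x,w)/\partial x_j\big|>L\Big)\le a_1 e^{-(L/b_1)^2}.$$ (ii) $q_1:[0,\infty)\to[0,\infty)$ is non-decreasing and concave with $q_1(0)=0$,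 and almost surely $|\rho(f(x,\cdot))-\rho(f(x',\cdot))|\le q_1(\max_{w\in\Omega}|f(x,w)-f(x',w)|)$ for all $x,x'\in\mathcal X$. **Algorithm.** For $t\ge1$ put $$\kappa^{(1)}_t=\Big(1+\big\lceil b_1d_1rt^2\big(\sqrt{\log(a_1d_1|\Omega|)}+\sqrt\pi/2\big)\big\rceil^{d_1}\Big)|\Omega|,\qquad \beta_t=2\log\kappa^{(1)}_t+\xi_t,$$ where $\sqrt{\log(a_1d_1|\Omega|)}$ is read as $0$ if $a_1d_1|\Omega|<1$. Let $\mu_{t-1}$ and $\sigma^2_{t-1}$ be the Gaussian process posterior mean and variance (noise variance $\sigma^2_{\rm noise}$) given $(x_i,w_i,y_i)_{i<t}$, where $y_i=f(x_i,w_i)+\varepsilon_i$. Let $G_{t-1}(x)$ be the set of functions $g:\Omega\to\mathbb R$ with $|g(w)-\mu_{t-1}(x,w)|\le\beta_t^{1/2}\sigma_{t-1}(x,w)$ for all $w$. Let $\mathrm{lcb}_{t-1},\mathrm{ucb}_{t-1}$ satisfy, almost surely for all $t\ge 1$ and $x\in\mathcal X$, $$\mathrm{lcb}_{t-1}(x)\le\inf_{g\in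 G_{t-1}(x)}\rho(g),\qquad \sup_{g\in G_{t-1}(x)}\rho(g)\le\mathrm{ucb}_{t-1}(x).$$ In round $t$ the algorithm selects - $\hat x_t\in\operatorname{argmax}_{x\in\mathcal X}\rho(\mu_{t-1}(x,\cdot))$, as a measurable function of the past data $(x_i,w_i,y_i,\beta_i)_{i<t}$; - $\tilde x_t\in\operatorname{argmax}_{x\in\mathcal X}\big(\mathrm{ucb}_{t-1}(x)-\sup_{x'\in\mathcal X}\mathrm{lcb}_{t-1}(x')\big)_+$; - $x_t\in\operatorname{argmax}_{x\in\{\tilde x_t,\hat x_t\}}(\mathrm{ucb}_{t-1}(x)-\mathrm{lcb}_{t-1}(x))$ and $w_t\in\operatorname{argmax}_{w\in\Omega}\sigma^2_{t-1}(x_t,w)$, as measurable functions of the past data and $\beta_t$. **Width condition.** Let $q(a)=\sum_{i=1}^n\zeta_ih_i\big(\sum_{j=1}^{s_i}\lambda_{ij}a^{\nu_{ij}}\big)$ with $\zeta_i,\lambda_{ij}\ge0$, $\nu_{ij}>0$ and $h_i:[0,\infty)\to[0,\infty)$ non-decreasing and concave with $h_i(0)=0$. Suppose that almost surely, for all $t\ge1$,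 $$\mathrm{ucb}_{t-1}(x_t)-\mathrm{lcb}_{t-1}(x_t)\le q\big(2\beta_t^{1/2}\max_{w\in\Omega}\sigma_{t-1}(x_t,w)\big).$$ **Conclusion.** Let $x^*$ be a (measurable) maximizer of $F$ over $\mathcal X$ and $R_t=\sum_{i=1}^t\{F(x^*)-F(\hat x_i)\}$. Let $\gamma_t=\frac12\sup\log\det(I_t+\sigma^{-2}_{\rm noise}\tilde K_t)$, where $\tilde K_t$ ranges over the kernel matrices of $t$-tuples of points of $\mathcal X\times\Omega$. Then for every $t\ge1$ the random variable $R_t$ is integrable, all the expectations $C_{2,\nu_{ij},t}$ below are finite, and $$\mathbb E[R_t]\le t\,q_1\Big(\frac{\pi^2}{6t}\Big)+2t\sum_{i=1}^n\zeta_ih_i\Big(\frac1t\sum_{j=1}^{s_i}2^{\nu_{ij}}\lambda_{ij}\,(t\,C_{2,\nu_{ij},t})^{1-\nu'_{ij}/2}(C_1\gamma_t)^{\nu'_{ij}/2}\Big),$$ where $\nu'_{ij}=\min\{\nu_{ij},1\}$, $C_1=2/\log(1+\sigma^{-2}_{\rm noise})$ and $C_{2,\nu_{ij},t}=\mathbb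 E\big[\beta_t^{\nu_{ij}/(2-\nu'_{ij})}\big]$. -/

import Mathlib

open MeasureTheory ProbabilityTheory
open scoped NNReal ENNReal

namespace RobustBO

noncomputable section

/-! ### Gaussian process regression -/

section GP

variable {Z : Type*}

/-- Kernel matrix `(k (zᵢ, zⱼ))ᵢⱼ`. -/
def kernelMatrix (k : Z → Z → ℝ) {n : ℕ} (z : Fin n → Z) : Matrix (Fin n) (Fin n) ℝ :=
  Matrix.of fun i j => k (z i) (z j)

/-- Posterior mean at `p` after observing `y` at the inputs `z`, with noise variance `v`:
`k(p)ᵀ (K + v I)⁻¹ y`. -/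
def postMean (k : Z → Z → ℝ) (v : ℝ≥0) {n : ℕ} (z : Fin n → Z) (y : Fin n → ℝ) (p : Z) : ℝ :=
  dotProduct (fun i => k p (z i)) ((kernelMatrix k z + (v : ℝ) • 1)⁻¹.mulVec y)

/-- Posterior variance at `p`: `k(p,p) - k(p)ᵀ (K + v I)⁻¹ k(p)`. -/
def postVar (k : Z → Z → ℝ) (v : ℝ≥0) {n : ℕ} (z : Fin n → Z) (p : Z) : ℝ :=
  k p p - dotProduct (fun i => k p (z i))
    ((kernelMatrix k z + (v : ℝ) • 1)⁻¹.mulVec fun i => k p (z i))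

/-- Posterior standard deviation. -/
def postSd (k : Z → Z → ℝ) (v : ℝ≥0) {n : ℕ} (z : Fin n → Z) (p : Z) : ℝ :=
  Real.sqrt (postVar k v z p)

/-- Maximum information gain `γ_n = ½ sup log det (I + v⁻¹ K)`, the supremum being over all
`n`-tuples (repetitions allowed) of points of `S`. -/
def maxInfoGain (k : Z → Z → ℝ) (v : ℝ≥0) (S : Set Z) (n : ℕ) : ℝ :=
  (1 / 2) * ⨆ z : Fin n → S,
    Real.log (1 + (v : ℝ)⁻¹ • kernelMatrix k fun i => (z i : Z)).det

end GP

/-- Chi-squared distribution with `m` degrees of freedom (density proportional to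
`x ^ (m/2 - 1) * exp (-x/2)` on the positive half-line). -/
def chiSquared (m : ℕ) : Measure ℝ := gammaMeasure ((m : ℝ) / 2) (1 / 2)

/-! ### Function classes -/

/-- `h : [0,∞) → [0,∞)` non-decreasing and concave with `h 0 = 0`
(only the values on `[0,∞)` matter; nonnegativity follows). -/
structure IsConcaveModulus (h : ℝ → ℝ) : Prop where
  mono : MonotoneOn h (Set.Ici 0)
  concave : ConcaveOn ℝ (Set.Ici 0) h
  zero : h 0 = 0

/-- Data of a function `q(a) = ∑ᵢ ζᵢ hᵢ (∑ⱼ λᵢⱼ a ^ νᵢⱼ)` of the class `𝒬`. -/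
structure QForm where
  n : ℕ
  s : Fin n → ℕ
  ζ : Fin n → ℝ
  h : Fin n → ℝ → ℝ
  lam : (i : Fin n) → Fin (s i) → ℝ
  ν : (i : Fin n) → Fin (s i) → ℝ
  ζ_nonneg : ∀ i, 0 ≤ ζ i
  h_mem : ∀ i, IsConcaveModulus (h i)
  lam_nonneg : ∀ i j, 0 ≤ lam i j
  ν_pos : ∀ i j, 0 < ν i j

/-- The function `q` given by the data. -/
def QForm.eval (q : QForm) (a : ℝ) : ℝ :=
  ∑ i, q.ζ i * q.h i (∑ j, q.lam i j * a ^ q.ν i j)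

/-! ### The random black-box function

`f ω x w` is the black-box function; `X` is the design set and `W` the finite set of environmental
variables. Only the values for `x ∈ X` matter. -/

section Model

variable {Ω' : Type*} [MeasurableSpace Ω'] {d : ℕ} {W : Type*}

/-- `f` is a (measurable) centred Gaussian process on `X × W` with covariance kernel `k`. -/
structure IsCentredGP (X : Set (Fin d → ℝ)) (f : Ω' → (Fin d → ℝ) → W → ℝ)
    (k : (Fin d → ℝ) × W → (Fin d → ℝ) × W → ℝ) (P : Measure Ω') : Prop where
  measurable : ∀ w, Measurable fun p : X × Ω' => f p.2 p.1 w
  gaussian : IsGaussianProcess (fun (z : X × W) ω => f ω z.1 z.2) P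
  mean : ∀ x ∈ X, ∀ w, ∫ ω, f ω x w ∂P = 0
  cov : ∀ x ∈ X, ∀ w, ∀ x' ∈ X, ∀ w',
    covariance (fun ω => f ω x w) (fun ω => f ω x' w') P = k (x, w) (x', w')

/-- The sample paths `f(·, w)` are almost surely differentiable on `X`, with partial derivatives
`D ω x w j = ∂f(x, w)/∂xⱼ` satisfying
`P (sup_{x ∈ X} |∂f(x, w)/∂xⱼ| > L) ≤ a exp (-(L/b)²)` for all `j`, `w` and `L > 0`. -/
def HasSubGaussianPartials (a b : ℝ) (X : Set (Fin d → ℝ)) (f : Ω' → (Fin d → ℝ) → W → ℝ)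
    (P : Measure Ω') : Prop :=
  ∃ D : Ω' → (Fin d → ℝ) → W → Fin d → ℝ,
    (∀ᵐ ω ∂P, ∀ w, ∀ x ∈ X, HasFDerivWithinAt (fun v => f ω v w)
      (∑ j, D ω x w j • (ContinuousLinearMap.proj j : (Fin d → ℝ) →L[ℝ] ℝ)) X x) ∧
    ∀ j w, ∀ L : ℝ, 0 < L →
      P {ω | ENNReal.ofReal L < ⨆ x ∈ X, ‖D ω x w j‖ₑ} ≤
        ENNReal.ofReal (a * Real.exp (-(L / b) ^ 2))

/-- The σ-algebras generated by the sources of randomness: `f` (restricted to `X × W`), the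
noises `ε₁, ε₂, …`, and the variables `ξ₁, ξ₂, …`. -/
@[reducible] def sourceSigma (X : Set (Fin d → ℝ)) (f : Ω' → (Fin d → ℝ) → W → ℝ) (ε ξ : ℕ → Ω' → ℝ) :
    Option (ℕ ⊕ ℕ) → MeasurableSpace Ω'
  | none => ⨆ x ∈ X, ⨆ w, MeasurableSpace.comap (fun ω => f ω x w) inferInstance
  | some (Sum.inl i) => MeasurableSpace.comap (ε (i + 1)) inferInstance
  | some (Sum.inr i) => MeasurableSpace.comap (ξ (i + 1)) inferInstance

end Model

/-! ### The algorithm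

Rounds are numbered `t = 1, 2, …`; the values of the processes at index `0` are never used.
After `n` rounds the data are `(x₁,w₁,y₁,β₁), …, (xₙ,wₙ,yₙ,βₙ)`. -/

section Algorithm

variable {Ω' : Type*} [MeasurableSpace Ω'] {d : ℕ} {W : Type*}

/-- `κ_t = (1 + ⌈b d r t² (√(log (a d |W|)) + √π / 2)⌉ ^ d) |W|`. -/
def kappa (a b r : ℝ) (d : ℕ) (W : Type*) [Fintype W] (t : ℕ) : ℝ :=
  (1 + (⌈b * d * r * (t : ℝ) ^ 2 *
    (Real.sqrt (Real.log (a * d * Fintype.card W)) + Real.sqrt Real.pi / 2)⌉₊ : ℝ) ^ d) *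
    Fintype.card W

/-- The random quantities produced by the algorithm: the estimated solutions `x̂_t`, the optimistic
maximizers `x̃_t`, the evaluated points `(x_t, w_t)`, and the bounds `lcb n`, `ucb n` computed
after `n` rounds. -/
structure Run (Ω' : Type*) (d : ℕ) (W : Type*) where
  xhat : ℕ → Ω' → Fin d → ℝ
  xtil : ℕ → Ω' → Fin d → ℝ
  x : ℕ → Ω' → Fin d → ℝ
  w : ℕ → Ω' → W
  lcb : ℕ → Ω' → (Fin d → ℝ) → ℝ
  ucb : ℕ → Ω' → (Fin d → ℝ) → ℝ

namespace Run

variable (R : Run Ω' d W)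

/-- Observation `y_t = f(x_t, w_t) + ε_t`. -/
def obs (f : Ω' → (Fin d → ℝ) → W → ℝ) (ε : ℕ → Ω' → ℝ) (t : ℕ) (ω : Ω') : ℝ :=
  f ω (R.x t ω) (R.w t ω) + ε t ω

/-- The first `n` evaluated inputs. -/
def inputs (n : ℕ) (ω : Ω') : Fin n → (Fin d → ℝ) × W :=
  fun i => (R.x (i + 1) ω, R.w (i + 1) ω)

/-- The dataset after `n` rounds. -/
def data (f : Ω' → (Fin d → ℝ) → W → ℝ) (ε β : ℕ → Ω' → ℝ) (n : ℕ) (ω : Ω') :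
    Fin n → (Fin d → ℝ) × W × ℝ × ℝ :=
  fun i => (R.x (i + 1) ω, R.w (i + 1) ω, R.obs f ε (i + 1) ω, β (i + 1) ω)

/-- Posterior mean `μ_n(x, w)` after `n` rounds. -/
def mu (k : (Fin d → ℝ) × W → (Fin d → ℝ) × W → ℝ) (v : ℝ≥0)
    (f : Ω' → (Fin d → ℝ) → W → ℝ) (ε : ℕ → Ω' → ℝ) (n : ℕ) (ω : Ω')
    (x : Fin d → ℝ) (w : W) : ℝ :=
  postMean k v (R.inputs n ω) (fun i : Fin n => R.obs f ε (i + 1) ω) (x, w)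

/-- Posterior standard deviation `σ_n(x, w)` after `n` rounds. -/
def sd (k : (Fin d → ℝ) × W → (Fin d → ℝ) × W → ℝ) (v : ℝ≥0) (n : ℕ) (ω : Ω')
    (x : Fin d → ℝ) (w : W) : ℝ :=
  postSd k v (R.inputs n ω) (x, w)

/-- `G_n(x)`: the functions `g` of the environmental variable with
`μ_n - √β_{n+1} σ_n ≤ g ≤ μ_n + √β_{n+1} σ_n` pointwise. -/
def credibleSet (k : (Fin d → ℝ) × W → (Fin d → ℝ) × W → ℝ) (v : ℝ≥0)
    (f : Ω' → (Fin d → ℝ) → W → ℝ) (ε β : ℕ → Ω' → ℝ) (n : ℕ) (ω : Ω')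
    (x : Fin d → ℝ) : Set (W → ℝ) :=
  {g | ∀ w, g w ∈ Set.Icc
    (R.mu k v f ε n ω x w - Real.sqrt (β (n + 1) ω) * R.sd k v n ω x w)
    (R.mu k v f ε n ω x w + Real.sqrt (β (n + 1) ω) * R.sd k v n ω x w)}

/-- The bounds `lcb_{t-1}`, `ucb_{t-1}` enclose the values of `ρ` on `G_{t-1}(x)`:
`lcb_{t-1}(x) ≤ inf ρ(g)` and `sup ρ(g) ≤ ucb_{t-1}(x)`, over `g ∈ G_{t-1}(x)`. -/
def BoundsValid (X : Set (Fin d → ℝ)) (k : (Fin d → ℝ) × W → (Fin d → ℝ) × W → ℝ) (v : ℝ≥0)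
    (f : Ω' → (Fin d → ℝ) → W → ℝ) (ε β : ℕ → Ω' → ℝ) (ρ : (W → ℝ) → ℝ)
    (P : Measure Ω') : Prop :=
  ∀ᵐ ω ∂P, ∀ n, ∀ x ∈ X,
    R.lcb n ω x ∈ lowerBounds (ρ '' R.credibleSet k v f ε β n ω x) ∧
    R.ucb n ω x ∈ upperBounds (ρ '' R.credibleSet k v f ε β n ω x)

/-- Width condition: `ucb_{t-1}(x_t) - lcb_{t-1}(x_t) ≤ q(2 √β_t max_w σ_{t-1}(x_t, w))`
for all `t ≥ 1`. -/
def WidthBound (k : (Fin d → ℝ) × W → (Fin d → ℝ) × W → ℝ) (v : ℝ≥0) (β : ℕ → Ω' → ℝ)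
    (q : ℝ → ℝ) (P : Measure Ω') : Prop :=
  ∀ᵐ ω ∂P, ∀ n, R.ucb n ω (R.x (n + 1) ω) - R.lcb n ω (R.x (n + 1) ω) ≤
    q (2 * Real.sqrt (β (n + 1) ω) * ⨆ w, R.sd k v n ω (R.x (n + 1) ω) w)

/-- `R` is an execution of the algorithm. In round `t = n + 1`,
* `x̂_t` is chosen from the past data only, and maximizes `ρ(μ_{t-1}(x, ·))` over `X`;
* `x̃_t` maximizes `(ucb_{t-1}(x) - max lcb_{t-1})₊` over `X`;
* `x_t ∈ {x̃_t, x̂_t}` has the larger `ucb_{t-1} - lcb_{t-1}`;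
* `w_t` maximizes `σ²_{t-1}(x_t, ·)`;
* `x_t` and `w_t` are chosen from the past data and `β_t`. -/
structure IsExecution [MeasurableSpace W] (X : Set (Fin d → ℝ))
    (k : (Fin d → ℝ) × W → (Fin d → ℝ) × W → ℝ) (v : ℝ≥0)
    (f : Ω' → (Fin d → ℝ) → W → ℝ) (ε β : ℕ → Ω' → ℝ) (ρ : (W → ℝ) → ℝ)
    (P : Measure Ω') : Prop where
  xhat_mem : ∀ n ω, R.xhat (n + 1) ω ∈ X
  xtil_mem : ∀ n ω, R.xtil (n + 1) ω ∈ X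
  x_mem : ∀ n ω, R.x (n + 1) ω ∈ X
  xhat_adapted : ∀ n, Measurable[MeasurableSpace.comap (R.data f ε β n) inferInstance]
    (R.xhat (n + 1))
  x_adapted : ∀ n, Measurable[MeasurableSpace.comap
    (fun ω => (R.data f ε β n ω, β (n + 1) ω)) inferInstance] (R.x (n + 1))
  w_adapted : ∀ n, Measurable[MeasurableSpace.comap
    (fun ω => (R.data f ε β n ω, β (n + 1) ω)) inferInstance] (R.w (n + 1))
  xhat_max : ∀ᵐ ω ∂P, ∀ n,
    IsMaxOn (fun x => ρ (R.mu k v f ε n ω x)) X (R.xhat (n + 1) ω)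
  xtil_max : ∀ᵐ ω ∂P, ∀ n,
    IsMaxOn (fun x => max (R.ucb n ω x - ⨆ x' : X, R.lcb n ω x') 0) X (R.xtil (n + 1) ω)
  x_choice : ∀ᵐ ω ∂P, ∀ n, R.x (n + 1) ω ∈ ({R.xtil (n + 1) ω, R.xhat (n + 1) ω} : Set _)
  x_max : ∀ᵐ ω ∂P, ∀ n, IsMaxOn (fun x => R.ucb n ω x - R.lcb n ω x)
    {R.xtil (n + 1) ω, R.xhat (n + 1) ω} (R.x (n + 1) ω)
  w_max : ∀ᵐ ω ∂P, ∀ n w,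
    postVar k v (R.inputs n ω) (R.x (n + 1) ω, w) ≤
      postVar k v (R.inputs n ω) (R.x (n + 1) ω, R.w (n + 1) ω)

/-- Cumulative regret `R_t = ∑_{i=1}^t (F(x*) - F(x̂_i))` with `F(x) = ρ(f(x, ·))`. -/
def cumRegret (f : Ω' → (Fin d → ℝ) → W → ℝ) (ρ : (W → ℝ) → ℝ) (xstar : Ω' → Fin d → ℝ)
    (t : ℕ) (ω : Ω') : ℝ :=
  ∑ i ∈ Finset.Icc 1 t, (ρ (f ω (xstar ω)) - ρ (f ω (R.xhat i ω)))

end Run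

end Algorithm

end

end RobustBO

open RobustBO

namespace RobustBO

set_option linter.unusedSectionVars false

/-! ### Concave moduli -/

namespace IsConcaveModulus

variable {h : ℝ → ℝ} (hh : IsConcaveModulus h)
include hh

/-! Fix a round `t` and a finite set `S ⊆ X`. Let `M` be the smallest value of `max_w |f(x*, w) -
f(s, w)|` over `s ∈ S ∪ {x̂_t}`, and let `D` be the largest gap `ρ(f(s, ·)) - ρ(f(x̂_t, ·))` over
the same points. The regret of the round is at most `q₁(M) + D`. If `S` is fine enough, the mean
value inequality and the tails of the partial derivatives give `E[M] ≤ 1/t²` (`exists_grid`).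
Jensen's inequality and `∑ 1/t² = π²/6` then produce the `q₁` term.

If the credible intervals hold at the `(1 + |S|)|W| ≤ κ_t` points `(S ∪ {x̂_t}) × W`, then `D ≤ V :=
2 q(2 √β_t σ_{t-1}(x_t, w_t))` by the selection rule (`sub_le_two_mul_width`). Given the past,
intervals of level `b ≥ 2 log κ_t` fail with probability at most `κ_t exp(-b/2)`, which is exactly
`P(β_t > b)`. This coincidence removes any failure term. Choose `b` from the past so that `P(β_t >
b)` slightly exceeds the conditional probability of `V > c`. If `D > c` and the intervals held at
`b`, they would hold at every larger level, so `V > c` whenever `β_t > b`, contrary to the choice of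
`b`. Thus `D > c` forces a failure at level `b`. It follows that `V` dominates `D` stochastically
(`measure_gt_le_measure_gt`) and `E[D] ≤ E[V]`. It is essential here that `x̂_t` is chosen without
`β_t`, whereas `x_t` may depend on it.

The posterior bound under adaptive sampling is proved by a change of measure. Replacing the
observations by pure noise costs a product of likelihoods (`lintegral_observations`), and under the
new law `f` is independent of the data and of the inputs computed from them
(`AdaptiveDesign.lintegral_posterior`). What remains is an inequality at a fixed design and fixed
data. At a fixed design the residual of the posterior mean is Gaussian and independent of the
observations, which gives the inequality for almost all data; semicontinuity extends it to all data.
This extension matters because the design varies with the data and each design has its own null set.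

It remains to sum `E[V]` over the rounds: Jensen's inequality for each `h_i`, Hölder's inequality in
probability and over the rounds, and the identity of `det(I + v⁻¹K)` with a product of `1 + v⁻¹σ²`,
which bounds `∑ σ²` by `C₁ γ_t` (`sum_postVar_le`). -/

theorem nonneg {x : ℝ} (hx : 0 ≤ x) : 0 ≤ h x := by
  have := hh.mono (Set.mem_Ici.2 le_rfl) (Set.mem_Ici.2 hx) hx
  rwa [hh.zero] at this

theorem le_linear {x : ℝ} (hx : 0 ≤ x) : h x ≤ h 1 * (1 + x) := by
  have h1 := hh.nonneg zero_le_one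
  rcases le_total x 1 with hx1 | hx1
  · have := hh.mono (Set.mem_Ici.2 hx) (Set.mem_Ici.2 zero_le_one) hx1
    nlinarith
  · have hx0 : 0 < x := by linarith
    have hc := hh.concave.2 (Set.mem_Ici.2 hx) (Set.mem_Ici.2 (le_refl (0 : ℝ)))
    have hx2 : 0 ≤ 1 - x⁻¹ := by
      have := inv_le_one_of_one_le₀ hx1; linarith
    -- Concavity at `1 = x⁻¹ · x + (1 - x⁻¹) · 0` gives `h x / x ≤ h 1`.
    have := hc (inv_nonneg.2 hx) hx2 (by ring)
    simp only [smul_eq_mul, hh.zero, mul_zero, add_zero, inv_mul_cancel₀ hx0.ne'] at this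
    rw [inv_mul_le_iff₀ hx0] at this
    nlinarith

/-- The slope is the supremum of the slopes to the right of `m`; every slope to the left bounds them
from above. Since `m > 0`, there is a point on the left. -/
theorem exists_supergradient {m : ℝ} (hm : 0 < m) :
    ∃ s : ℝ, ∀ x, 0 ≤ x → h x ≤ h m + s * (x - m) := by
  set S : Set ℝ := {y | ∃ x, m < x ∧ y = (h x - h m) / (x - m)} with hS
  have hne : S.Nonempty := ⟨_, m + 1, by linarith, rfl⟩
  have key : ∀ x, 0 ≤ x → x < m → ∀ y ∈ S, y ≤ (h m - h x) / (m - x) := by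
    rintro x hx hxm y ⟨z, hz, rfl⟩
    exact hh.concave.slope_anti_adjacent (Set.mem_Ici.2 hx)
      (Set.mem_Ici.2 (hm.le.trans hz.le)) hxm hz
  have hbdd : BddAbove S := ⟨_, fun y hy => key 0 le_rfl hm y hy⟩
  refine ⟨sSup S, fun x hx => ?_⟩
  rcases lt_trichotomy x m with hxm | rfl | hxm
  · have := csSup_le hne (key x hx hxm)
    rw [le_div_iff₀ (by linarith)] at this
    linarith
  · simp
  · have := le_csSup hbdd ⟨x, hxm, rfl⟩
    rw [div_le_iff₀ (by linarith)] at this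
    linarith

/-- Nothing is known about `h` on the negative axis, so measurability is obtained for the monotone
function `h (max x 0)`. -/
theorem measurable_comp_max : Measurable fun x => h (max x 0) := by
  apply Monotone.measurable
  intro x y hxy
  exact hh.mono (Set.mem_Ici.2 (le_max_right _ _)) (Set.mem_Ici.2 (le_max_right _ _))
    (max_le_max_right 0 hxy)

/-! ### Jensen's inequality for concave moduli -/

section Jensen

variable {α : Type*} [MeasurableSpace α] {μ : Measure α} [IsProbabilityMeasure μ] {M : α → ℝ}

theorem integrable_comp (hM : Integrable M μ) (h0 : ∀ᵐ a ∂μ, 0 ≤ M a) :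
    Integrable (fun a => h (M a)) μ := by
  have hae : (fun a => h (M a)) =ᵐ[μ] fun a => h (max (M a) 0) := by
    filter_upwards [h0] with a ha using by rw [max_eq_left ha]
  refine Integrable.mono' (g := fun a => h 1 * (1 + M a))
    (((integrable_const 1).add hM).const_mul _) ?_ ?_
  · exact AEStronglyMeasurable.congr
      (hh.measurable_comp_max.comp_aemeasurable hM.aemeasurable).aestronglyMeasurable hae.symm
  · filter_upwards [h0] with a ha
    rw [Real.norm_eq_abs, abs_of_nonneg (hh.nonneg ha)]
    exact hh.le_linear ha

theorem integral_comp_le (hM : Integrable M μ) (h0 : ∀ᵐ a ∂μ, 0 ≤ M a) :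
    ∫ a, h (M a) ∂μ ≤ h (∫ a, M a ∂μ) := by
  have hm : 0 ≤ ∫ a, M a ∂μ := integral_nonneg_of_ae h0
  rcases hm.eq_or_lt with hm | hm
  -- A supergradient may fail to exist at `0` (as for the square root), but then `M` vanishes almost
  -- surely.
  · have : M =ᵐ[μ] 0 := (integral_eq_zero_iff_of_nonneg_ae h0 hM).1 hm.symm
    rw [← hm, hh.zero]
    have h2 : (fun a => h (M a)) =ᵐ[μ] fun _ => 0 := by
      filter_upwards [this] with a ha
      rw [ha, Pi.zero_apply, hh.zero]
    rw [integral_congr_ae h2]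
    simp
  · obtain ⟨s, hs⟩ := hh.exists_supergradient hm
    calc ∫ a, h (M a) ∂μ
        ≤ ∫ a, (h (∫ a, M a ∂μ) + s * (M a - ∫ a, M a ∂μ)) ∂μ := by
          apply integral_mono_ae (hh.integrable_comp hM h0)
          · exact (integrable_const _).add ((hM.sub (integrable_const _)).const_mul _)
          · filter_upwards [h0] with a ha using hs _ ha
      _ = h (∫ a, M a ∂μ) := by
          have h1 : Integrable (fun a => M a - ∫ a, M a ∂μ) μ := hM.sub (integrable_const _)
          rw [integral_add (integrable_const _) (h1.const_mul s),
            integral_const_mul, integral_sub hM (integrable_const _)]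
          simp

theorem sum_le {ι : Type*} (s : Finset ι) (hs : s.Nonempty) {x : ι → ℝ} (hx : ∀ i ∈ s, 0 ≤ x i) :
    ∑ i ∈ s, h (x i) ≤ s.card * h (1 / s.card * ∑ i ∈ s, x i) := by
  have hc : (0 : ℝ) < s.card := by exact_mod_cast hs.card_pos
  have := hh.concave.le_map_sum (t := s) (w := fun _ => 1 / (s.card : ℝ)) (p := x)
    (fun _ _ => by positivity) (by simp [hc.ne']) (fun i hi => Set.mem_Ici.2 (hx i hi))
  simp only [smul_eq_mul, ← Finset.mul_sum] at this
  rw [one_div, inv_mul_le_iff₀ hc] at this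
  rwa [one_div]

end Jensen

end IsConcaveModulus

/-! ### Tails -/

theorem gaussianReal_Ioi_zero_le (v : ℝ≥0) :
    gaussianReal 0 v (Set.Ioi 0) ≤ 1 / 2 := by
  have h1 : gaussianReal 0 v (Set.Iio 0) = gaussianReal 0 v (Set.Ioi 0) := by
    conv_rhs => rw [← neg_zero, ← gaussianReal_map_neg]
    rw [Measure.map_apply measurable_neg measurableSet_Ioi]
    congr 1
    ext x; simp
  have h2 : gaussianReal 0 v (Set.Iio 0) + gaussianReal 0 v (Set.Ioi 0) ≤ 1 := by
    rw [← measure_union (by rw [Set.disjoint_left]; intro x hx hx'; exact lt_asymm (Set.mem_Iio.1 hx) (Set.mem_Ioi.1 hx'))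
      measurableSet_Ioi]
    exact prob_le_one
  rw [h1, ← two_mul] at h2
  rw [ENNReal.le_div_iff_mul_le (by simp) (by simp), mul_comm]
  exact h2

/-- One-sided Gaussian tail with the constant `1 / 2`. -/
theorem gaussianReal_Ioi_le {v : ℝ≥0} (hv : v ≠ 0) {s : ℝ} (hs : 0 ≤ s) :
    gaussianReal 0 v (Set.Ioi s) ≤ ENNReal.ofReal (Real.exp (-s ^ 2 / (2 * v))) * (1 / 2) := by
  have hvpos : (0 : ℝ) < v := by exact_mod_cast pos_iff_ne_zero.2 hv
  calc gaussianReal 0 v (Set.Ioi s)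
      = ∫⁻ x in Set.Ioi s, gaussianPDF 0 v x := gaussianReal_apply _ hv _
    _ = ∫⁻ x in Set.Ioi 0, gaussianPDF 0 v (x + s) := by
        rw [← lintegral_indicator measurableSet_Ioi, ← lintegral_indicator measurableSet_Ioi,
          ← lintegral_add_right_eq_self _ s]
        congr 1
        ext x
        simp [Set.indicator]
    -- For `x, s ≥ 0` one has `(x + s)² ≥ x² + s²`. The shifted density is thus at most
    -- `exp(-s²/2v)` times the original one, and the half line carries mass at most `1/2`.
    _ ≤ ∫⁻ x in Set.Ioi 0, ENNReal.ofReal (Real.exp (-s ^ 2 / (2 * v))) * gaussianPDF 0 v x := by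
        apply setLIntegral_mono ((measurable_gaussianPDF _ _).const_mul _)
        intro x hx
        rw [gaussianPDF, gaussianPDF, ← ENNReal.ofReal_mul (Real.exp_pos _).le]
        apply ENNReal.ofReal_le_ofReal
        rw [gaussianPDFReal, gaussianPDFReal, mul_left_comm, ← Real.exp_add, ← add_div]
        gcongr
        nlinarith [mul_nonneg hs (Set.mem_Ioi.1 hx).le]
    _ = ENNReal.ofReal (Real.exp (-s ^ 2 / (2 * v))) * gaussianReal 0 v (Set.Ioi 0) := by
        rw [lintegral_const_mul _ (measurable_gaussianPDF _ _), gaussianReal_apply _ hv]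
    _ ≤ _ := by gcongr; exact gaussianReal_Ioi_zero_le v

/-- Two-sided Gaussian tail. -/
theorem gaussianReal_abs_gt_le (v : ℝ≥0) {b : ℝ} (hb : 0 ≤ b) :
    gaussianReal 0 v {x | √b * √(v : ℝ) < |x|} ≤ ENNReal.ofReal (Real.exp (-b / 2)) := by
  rcases eq_or_ne v 0 with rfl | hv
  -- The posterior variance may vanish. The law is then the Dirac mass at `0`, which the strict
  -- inequality excludes.
  · have hm : MeasurableSet {x : ℝ | √b * √((0 : ℝ≥0) : ℝ) < |x|} :=
      (measurable_norm (α := ℝ)) measurableSet_Ioi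
    rw [gaussianReal_zero_var, Measure.dirac_apply' _ hm]
    simp
  have hvpos : (0 : ℝ) < v := by exact_mod_cast pos_iff_ne_zero.2 hv
  set s := √b * √(v : ℝ) with hsdef
  have hs : 0 ≤ s := by positivity
  have hs2 : -s ^ 2 / (2 * v) = -b / 2 := by
    rw [hsdef, mul_pow, Real.sq_sqrt hb, Real.sq_sqrt hvpos.le]; field_simp
  have hset : {x : ℝ | s < |x|} = Set.Ioi s ∪ Set.Iio (-s) := by
    ext x; simp only [Set.mem_ofPred_eq, lt_abs, Set.mem_union, Set.mem_Ioi, Set.mem_Iio]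
    constructor <;> rintro (h | h) <;> first | (left; linarith) | (right; linarith)
  have h1 : gaussianReal 0 v (Set.Iio (-s)) = gaussianReal 0 v (Set.Ioi s) := by
    conv_rhs => rw [← neg_zero, ← gaussianReal_map_neg]
    rw [Measure.map_apply measurable_neg measurableSet_Ioi]
    congr 1
    ext x; simp [lt_neg]
  rw [hset]
  refine (measure_union_le _ _).trans ?_
  rw [h1, ← two_mul, ← hs2]
  calc _ ≤ 2 * (ENNReal.ofReal (Real.exp (-s ^ 2 / (2 * v))) * (1 / 2)) := by
        gcongr; exact gaussianReal_Ioi_le hv hs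
    _ = _ := by
        rw [mul_left_comm, one_div, ENNReal.mul_inv_cancel (by simp) (by simp), mul_one]

theorem chiSquared_two : chiSquared 2 = expMeasure (1 / 2) := by
  unfold chiSquared expMeasure; norm_num

instance : IsProbabilityMeasure (chiSquared 2) := by
  rw [chiSquared_two]; exact isProbabilityMeasure_expMeasure (by norm_num)

/-- With two degrees of freedom the law is exponential of rate `1/2`. Its tail coincides with the
Gaussian failure bound `exp(-b/2)`, which is what makes the domination argument lossless. -/
theorem chiSquared_two_Ioi {s : ℝ} (hs : 0 ≤ s) :
    chiSquared 2 (Set.Ioi s) = ENNReal.ofReal (Real.exp (-s / 2)) := by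
  have h := cdf_expMeasure_eq (r := 1 / 2) (by norm_num) s
  rw [if_pos hs] at h
  have hp : IsProbabilityMeasure (expMeasure (1 / 2)) :=
    isProbabilityMeasure_expMeasure (by norm_num)
  rw [chiSquared_two, ← Set.compl_Iic, prob_compl_eq_one_sub measurableSet_Iic,
    ← ofReal_cdf, h, ← ENNReal.ofReal_one, ← ENNReal.ofReal_sub]
  · congr 1; ring_nf
  · have : Real.exp (-(1 / 2 * s)) ≤ 1 := Real.exp_le_one_iff.2 (by linarith)
    linarith

theorem chiSquared_two_Iio_zero : chiSquared 2 (Set.Iio 0) = 0 := by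
  have h := chiSquared_two_Ioi le_rfl
  simp only [neg_zero, zero_div, Real.exp_zero, ENNReal.ofReal_one] at h
  rw [← Set.compl_Iic, prob_compl_eq_one_sub measurableSet_Iic, ] at h
  have h2 : chiSquared 2 (Set.Iic 0) = 0 := by
    by_contra h0
    exact absurd h (ENNReal.sub_lt_self (by simp) (by simp) h0).ne
  exact measure_mono_null Set.Iio_subset_Iic_self h2

theorem ae_nonneg_chiSquared_two : ∀ᵐ x ∂chiSquared 2, 0 ≤ x := by
  rw [ae_iff]; simpa [← Set.Iio_def] using chiSquared_two_Iio_zero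

theorem integrable_chiSquared_two_rpow {c p : ℝ} (hp : 0 < p) :
    Integrable (fun x => (c + x) ^ p) (chiSquared 2) := by
  have hI : IntegrableOn (fun x => (c + x) ^ p * (1 / 2 * Real.exp (-(1 / 2 * x)))) (Set.Ioi 0) := by
    apply integrable_of_isBigO_exp_neg (b := 1 / 4) (by norm_num)
    · apply ContinuousOn.mul _ (by fun_prop)
      exact ContinuousOn.rpow_const (by fun_prop) fun x _ => Or.inr hp.le
    -- Half of the decay rate `1/2` absorbs the power, and the rate `1/4` is left over.
    · have h1 := ((isLittleO_rpow_exp_pos_mul_atTop p (b := 1 / 4) (by norm_num)).isBigO.comp_tendsto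
        (Filter.tendsto_atTop_add_const_left _ c Filter.tendsto_id))
      have h2 := h1.mul (Asymptotics.isBigO_refl (fun x : ℝ => 1 / 2 * Real.exp (-(1 / 2 * x)))
        Filter.atTop)
      refine h2.trans (Asymptotics.IsBigO.of_bound (Real.exp (c / 4)) (Filter.Eventually.of_forall
        fun x => ?_))
      simp only [Function.comp_apply, id_eq, Real.norm_eq_abs]
      rw [abs_of_pos (by positivity), abs_of_pos (by positivity), mul_left_comm, ← Real.exp_add,
        ← Real.exp_add]
      have : 0 < Real.exp (1 / 4 * (c + x) + -(1 / 2 * x)) := Real.exp_pos _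
      calc _ ≤ Real.exp (1 / 4 * (c + x) + -(1 / 2 * x)) := by linarith
        _ = _ := by congr 1; ring
  rw [chiSquared_two, expMeasure, gammaMeasure, integrable_withDensity_iff]
  · rw [← integrableOn_univ, ← Set.Iio_union_Ici (a := (0 : ℝ)), integrableOn_union]
    constructor
    · apply IntegrableOn.congr_fun integrableOn_zero _ measurableSet_Iio
      intro x hx
      simp [gammaPDF_of_neg (Set.mem_Iio.1 hx)]
    · rw [integrableOn_Ici_iff_integrableOn_Ioi]
      apply hI.congr_fun _ measurableSet_Ioi
      intro x hx
      simp only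
      rw [gammaPDF, ENNReal.toReal_ofReal (gammaPDFReal_nonneg one_pos (by norm_num) x),
        gammaPDFReal, if_pos (Set.mem_Ioi.1 hx).le]
      simp
  · exact (measurable_gammaPDFReal _ _).ennreal_ofReal
  · exact Filter.Eventually.of_forall fun x => by simp [gammaPDF]

/-! ### Change of measure for adaptively shifted Gaussian noise -/

/-- Density of `N(c, v)` with respect to `N(0, v)`. -/
noncomputable def likelihood (v : ℝ≥0) (c e : ℝ) : ℝ := Real.exp ((c * e - c ^ 2 / 2) / v)

@[fun_prop]
theorem measurable_likelihood {α : Type*} [MeasurableSpace α] (v : ℝ≥0) {c e : α → ℝ}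
    (hc : Measurable c) (he : Measurable e) : Measurable fun a => likelihood v (c a) (e a) := by
  unfold likelihood; fun_prop

theorem continuous_likelihood (v : ℝ≥0) (c : ℝ) : Continuous (likelihood v c) := by
  unfold likelihood; fun_prop

theorem likelihood_nonneg (v : ℝ≥0) (c e : ℝ) : 0 ≤ likelihood v c e := (Real.exp_pos _).le

/-- The maximum over the shift `c` is attained at `c = e`. Uniformity in `c` makes this a dominating
function, whatever the value of the process. -/
theorem likelihood_le (v : ℝ≥0) (c e : ℝ) : likelihood v c e ≤ Real.exp (e ^ 2 / 2 / v) := by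
  unfold likelihood
  gcongr
  nlinarith [sq_nonneg (c - e)]

/-- One-dimensional Cameron–Martin formula: completing the square turns the density of `N(c, v)`
into the likelihood times that of `N(0, v)`. -/
theorem lintegral_gaussianReal_add {v : ℝ≥0} (hv : v ≠ 0) (c : ℝ) {Ψ : ℝ → ℝ≥0∞}
    (hΨ : Measurable Ψ) :
    ∫⁻ e, Ψ (c + e) ∂gaussianReal 0 v =
      ∫⁻ e, Ψ e * ENNReal.ofReal (likelihood v c e) ∂gaussianReal 0 v := by
  have hvpos : (0 : ℝ) < v := by exact_mod_cast pos_iff_ne_zero.2 hv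
  rw [← lintegral_map (f := Ψ) (g := fun e => c + e) hΨ (by fun_prop), gaussianReal_map_const_add,
    zero_add, gaussianReal_of_var_ne_zero _ hv, gaussianReal_of_var_ne_zero _ hv,
    lintegral_withDensity_eq_lintegral_mul _ (measurable_gaussianPDF _ _) hΨ,
    lintegral_withDensity_eq_lintegral_mul _ (measurable_gaussianPDF _ _)
      (g := fun e => Ψ e * ENNReal.ofReal (likelihood v c e)) (by fun_prop)]
  congr 1
  ext x
  simp only [Pi.mul_apply, gaussianPDF]
  rw [mul_left_comm, mul_comm (Ψ x), ← ENNReal.ofReal_mul (gaussianPDFReal_nonneg _ _ _)]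
  congr 2
  rw [gaussianPDFReal, gaussianPDFReal, likelihood,
    mul_assoc (√(2 * Real.pi * v))⁻¹, ← Real.exp_add]
  congr 2
  field_simp
  ring

theorem lintegral_comp_prodMk_of_indepFun {Ω' α β : Type*} [MeasurableSpace Ω']
    [MeasurableSpace α] [MeasurableSpace β] {P : Measure Ω'} [IsProbabilityMeasure P]
    {X : Ω' → α} {Y : Ω' → β} (hX : Measurable X) (hY : Measurable Y) (h : IndepFun X Y P)
    {Ψ : α × β → ℝ≥0∞} (hΨ : Measurable Ψ) :
    ∫⁻ ω, Ψ (X ω, Y ω) ∂P = ∫⁻ ω, ∫⁻ y, Ψ (X ω, y) ∂(P.map Y) ∂P := by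
  have : IsProbabilityMeasure (P.map X) := Measure.isProbabilityMeasure_map hX.aemeasurable
  have : IsProbabilityMeasure (P.map Y) := Measure.isProbabilityMeasure_map hY.aemeasurable
  rw [← lintegral_map (f := Ψ) (g := fun ω => (X ω, Y ω)) hΨ (by fun_prop),
    (indepFun_iff_map_prod_eq_prod_map_map hX.aemeasurable hY.aemeasurable).1 h,
    lintegral_prod _ hΨ.aemeasurable, lintegral_map (hΨ.lintegral_prod_right') hX]

/-- The first `n` terms of a sequence, continued by zeros. -/
def trunc (n : ℕ) (y : ℕ → ℝ) : ℕ → ℝ := fun i => if i < n then y i else 0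

theorem trunc_succ (n : ℕ) (y : ℕ → ℝ) :
    trunc (n + 1) y = Function.update (trunc n y) n (y n) := by
  ext i
  simp only [trunc, Function.update_apply]
  split_ifs with h1 h2 h3 <;> first | rfl | omega | (subst h2; rfl)

theorem trunc_of_lt {n i : ℕ} (h : i < n) (y : ℕ → ℝ) : trunc n y i = y i := if_pos h

theorem trunc_trunc_of_le {m n : ℕ} (h : m ≤ n) (y : ℕ → ℝ) : trunc m (trunc n y) = trunc m y := by
  ext i
  simp only [trunc]
  split_ifs <;> first | rfl | omega

@[fun_prop]
theorem measurable_trunc (n : ℕ) : Measurable (trunc n) := by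
  refine measurable_pi_lambda _ fun i => ?_
  unfold trunc
  split_ifs <;> fun_prop

section Observations

variable {Ω' α : Type*} [MeasurableSpace Ω'] [MeasurableSpace α] {P : Measure Ω'}
  {S : Ω' → α} {E Y : ℕ → Ω' → ℝ} {G : ℕ → α × (ℕ → ℝ) → ℝ}

/-- Unrolling the recursion shows that the past observations involve only `S` and earlier noises,
hence are independent of the next noise. Truncated sequences keep histories of all lengths in one
type. -/
theorem exists_measurable_trunc_observations (hG : ∀ i, Measurable (G i)) (n : ℕ)
    (hY : ∀ᵐ ω ∂P, ∀ i < n, Y i ω = G i (S ω, trunc i (fun j => Y j ω)) + E i ω) :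
    ∃ H : α × (ℕ → ℝ) → (ℕ → ℝ), Measurable H ∧
      ∀ᵐ ω ∂P, trunc n (fun j => Y j ω) = H (S ω, trunc n (fun j => E j ω)) := by
  induction n with
  | zero =>
    refine ⟨fun _ _ => 0, by fun_prop, Filter.Eventually.of_forall fun ω => ?_⟩
    ext i; simp [trunc]
  | succ n ih =>
    obtain ⟨H, hH, hHY⟩ := ih (hY.mono fun ω hω i hi => hω i (hi.trans n.lt_succ_self))
    refine ⟨fun p => Function.update (H (p.1, trunc n p.2)) n
      (G n (p.1, H (p.1, trunc n p.2)) + p.2 n), ?_, ?_⟩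
    · have h1 : Measurable fun p : α × (ℕ → ℝ) => H (p.1, trunc n p.2) := by fun_prop
      have h2 : Measurable fun p : α × (ℕ → ℝ) => G n (p.1, H (p.1, trunc n p.2)) + p.2 n := by
        have := hG n
        fun_prop
      exact measurable_update'.comp (h1.prodMk h2)
    · filter_upwards [hHY, hY] with ω h1 h2
      rw [trunc_succ, h2 n n.lt_succ_self, h1, trunc_trunc_of_le (Nat.le_succ n), trunc_of_lt (Nat.lt_succ_self n)]

variable [IsProbabilityMeasure P] {v : ℝ≥0}

/-- The law of adaptively generated observations has the product of the one-step likelihoods as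
density with respect to the law of the noise. -/
theorem lintegral_observations (hv : v ≠ 0) (hS : Measurable S) (hE : ∀ i, Measurable (E i))
    (hEl : ∀ i, P.map (E i) = gaussianReal 0 v)
    (hind : ∀ n, IndepFun (fun ω => (S ω, trunc n (fun j => E j ω))) (E n) P)
    (hG : ∀ i, Measurable (G i))
    (hY : ∀ᵐ ω ∂P, ∀ i, Y i ω = G i (S ω, trunc i (fun j => Y j ω)) + E i ω) (n : ℕ)
    {Φ : α × (ℕ → ℝ) → ℝ≥0∞} (hΦ : Measurable Φ) :
    ∫⁻ ω, Φ (S ω, trunc n (fun j => Y j ω)) ∂P =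
      ∫⁻ ω, Φ (S ω, trunc n (fun j => E j ω)) * ∏ i ∈ Finset.range n,
        ENNReal.ofReal (likelihood v (G i (S ω, trunc i (fun j => E j ω))) (E i ω)) ∂P := by
  induction n generalizing Φ with
  | zero =>
    simp only [Finset.range_zero, Finset.prod_empty, mul_one]
    congr 1
  | succ n ih =>
    have hEs : Measurable fun ω => (fun j => E j ω) := by fun_prop
    have hX : Measurable fun ω => (S ω, trunc n (fun j => E j ω)) := by fun_prop
    have hup : Measurable fun q : (α × (ℕ → ℝ)) × ℝ => (q.1.1, Function.update q.1.2 n q.2) :=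
      (measurable_fst.comp measurable_fst).prodMk
        (measurable_update'.comp ((measurable_snd.comp measurable_fst).prodMk measurable_snd))
    set Ψ : (α × (ℕ → ℝ)) × ℝ → ℝ≥0∞ := fun q => Φ (q.1.1, Function.update q.1.2 n q.2) with hΨdef
    have hΨ : Measurable Ψ := hΦ.comp hup
    -- The last observation is integrated out: given the past it is `N(G n p, v)`, that is, `N(0,
    -- v)` weighted by one likelihood factor. The induction hypothesis is then applied to `Φ'`.
    set Φ' : α × (ℕ → ℝ) → ℝ≥0∞ := fun p =>
      ∫⁻ e, Ψ (p, e) * ENNReal.ofReal (likelihood v (G n p) e) ∂gaussianReal 0 v with hΦ'def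
    have hGn := hG n
    have hΨL : Measurable fun q : (α × (ℕ → ℝ)) × ℝ =>
      Ψ q * ENNReal.ofReal (likelihood v (G n q.1) q.2) := by fun_prop
    have hΦ' : Measurable Φ' := hΨL.lintegral_prod_right'
    obtain ⟨H, hH, hHY⟩ := exists_measurable_trunc_observations hG n
      (hY.mono fun ω hω i _ => hω i)
    have step1 : ∫⁻ ω, Φ (S ω, trunc (n + 1) (fun j => Y j ω)) ∂P =
        ∫⁻ ω, Φ' (S ω, trunc n (fun j => Y j ω)) ∂P := by
      set T : Ω' → α × (ℕ → ℝ) := fun ω => (S ω, H (S ω, trunc n (fun j => E j ω))) with hT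
      have hTm : Measurable T := by fun_prop
      have hTind : IndepFun T (E n) P :=
        (hind n).comp (φ := fun p => (p.1, H p)) (ψ := id) (by fun_prop) measurable_id
      calc ∫⁻ ω, Φ (S ω, trunc (n + 1) (fun j => Y j ω)) ∂P
          = ∫⁻ ω, Ψ (T ω, G n (T ω) + E n ω) ∂P := by
            apply lintegral_congr_ae
            filter_upwards [hHY, hY] with ω h1 h2
            simp only [hΨdef, hT]
            rw [trunc_succ, h2 n, h1]
        _ = ∫⁻ ω, ∫⁻ e, Ψ (T ω, G n (T ω) + e) ∂gaussianReal 0 v ∂P := by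
            rw [← hEl n]
            exact lintegral_comp_prodMk_of_indepFun (Ψ := fun q => Ψ (q.1, G n q.1 + q.2)) hTm
              (hE n) hTind (by fun_prop)
        _ = ∫⁻ ω, Φ' (T ω) ∂P := by
            congr 1; ext ω
            exact lintegral_gaussianReal_add hv _ (Ψ := fun e => Ψ (T ω, e)) (by fun_prop)
        _ = _ := by
            apply lintegral_congr_ae
            filter_upwards [hHY] with ω h1
            rw [h1]
    have hprod : Measurable fun p : α × (ℕ → ℝ) => ∏ i ∈ Finset.range n,
        ENNReal.ofReal (likelihood v (G i (p.1, trunc i p.2)) (p.2 i)) := by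
      refine Finset.measurable_fun_prod _ fun i _ => ?_
      have := hG i
      fun_prop
    rw [step1, ih hΦ']
    -- The first `n` factors depend only on `S` and the first `n` noises, so they stay fixed while
    -- the noise of index `n` is integrated.
    have hprodeq : ∀ ω, ∏ i ∈ Finset.range n,
        ENNReal.ofReal (likelihood v (G i (S ω, trunc i (fun j => E j ω))) (E i ω)) =
        (fun p : α × (ℕ → ℝ) => ∏ i ∈ Finset.range n,
        ENNReal.ofReal (likelihood v (G i (p.1, trunc i p.2)) (p.2 i)))
          (S ω, trunc n (fun j => E j ω)) := by
      intro ω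
      refine Finset.prod_congr rfl fun i hi => ?_
      have hi' := Finset.mem_range.1 hi
      simp only
      rw [trunc_trunc_of_le hi'.le, trunc_of_lt hi']
    simp_rw [Finset.prod_range_succ, hprodeq]
    set D := fun p : α × (ℕ → ℝ) => ∏ i ∈ Finset.range n,
        ENNReal.ofReal (likelihood v (G i (p.1, trunc i p.2)) (p.2 i)) with hD
    symm
    calc _ = ∫⁻ ω, (fun q : (α × (ℕ → ℝ)) × ℝ =>
            Ψ q * ENNReal.ofReal (likelihood v (G n q.1) q.2) * D q.1)
            ((S ω, trunc n (fun j => E j ω)), E n ω) ∂P := by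
          congr 1; ext ω
          simp only [hΨdef]
          rw [trunc_succ]
          ring
      _ = ∫⁻ ω, ∫⁻ e, (fun q : (α × (ℕ → ℝ)) × ℝ =>
            Ψ q * ENNReal.ofReal (likelihood v (G n q.1) q.2) * D q.1)
            ((S ω, trunc n (fun j => E j ω)), e) ∂gaussianReal 0 v ∂P := by
          rw [← hEl n]
          exact lintegral_comp_prodMk_of_indepFun hX (hE n) (hind n)
            (hΨL.mul (hprod.comp measurable_fst))
      _ = _ := by
          congr 1; ext ω
          simp only
          rw [lintegral_mul_const _ (by fun_prop)]

end Observations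

/-! ### Posterior algebra -/

section PosteriorAlgebra

variable {Z : Type*} {k : Z → Z → ℝ} {v : ℝ≥0} {n : ℕ} {z : Fin n → Z}

theorem posDef_kernelMatrix_add (hK : (kernelMatrix k z).PosSemidef) (hv : v ≠ 0) :
    (kernelMatrix k z + (v : ℝ) • (1 : Matrix (Fin n) (Fin n) ℝ)).PosDef :=
  Matrix.PosDef.posSemidef_add hK
    (Matrix.PosDef.one.smul (by exact_mod_cast pos_iff_ne_zero.2 hv : (0 : ℝ) < v))

/-- The weights `k(p)ᵀ (K + v I)⁻¹` of the posterior mean. -/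
noncomputable def postWeight (k : Z → Z → ℝ) (v : ℝ≥0) {n : ℕ} (z : Fin n → Z) (p : Z) :
    Fin n → ℝ :=
  Matrix.vecMul (fun i => k p (z i)) (kernelMatrix k z + (v : ℝ) • 1)⁻¹

theorem postMean_eq_dotProduct (y : Fin n → ℝ) (p : Z) :
    postMean k v z y p = dotProduct (postWeight k v z p) y := by
  rw [postMean, Matrix.dotProduct_mulVec, postWeight]

theorem postVar_eq_sub (p : Z) :
    postVar k v z p = k p p - dotProduct (postWeight k v z p) (fun i => k p (z i)) := by
  rw [postVar, Matrix.dotProduct_mulVec, postWeight]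

/-- These are the normal equations of linear prediction; they are what makes the residual
uncorrelated with the observations. -/
theorem postWeight_vecMul (hK : (kernelMatrix k z).PosSemidef) (hv : v ≠ 0) (p : Z) :
    Matrix.vecMul (postWeight k v z p) (kernelMatrix k z + (v : ℝ) • 1) = fun i => k p (z i) := by
  rw [postWeight, Matrix.vecMul_vecMul, Matrix.nonsing_inv_mul, Matrix.vecMul_one]
  exact (Matrix.isUnit_iff_isUnit_det _).1 (posDef_kernelMatrix_add hK hv).isUnit

theorem postVar_le (hK : (kernelMatrix k z).PosSemidef) (hv : v ≠ 0) (p : Z) :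
    postVar k v z p ≤ k p p := by
  have := (posDef_kernelMatrix_add hK hv).inv.posSemidef.dotProduct_mulVec_nonneg
    (fun i => k p (z i))
  simp only [star_trivial] at this
  rw [postVar]
  linarith

end PosteriorAlgebra

/-! ### Fixed design -/

section FixedDesign

variable {Ω' : Type*} [MeasurableSpace Ω'] {P : Measure Ω'} {n : ℕ} {v : ℝ≥0}

theorem posSemidef_of_covariance {ι : Type*} [IsProbabilityMeasure P] {F : ι → Ω' → ℝ}
    {k : ι → ι → ℝ} (hF : ∀ i, MemLp (F i) 2 P) (hcov : ∀ i j, cov[F i, F j; P] = k i j)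
    {m : ℕ} (z : Fin m → ι) : (kernelMatrix k z).PosSemidef := by
  apply Matrix.PosSemidef.of_dotProduct_mulVec_nonneg
  · ext i j
    simp [kernelMatrix, ← hcov, covariance_comm]
  · intro x
    -- The quadratic form is the variance of `∑ xᵢ F(zᵢ)`.
    have : star x ⬝ᵥ (kernelMatrix k z).mulVec x =
        cov[fun ω => ∑ i, x i * F (z i) ω, fun ω => ∑ i, x i * F (z i) ω; P] := by
      rw [covariance_fun_sum_fun_sum (fun i => (hF _).const_mul _) (fun i => (hF _).const_mul _)]
      simp only [dotProduct, Matrix.mulVec, kernelMatrix, Matrix.of_apply, star_trivial,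
        covariance_const_mul_left, covariance_const_mul_right, hcov, Finset.mul_sum]
      refine Finset.sum_congr rfl fun i _ => Finset.sum_congr rfl fun j _ => by ring
    rw [this, covariance_self]
    · exact variance_nonneg _ _
    · exact (memLp_finsetSum Finset.univ fun i _ => (hF (z i)).const_mul (x i)).aemeasurable

/-- The index `none` is the point where the process is predicted and `some i` is the `i`-th input,
so that a single Gaussian vector carries both. -/
structure GaussianDesign (F : Option (Fin n) → Ω' → ℝ) (k : Option (Fin n) → Option (Fin n) → ℝ)
    (E : ℕ → Ω' → ℝ) (v : ℝ≥0) (P : Measure Ω') : Prop where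
  gaussian : HasGaussianLaw (fun ω o => F o ω) P
  measurable : ∀ o, Measurable (F o)
  mean : ∀ o, ∫ ω, F o ω ∂P = 0
  cov : ∀ o o', cov[F o, F o'; P] = k o o'
  noise_measurable : ∀ i, Measurable (E i)
  noise_law : ∀ i, P.map (E i) = gaussianReal 0 v
  noise_indep : ∀ m, IndepFun (fun ω => ((fun o => F o ω), trunc m (fun j => E j ω))) (E m) P
  indep : IndepFun (fun ω o => F o ω) (fun ω j => E j ω) P
  noise_iIndep : iIndepFun E P

namespace GaussianDesign

variable {F : Option (Fin n) → Ω' → ℝ} {k : Option (Fin n) → Option (Fin n) → ℝ}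
  {E : ℕ → Ω' → ℝ} [IsProbabilityMeasure P] (h : GaussianDesign F k E v P)
include h

theorem memLp (o : Option (Fin n)) : MemLp (F o) 2 P := (h.gaussian.eval o).memLp_two

theorem noise_gaussian (i : ℕ) : HasGaussianLaw (E i) P :=
  ⟨by rw [h.noise_law]; infer_instance⟩

theorem noise_memLp (i : ℕ) : MemLp (E i) 2 P := (h.noise_gaussian i).memLp_two

theorem noise_mean (i : ℕ) : ∫ ω, E i ω ∂P = 0 := by
  have := integral_map (μ := P) (h.noise_measurable i).aemeasurable
    (f := fun x : ℝ => x) aestronglyMeasurable_id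
  rw [← this, h.noise_law, integral_id_gaussianReal]

theorem noise_variance (i : ℕ) : Var[E i; P] = v := by
  have := variance_map (μ := P) (Y := E i) (X := id) aemeasurable_id
    (h.noise_measurable i).aemeasurable
  rw [h.noise_law, variance_id_gaussianReal] at this
  exact this.symm

theorem cov_noise (o : Option (Fin n)) (j : ℕ) : cov[F o, E j; P] = 0 := by
  have : IndepFun (F o) (E j) P :=
    h.indep.comp (φ := fun s : Option (Fin n) → ℝ => s o) (ψ := fun e : ℕ → ℝ => e j)
      (by fun_prop) (by fun_prop)
  exact this.covariance_eq_zero (h.memLp o) (h.noise_memLp j)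

theorem cov_noise_noise (i j : ℕ) : cov[E i, E j; P] = if i = j then (v : ℝ) else 0 := by
  split_ifs with hij
  · subst hij
    rw [covariance_self (h.noise_measurable i).aemeasurable, h.noise_variance]
  · exact (h.noise_iIndep.indepFun hij).covariance_eq_zero (h.noise_memLp i) (h.noise_memLp j)

theorem posSemidef : (kernelMatrix k (some : Fin n → Option (Fin n))).PosSemidef :=
  posSemidef_of_covariance h.memLp h.cov some

theorem cov_obs (o : Option (Fin n)) (j : Fin n) :
    cov[F o, fun ω => F (some j) ω + E j ω; P] = k o (some j) := by
  have := covariance_add_right (μ := P) (h.memLp o) (h.memLp (some j)) (h.noise_memLp j)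
  rw [h.cov, h.cov_noise, add_zero] at this
  exact this

theorem cov_obs_obs (i j : Fin n) :
    cov[fun ω => F (some i) ω + E i ω, fun ω => F (some j) ω + E j ω; P] =
      (kernelMatrix k (some : Fin n → Option (Fin n)) + (v : ℝ) • 1) i j := by
  have h1 := covariance_add_left (μ := P) (h.memLp (some i)) (h.noise_memLp i)
    (Z := fun ω => F (some j) ω + E j ω) ((h.memLp (some j)).add (h.noise_memLp j))
  have h2 := covariance_add_right (μ := P) (h.noise_memLp i) (h.memLp (some j)) (h.noise_memLp j)
  rw [h.cov_obs, show (fun ω => F (some j) ω + E j ω) = F (some j) + E j from rfl, h2,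
    covariance_comm (E i) (F (some j)), h.cov_noise, h.cov_noise_noise, zero_add] at h1
  refine h1.trans ?_
  simp [kernelMatrix, Matrix.one_apply, Fin.ext_iff]

/-- The residual of the posterior mean. -/
theorem cov_residual_obs (hv : v ≠ 0) (j : Fin n) :
    cov[fun ω => F none ω - postMean k v some (fun i : Fin n => F (some i) ω + E i ω) none,
      fun ω => F (some j) ω + E j ω; P] = 0 := by
  have hobs : ∀ i : Fin n, MemLp (fun ω => F (some i) ω + E i ω) 2 P := fun i =>
    (h.memLp (some i)).add (h.noise_memLp i)
  have hw := congrFun (postWeight_vecMul h.posSemidef hv none) j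
  simp only [postMean_eq_dotProduct, dotProduct]
  rw [covariance_fun_sub_left (h.memLp none)
    (memLp_finsetSum Finset.univ fun i _ => (hobs i).const_mul _) (hobs j), h.cov_obs,
    covariance_fun_sum_left (fun i => (hobs i).const_mul _) (hobs j)]
  simp only [covariance_const_mul_left, h.cov_obs_obs]
  -- The normal equations make the two covariances cancel.
  rw [← hw]
  simp [Matrix.vecMul, dotProduct]

/-- Residual and observations are a linear image of the Gaussian vector formed by process values and
noises. The residual is written as a family over `Unit` to fit the criterion for independence of
Gaussian families. -/
theorem hasGaussianLaw_residual_obs :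
    HasGaussianLaw (fun ω => ((fun _ : Unit => F none ω -
      postMean k v some (fun i : Fin n => F (some i) ω + E i ω) none),
      (fun j : Fin n => F (some j) ω + E j ω))) P := by
  have hE : HasGaussianLaw (fun ω => (fun i : Fin n => E i ω)) P :=
    iIndepFun.hasGaussianLaw (fun i : Fin n => h.noise_gaussian i)
      (h.noise_iIndep.precomp Fin.val_injective)
  have hFE : HasGaussianLaw (fun ω => ((fun o => F o ω), (fun i : Fin n => E i ω))) P :=
    IndepFun.hasGaussianLaw h.gaussian hE
      (h.indep.comp (φ := fun s : Option (Fin n) → ℝ => s)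
        (ψ := fun (e : ℕ → ℝ) (i : Fin n) => e i) (by fun_prop) (by fun_prop))
  set w := postWeight k v (some : Fin n → Option (Fin n)) none with hw
  let L : ((Option (Fin n) → ℝ) × (Fin n → ℝ)) →ₗ[ℝ] ((Unit → ℝ) × (Fin n → ℝ)) :=
    { toFun := fun q => (fun _ => q.1 none - dotProduct w (fun i => q.1 (some i) + q.2 i),
        fun j => q.1 (some j) + q.2 j)
      map_add' := by
        intro a b
        ext j
        · simp only [Prod.fst_add, Prod.snd_add, Pi.add_apply, dotProduct]
          rw [sub_add_sub_comm, ← Finset.sum_add_distrib]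
          congr 1
          refine Finset.sum_congr rfl fun i _ => by ring
        · simp only [Prod.fst_add, Prod.snd_add, Pi.add_apply]
          ring
      map_smul' := by
        intro c a
        ext j
        · simp only [Prod.smul_fst, Prod.smul_snd, Pi.smul_apply, smul_eq_mul, RingHom.id_apply,
            dotProduct, mul_sub, Finset.mul_sum]
          congr 1
          refine Finset.sum_congr rfl fun i _ => by ring
        · simp only [Prod.smul_snd, Prod.smul_fst, Pi.smul_apply, smul_eq_mul, RingHom.id_apply]
          ring }
  have := hFE.map_fun (LinearMap.toContinuousLinearMap L)
  simpa only [postMean_eq_dotProduct] using! this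

/-- Jointly Gaussian and uncorrelated families are independent. -/
theorem indepFun_residual_obs (hv : v ≠ 0) :
    IndepFun (fun ω => F none ω - postMean k v some (fun i : Fin n => F (some i) ω + E i ω) none)
      (fun ω => fun j : Fin n => F (some j) ω + E j ω) P := by
  have := h.hasGaussianLaw_residual_obs.indepFun_of_covariance_eval
    (X := fun (_ : Unit) ω => F none ω -
      postMean k v some (fun i : Fin n => F (some i) ω + E i ω) none)
    (Y := fun (j : Fin n) ω => F (some j) ω + E j ω) fun _ j => h.cov_residual_obs hv j
  exact this.comp (φ := fun s : Unit → ℝ => s ()) (ψ := fun y : Fin n → ℝ => y) (by fun_prop)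
    (by fun_prop)

theorem variance_residual (hv : v ≠ 0) :
    Var[fun ω => F none ω - postMean k v some (fun i : Fin n => F (some i) ω + E i ω) none; P] =
      postVar k v (some : Fin n → Option (Fin n)) none := by
  have hobs : ∀ i : Fin n, MemLp (fun ω => F (some i) ω + E i ω) 2 P := fun i =>
    (h.memLp (some i)).add (h.noise_memLp i)
  have hm : MemLp (fun ω => ∑ i : Fin n, postWeight k v (some : Fin n → Option (Fin n)) none i *
      (F (some i) ω + E i ω)) 2 P :=
    memLp_finsetSum Finset.univ fun i _ => (hobs i).const_mul _
  have hcov := h.cov_residual_obs hv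
  have hr : MemLp (fun ω => F none ω -
      postMean k v some (fun i : Fin n => F (some i) ω + E i ω) none) 2 P := by
    simp only [postMean_eq_dotProduct, dotProduct]
    exact (h.memLp none).sub hm
  rw [← covariance_self hr.aemeasurable]
  set r := fun ω => F none ω -
      postMean k v some (fun i : Fin n => F (some i) ω + E i ω) none with hrdef
  have hr' : r = fun ω => F none ω - ∑ i : Fin n,
      postWeight k v (some : Fin n → Option (Fin n)) none i * (F (some i) ω + E i ω) := by
    simp only [hrdef, postMean_eq_dotProduct, dotProduct]
  -- The residual is orthogonal to the observations, hence to the posterior mean.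
  have e1 : cov[r, r; P] = cov[r, F none; P] := by
    conv_lhs => rw [show cov[r, r; P] = cov[r, fun ω => F none ω - ∑ i : Fin n,
      postWeight k v (some : Fin n → Option (Fin n)) none i * (F (some i) ω + E i ω); P] by
      rw [← hr']]
    rw [covariance_fun_sub_right hr (h.memLp none) hm,
      covariance_fun_sum_right (fun i => (hobs i).const_mul _) hr]
    simp only [covariance_const_mul_right, hcov, mul_zero, Finset.sum_const_zero, sub_zero]
  rw [e1, hr', covariance_fun_sub_left (h.memLp none) hm (h.memLp none), h.cov,
    covariance_fun_sum_left (fun i => (hobs i).const_mul _) (h.memLp none), postVar_eq_sub]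
  congr 1
  simp only [covariance_const_mul_left, dotProduct]
  refine Finset.sum_congr rfl fun i _ => ?_
  rw [covariance_comm, h.cov_obs]

theorem postVar_nonneg (hv : v ≠ 0) :
    0 ≤ postVar k v (some : Fin n → Option (Fin n)) none := by
  rw [← h.variance_residual hv]; exact variance_nonneg _ _

theorem map_residual (hv : v ≠ 0) :
    P.map (fun ω => F none ω - postMean k v some (fun i : Fin n => F (some i) ω + E i ω) none) =
      gaussianReal 0 (postVar k v (some : Fin n → Option (Fin n)) none).toNNReal := by
  have h1 : HasGaussianLaw (fun ω => F none ω -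
      postMean k v some (fun i : Fin n => F (some i) ω + E i ω) none) P :=
    h.hasGaussianLaw_residual_obs.fst.eval ()
  rw [h1.map_eq_gaussianReal, h.variance_residual hv]
  congr 1
  have hobs : ∀ i : Fin n, Integrable (fun ω => F (some i) ω + E i ω) P := fun i =>
    ((h.memLp (some i)).add (h.noise_memLp i)).integrable one_le_two
  simp only [postMean_eq_dotProduct, dotProduct]
  rw [integral_sub ((h.memLp none).integrable one_le_two)
    (integrable_finsetSum _ fun i _ => (hobs i).const_mul _), h.mean,
    integral_finsetSum _ fun i _ => (hobs i).const_mul _]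
  simp only [integral_const_mul]
  simp [integral_add ((h.memLp _).integrable one_le_two) ((h.noise_memLp _).integrable one_le_two),
    h.mean, h.noise_mean]

end GaussianDesign

end FixedDesign

/-! ### Posterior confidence at a fixed design, for every data vector -/

section FixedDesignTail

variable {Ω' : Type*} [MeasurableSpace Ω'] {P : Measure Ω'} {n : ℕ} {v : ℝ≥0}

open Filter Topology in
/-- An inequality `f ≤ g` that holds almost everywhere for a measure charging open sets extends to
all points when `f` is lower semicontinuous and `g` is continuous. -/
theorem le_of_ae_le_of_tendsto {α : Type*} [TopologicalSpace α] [FrechetUrysohnSpace α]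
    [MeasurableSpace α] {ν : Measure α} [ν.IsOpenPosMeasure] {f g : α → ℝ≥0∞}
    (hfg : f ≤ᵐ[ν] g)
    (hf : ∀ (u : ℕ → α) (a : α), Tendsto u atTop (𝓝 a) → f a ≤ liminf (fun m => f (u m)) atTop)
    (hg : ∀ (u : ℕ → α) (a : α), Tendsto u atTop (𝓝 a) →
      Tendsto (fun m => g (u m)) atTop (𝓝 (g a))) (a : α) : f a ≤ g a := by
  have hd : Dense {x | f x ≤ g x} := Measure.dense_of_ae hfg
  obtain ⟨u, hu, hua⟩ := mem_closure_iff_seq_limit.1 (hd a)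
  calc f a ≤ liminf (fun m => f (u m)) atTop := hf u a hua
    _ ≤ liminf (fun m => g (u m)) atTop := liminf_le_liminf (Eventually.of_forall hu)
    _ = g a := (hg u a hua).liminf_eq

/-- The likelihood of the observations `e` at a fixed design. -/
noncomputable def designLikelihood (v : ℝ≥0) (s : Option (Fin n) → ℝ) (e : Fin n → ℝ) : ℝ≥0∞ :=
  ∏ i, ENNReal.ofReal (likelihood v (s (some i)) (e i))

@[fun_prop]
theorem measurable_designLikelihood {α : Type*} [MeasurableSpace α] {s : α → Option (Fin n) → ℝ}
    {e : α → Fin n → ℝ} (hs : Measurable s) (he : Measurable e) :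
    Measurable fun a => designLikelihood v (s a) (e a) := by
  unfold designLikelihood
  exact Finset.measurable_fun_prod _ fun i _ => by fun_prop

theorem continuous_designLikelihood (s : Option (Fin n) → ℝ) :
    Continuous (designLikelihood v s) := by
  -- Taking the product in `ℝ` first reduces continuity to that of real functions.
  have : designLikelihood v s = fun e =>
      ENNReal.ofReal (∏ i, likelihood v (s (some i)) (e i)) := by
    ext e
    rw [ENNReal.ofReal_prod_of_nonneg fun i _ => likelihood_nonneg _ _ _, designLikelihood]
  rw [this]
  exact ENNReal.continuous_ofReal.comp (continuous_finsetProd _ fun i _ =>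
    (continuous_likelihood v _).comp (continuous_apply i))

namespace GaussianDesign

variable {F : Option (Fin n) → Ω' → ℝ} {k : Option (Fin n) → Option (Fin n) → ℝ}
  {E : ℕ → Ω' → ℝ} [IsProbabilityMeasure P] (h : GaussianDesign F k E v P)
include h

/-- Bayes' formula without conditioning: under the noise law the data are independent of the
process, and the likelihood restores the true joint law. -/
theorem lintegral_obs (hv : v ≠ 0) {Φ : (Fin n → ℝ) × (Option (Fin n) → ℝ) → ℝ≥0∞}
    (hΦ : Measurable Φ) :
    ∫⁻ ω, Φ (fun i => F (some i) ω + E i ω, fun o => F o ω) ∂P =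
      ∫⁻ e, ∫⁻ ω, Φ (e, fun o => F o ω) * designLikelihood v (fun o => F o ω) e ∂P
        ∂(P.map fun ω (i : Fin n) => E i ω) := by
  have hF := h.measurable
  have hE := h.noise_measurable
  have hS : Measurable fun ω => (fun o => F o ω) := by fun_prop
  have hEv : Measurable fun ω => (fun i : Fin n => E i ω) := by fun_prop
  -- A fixed design is the special case in which the signal ignores the past. From index `n` on the
  -- signal is `0`, and those observations are never used.
  let G : ℕ → (Option (Fin n) → ℝ) × (ℕ → ℝ) → ℝ := fun i p =>
    if hi : i < n then p.1 (some ⟨i, hi⟩) else 0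
  have hG : ∀ i, Measurable (G i) := by
    intro i
    by_cases hi : i < n
    · simp only [G, hi, dif_pos]; fun_prop
    · simp only [G, hi, dif_neg, not_false_iff]; fun_prop
  let Y : ℕ → Ω' → ℝ := fun i ω => G i (fun o => F o ω, trunc i fun _ => 0) + E i ω
  have hGi : ∀ (i : Fin n) (s : Option (Fin n) → ℝ) y, G i (s, y) = s (some i) := by
    intro i s y; simp [G]
  have key := lintegral_observations (Y := Y) hv hS hE h.noise_law h.noise_indep hG
    (Filter.Eventually.of_forall fun ω i => rfl) n
    (Φ := fun p => Φ (fun i : Fin n => p.2 i, p.1)) (by fun_prop)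
  have e1 : ∀ ω, (fun i : Fin n => trunc n (fun j => Y j ω) i) =
      fun i : Fin n => F (some i) ω + E i ω := by
    intro ω; ext i
    rw [trunc_of_lt i.2]
    simp only [Y]
    rw [hGi]
  have e2 : ∀ ω, (fun i : Fin n => trunc n (fun j => E j ω) i) = fun i : Fin n => E i ω := by
    intro ω; ext i
    rw [trunc_of_lt i.2]
  simp only [e1, e2, Finset.prod_range, hGi] at key
  rw [key]
  have hind : IndepFun (fun ω => (fun i : Fin n => E i ω)) (fun ω => (fun o => F o ω)) P :=
    (h.indep.comp (φ := fun s : Option (Fin n) → ℝ => s)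
        (ψ := fun (e : ℕ → ℝ) (i : Fin n) => e i) (by fun_prop) (by fun_prop)).symm
  have hΨ : Measurable fun q : (Fin n → ℝ) × (Option (Fin n) → ℝ) =>
    Φ q * designLikelihood v q.2 q.1 := by fun_prop
  have := lintegral_comp_prodMk_of_indepFun hEv hS hind hΨ
  refine this.trans ?_
  rw [← lintegral_map (μ := P) (g := fun ω => (fun i : Fin n => E i ω))
    (f := fun e => ∫⁻ s, Φ (e, s) * designLikelihood v s e ∂(P.map fun ω o => F o ω))
    hΨ.lintegral_prod_right' hEv]
  congr 1; ext e
  exact lintegral_map (hΨ.comp measurable_prodMk_left) hS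

theorem isOpenPosMeasure_noise (hv : v ≠ 0) :
    (P.map fun ω (i : Fin n) => E i ω).IsOpenPosMeasure := by
  have := iIndepFun.map_fun_eq_pi_map (μ := P) (f := fun i : Fin n => E i)
    (fun i => (h.noise_measurable i).aemeasurable) (h.noise_iIndep.precomp Fin.val_injective)
  rw [this]
  simp only [h.noise_law]
  have : (gaussianReal 0 v).IsOpenPosMeasure :=
    (gaussianReal_absolutelyContinuous' 0 hv).isOpenPosMeasure
  infer_instance

/-- The event that the posterior confidence interval fails. -/
def tailSet (k : Option (Fin n) → Option (Fin n) → ℝ) (v : ℝ≥0) (b : ℝ) :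
    Set ((Fin n → ℝ) × (Option (Fin n) → ℝ)) :=
  {q | √b * postSd k v some none < |q.2 none - postMean k v some q.1 none|}

omit h in
theorem isOpen_tailSet (b : ℝ) : IsOpen (tailSet k v b) := by
  have hcont : Continuous fun q : (Fin n → ℝ) × (Option (Fin n) → ℝ) =>
      |q.2 none - postMean k v some q.1 none| := by
    simp only [postMean_eq_dotProduct, dotProduct]
    fun_prop
  exact isOpen_lt continuous_const hcont

omit h in
theorem measurable_indicator_tailSet (b : ℝ) :
    Measurable ((tailSet k v b).indicator
      (1 : (Fin n → ℝ) × (Option (Fin n) → ℝ) → ℝ≥0∞)) :=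
  measurable_one.indicator (isOpen_tailSet b).measurableSet

/-- The residual is independent of the observations, so its tail factors out of any weight `u` of
them. This is the conditional bound in integrated form. -/
theorem lintegral_obs_tail_le (hv : v ≠ 0) {b : ℝ} (hb : 0 ≤ b) {u : (Fin n → ℝ) → ℝ≥0∞}
    (hu : Measurable u) :
    ∫⁻ ω, u (fun i => F (some i) ω + E i ω) *
        (tailSet k v b).indicator 1 (fun i => F (some i) ω + E i ω, fun o => F o ω) ∂P ≤
      ENNReal.ofReal (Real.exp (-b / 2)) * ∫⁻ ω, u (fun i => F (some i) ω + E i ω) ∂P := by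
  have hF := h.measurable
  have hE := h.noise_measurable
  set r := fun ω => F none ω - postMean k v some (fun i : Fin n => F (some i) ω + E i ω) none
    with hr
  have hrm : Measurable r := by
    simp only [hr, postMean_eq_dotProduct, dotProduct]; fun_prop
  set D : Set ℝ := {x | √b * √((postVar k v (some : Fin n → Option (Fin n)) none).toNNReal : ℝ)
    < |x|} with hD
  have hDm : MeasurableSet D := (measurable_norm (α := ℝ)) measurableSet_Ioi
  have hD1 : Measurable (D.indicator (1 : ℝ → ℝ≥0∞)) := measurable_one.indicator hDm
  have hBD : ∀ ω, (tailSet k v b).indicator (1 : (Fin n → ℝ) × (Option (Fin n) → ℝ) → ℝ≥0∞)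
      (fun i => F (some i) ω + E i ω, fun o => F o ω) = D.indicator 1 (r ω) := by
    intro ω
    have : (fun i => F (some i) ω + E i ω, fun o => F o ω) ∈ tailSet k v b ↔ r ω ∈ D := by
      simp only [tailSet, hD, Set.mem_ofPred_eq, postSd,
        Real.coe_toNNReal _ (h.postVar_nonneg hv), hr]
    by_cases h1 : r ω ∈ D
    · rw [Set.indicator_of_mem h1, Set.indicator_of_mem (this.2 h1)]; rfl
    · rw [Set.indicator_of_notMem h1, Set.indicator_of_notMem (fun h2 => h1 (this.1 h2))]
  simp only [hBD]
  have hobs : Measurable fun ω => (fun i : Fin n => F (some i) ω + E i ω) := by fun_prop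
  have := lintegral_comp_prodMk_of_indepFun hobs hrm (h.indepFun_residual_obs hv).symm
    (Ψ := fun q => u q.1 * D.indicator 1 q.2) (by fun_prop)
  rw [this, h.map_residual hv, ← lintegral_const_mul _ (by fun_prop)]
  refine lintegral_mono fun ω => ?_
  simp only
  rw [lintegral_const_mul _ hD1, lintegral_indicator_one hDm, mul_comm]
  gcongr
  exact gaussianReal_abs_gt_le _ hb

theorem measurable_designLikelihood_process (e : Fin n → ℝ) :
    Measurable fun ω => designLikelihood v (fun o => F o ω) e := by
  have hF := h.measurable
  fun_prop

theorem measurable_tail_mul_likelihood (b : ℝ) :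
    Measurable fun q : (Fin n → ℝ) × Ω' => (tailSet k v b).indicator 1 (q.1, fun o => F o q.2) *
      designLikelihood v (fun o => F o q.2) q.1 := by
  have hF := h.measurable
  have hB := measurable_indicator_tailSet (k := k) (v := v) b
  fun_prop

/-- Both sides are tested against sets `C` of data. By `lintegral_obs` the two integrals over `C`
become expectations under the true law, where the tail bound with weight `1_C` applies. -/
theorem ae_lintegral_tail_le (hv : v ≠ 0) {b : ℝ} (hb : 0 ≤ b) :
    (fun e => ∫⁻ ω, (tailSet k v b).indicator 1 (e, fun o => F o ω) *
        designLikelihood v (fun o => F o ω) e ∂P) ≤ᵐ[P.map fun ω (i : Fin n) => E i ω]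
      fun e => ENNReal.ofReal (Real.exp (-b / 2)) *
        ∫⁻ ω, designLikelihood v (fun o => F o ω) e ∂P := by
  have hE := h.noise_measurable
  have hEv : Measurable fun ω => (fun i : Fin n => E i ω) := by fun_prop
  have : IsProbabilityMeasure (P.map fun ω (i : Fin n) => E i ω) :=
    Measure.isProbabilityMeasure_map hEv.aemeasurable
  have hm := h.measurable_tail_mul_likelihood (v := v) b
  apply ae_le_of_forall_setLIntegral_le_of_sigmaFinite hm.lintegral_prod_right'
  intro C hC _
  have hC1 : Measurable (C.indicator (1 : (Fin n → ℝ) → ℝ≥0∞)) := measurable_one.indicator hC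
  have hB1 := measurable_indicator_tailSet (k := k) (v := v) b
  have k1 := h.lintegral_obs hv (Φ := fun q => C.indicator 1 q.1 * (tailSet k v b).indicator 1 q)
    (by fun_prop)
  have k2 := h.lintegral_obs hv (Φ := fun q => C.indicator 1 q.1) (by fun_prop)
  have hpull : ∀ u : (Fin n → ℝ) → Ω' → ℝ≥0∞, (∀ e, Measurable (u e)) →
      ∫⁻ e in C, ∫⁻ ω, u e ω ∂P ∂(P.map fun ω (i : Fin n) => E i ω) =
      ∫⁻ e, ∫⁻ ω, C.indicator 1 e * u e ω ∂P ∂(P.map fun ω (i : Fin n) => E i ω) := by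
    intro u hu
    rw [← lintegral_indicator hC]
    congr 1; ext e
    rw [lintegral_const_mul _ (hu e)]
    by_cases he : e ∈ C <;> simp [he]
  simp only
  rw [hpull (fun e ω => (tailSet k v b).indicator 1 (e, fun o => F o ω) *
    designLikelihood v (fun o => F o ω) e) (fun e => hm.comp measurable_prodMk_left),
    lintegral_const_mul',
    hpull _ h.measurable_designLikelihood_process]
  · simp only [mul_assoc] at k1
    rw [← k1, ← k2]
    exact h.lintegral_obs_tail_le hv hb hC1
  · exact ENNReal.ofReal_ne_top

open Filter Topology in
/-- At a fixed design and for fixed observations, the posterior probability that the confidence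
interval fails is at most `exp (-b / 2)`. -/
theorem lintegral_tail_le (hv : v ≠ 0) {b : ℝ} (hb : 0 ≤ b) (e : Fin n → ℝ) :
    ∫⁻ ω, (tailSet k v b).indicator 1 (e, fun o => F o ω) *
        designLikelihood v (fun o => F o ω) e ∂P ≤
      ENNReal.ofReal (Real.exp (-b / 2)) * ∫⁻ ω, designLikelihood v (fun o => F o ω) e ∂P := by
  have : (P.map fun ω (i : Fin n) => E i ω).IsOpenPosMeasure := h.isOpenPosMeasure_noise hv
  refine le_of_ae_le_of_tendsto (h.ae_lintegral_tail_le hv hb) ?_ ?_ e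
  · intro u a hu
    -- Fatou's lemma: the tail set is open, so its indicator is lower semicontinuous in the data.
    refine le_trans (lintegral_mono fun ω => ?_) (lintegral_liminf_le fun m =>
      (h.measurable_tail_mul_likelihood b).comp measurable_prodMk_left)
    have hlik := ((continuous_designLikelihood (v := v) (fun o => F o ω)).tendsto a).comp hu
    by_cases hm : (a, fun o => F o ω) ∈ tailSet k v b
    · have hev : ∀ᶠ m in atTop, (u m, fun o => F o ω) ∈ tailSet k v b :=
        (hu.prodMk_nhds tendsto_const_nhds).eventually ((isOpen_tailSet b).mem_nhds hm)
      rw [Set.indicator_of_mem hm, Pi.one_apply, one_mul, ← hlik.liminf_eq]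
      apply le_of_eq
      apply liminf_congr
      filter_upwards [hev] with m hm'
      simp only [Function.comp_apply]
      rw [Set.indicator_of_mem hm', Pi.one_apply, one_mul]
    · rw [Set.indicator_of_notMem hm, zero_mul]
      exact zero_le
  · intro u a hu
    refine ENNReal.Tendsto.const_mul ?_ (Or.inr ENNReal.ofReal_ne_top)
    -- A convergent sequence of data is bounded, and the likelihood bound is uniform in the process.
    -- A constant therefore dominates.
    obtain ⟨R, hR⟩ := (Metric.isBounded_range_of_tendsto u hu).exists_norm_le
    refine tendsto_lintegral_of_dominated_convergence
      (fun _ => ∏ _i : Fin n, ENNReal.ofReal (Real.exp (R ^ 2 / 2 / v)))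
      (fun m => h.measurable_designLikelihood_process (u m))
      (fun m => Eventually.of_forall fun ω => ?_) ?_ (Eventually.of_forall fun ω => ?_)
    · refine Finset.prod_le_prod' fun i _ => ENNReal.ofReal_le_ofReal ?_
      refine (likelihood_le _ _ _).trans ?_
      have h1 : |u m i| ≤ R := (norm_le_pi_norm (u m) i).trans (hR _ ⟨m, rfl⟩)
      have h2 : u m i ^ 2 ≤ R ^ 2 := sq_le_sq' (abs_le.1 h1).1 (abs_le.1 h1).2
      exact Real.exp_le_exp.2 (div_le_div_of_nonneg_right (div_le_div_of_nonneg_right h2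
        zero_le_two) v.coe_nonneg)
    · rw [lintegral_const, measure_univ, mul_one]
      exact ENNReal.prod_ne_top fun i _ => ENNReal.ofReal_ne_top
    · exact ((continuous_designLikelihood (v := v) (fun o => F o ω)).tendsto a).comp hu

end GaussianDesign

end FixedDesignTail

/-! ### Measurability of the posterior -/

section PosteriorMeasurable

variable {Z α : Type*} [MeasurableSpace Z] [MeasurableSpace α] {k : Z → Z → ℝ} {n : ℕ}
  {z : Fin n → α → Z} {p : α → Z}

theorem measurable_matrix_det {M : α → Matrix (Fin n) (Fin n) ℝ}
    (hM : ∀ i j, Measurable fun a => M a i j) : Measurable fun a => (M a).det := by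
  simp only [Matrix.det_apply]
  refine Finset.measurable_fun_sum _ fun σ _ => ?_
  exact (Finset.measurable_fun_prod _ fun i _ => hM _ _).const_smul _

/-- The adjugate formula makes each entry a polynomial divided by the determinant, with the value
`0` at singular matrices on both sides. -/
theorem measurable_matrix_inv {M : α → Matrix (Fin n) (Fin n) ℝ}
    (hM : ∀ i j, Measurable fun a => M a i j) (i j : Fin n) :
    Measurable fun a => (M a)⁻¹ i j := by
  simp only [Matrix.inv_def, Matrix.smul_apply, Ring.inverse_eq_inv', smul_eq_mul,
    Matrix.adjugate_apply]
  refine (measurable_matrix_det hM).inv.mul (measurable_matrix_det fun i' j' => ?_)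
  simp only [Matrix.updateRow_apply]
  split_ifs
  · fun_prop
  · exact hM _ _

theorem measurable_postWeight (hk : Measurable fun q : Z × Z => k q.1 q.2) (v : ℝ≥0)
    (hz : ∀ i, Measurable (z i)) (hp : Measurable p) (i : Fin n) :
    Measurable fun a => postWeight k v (fun i => z i a) (p a) i := by
  simp only [postWeight, Matrix.vecMul, dotProduct]
  refine Finset.measurable_fun_sum _ fun j _ => ?_
  refine (hk.comp (hp.prodMk (hz j))).mul (measurable_matrix_inv (fun i' j' => ?_) _ _)
  simp only [kernelMatrix, Matrix.add_apply, Matrix.of_apply]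
  exact (hk.comp ((hz i').prodMk (hz j'))).add_const _

theorem measurable_postMean (hk : Measurable fun q : Z × Z => k q.1 q.2) (v : ℝ≥0)
    (hz : ∀ i, Measurable (z i)) {y : α → Fin n → ℝ} (hy : Measurable y) (hp : Measurable p) :
    Measurable fun a => postMean k v (fun i => z i a) (y a) (p a) := by
  simp only [postMean_eq_dotProduct, dotProduct]
  refine Finset.measurable_fun_sum _ fun i _ => ?_
  have := measurable_postWeight hk v hz hp i
  fun_prop

theorem measurable_postSd (hk : Measurable fun q : Z × Z => k q.1 q.2) (v : ℝ≥0)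
    (hz : ∀ i, Measurable (z i)) (hp : Measurable p) :
    Measurable fun a => postSd k v (fun i => z i a) (p a) := by
  simp only [postSd, postVar_eq_sub, dotProduct]
  refine Measurable.sqrt ((hk.comp (hp.prodMk hp)).sub (Finset.measurable_fun_sum _ fun i _ => ?_))
  exact (measurable_postWeight hk v hz hp i).mul (hk.comp (hp.prodMk (hz i)))

end PosteriorMeasurable

/-! ### Adaptive design -/

section AdaptiveDesign

variable {Ω' 𝔸 Z : Type*} [MeasurableSpace Ω'] [MeasurableSpace 𝔸] [MeasurableSpace Z]

/-- A Gaussian process `g (A ·)` observed with noise `E` at inputs `Zf i` that depend on the earlier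
observations and on auxiliary randomness `U`. -/
structure AdaptiveDesign (k : Z → Z → ℝ) (v : ℝ≥0) (A : Ω' → 𝔸) (g : 𝔸 × Z → ℝ)
    (U : Ω' → ℕ → ℝ) (E Y : ℕ → Ω' → ℝ) (Zf : ℕ → (ℕ → ℝ) × (ℕ → ℝ) → Z) (P : Measure Ω') :
    Prop where
  kernel_measurable : Measurable fun q : Z × Z => k q.1 q.2
  A_measurable : Measurable A
  g_measurable : Measurable g
  U_measurable : Measurable U
  noise_measurable : ∀ i, Measurable (E i)
  input_measurable : ∀ i, Measurable (Zf i)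
  gaussian : ∀ n (q : Option (Fin n) → Z), HasGaussianLaw (fun ω o => g (A ω, q o)) P
  mean : ∀ z, ∫ ω, g (A ω, z) ∂P = 0
  cov : ∀ z z', cov[fun ω => g (A ω, z), fun ω => g (A ω, z'); P] = k z z'
  noise_law : ∀ i, P.map (E i) = gaussianReal 0 v
  noise_indep : ∀ m, IndepFun (fun ω => ((A ω, U ω), trunc m (fun j => E j ω))) (E m) P
  noise_iIndep : iIndepFun E P
  indep : IndepFun (fun ω => (U ω, fun j => E j ω)) A P
  U_indep : ∀ n, IndepFun (fun ω => ((A ω, trunc n (U ω)), fun j => E j ω)) (fun ω => U ω n) P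
  -- The `i`-th input may use `U₀, …, U_i` including index `i`: with rounds shifted by one, `β_t` is
  -- known when `x_t` is chosen.
  input_trunc : ∀ i u y, Zf i (trunc (i + 1) u, y) = Zf i (u, y)
  obs : ∀ᵐ ω ∂P, ∀ i, Y i ω = g (A ω, Zf i (U ω, trunc i fun j => Y j ω)) + E i ω

namespace AdaptiveDesign

variable {P : Measure Ω'} [IsProbabilityMeasure P] {k : Z → Z → ℝ} {v : ℝ≥0} {A : Ω' → 𝔸}
  {g : 𝔸 × Z → ℝ} {U : Ω' → ℕ → ℝ} {E Y : ℕ → Ω' → ℝ} {Zf : ℕ → (ℕ → ℝ) × (ℕ → ℝ) → Z}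
  (h : AdaptiveDesign k v A g U E Y Zf P)
include h

theorem memLp (z : Z) : MemLp (fun ω => g (A ω, z)) 2 P :=
  ((h.gaussian 0 fun _ => z).eval none).memLp_two

theorem gaussianDesign {n : ℕ} (q : Option (Fin n) → Z) :
    GaussianDesign (fun o ω => g (A ω, q o)) (fun o o' => k (q o) (q o')) E v P where
  gaussian := h.gaussian n q
  measurable o := by
    have := h.g_measurable
    have := h.A_measurable
    fun_prop
  mean o := h.mean _
  cov o o' := h.cov _ _
  noise_measurable := h.noise_measurable
  noise_law := h.noise_law
  noise_indep m := by
    have := h.g_measurable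
    exact (h.noise_indep m).comp
      (φ := fun s : (𝔸 × (ℕ → ℝ)) × (ℕ → ℝ) => ((fun o => g (s.1.1, q o)), s.2))
      (ψ := fun x : ℝ => x) (by fun_prop) (by fun_prop)
  indep := by
    have := h.g_measurable
    exact (h.indep.comp (φ := fun s : (ℕ → ℝ) × (ℕ → ℝ) => s.2)
      (ψ := fun a o => g (a, q o)) (by fun_prop) (by fun_prop)).symm
  noise_iIndep := h.noise_iIndep

theorem posSemidef {n : ℕ} (z : Fin n → Z) : (kernelMatrix k z).PosSemidef :=
  posSemidef_of_covariance (F := fun z ω => g (A ω, z)) h.memLp h.cov z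

theorem postVar_nonneg (hv : v ≠ 0) {n : ℕ} (z : Fin n → Z) (p : Z) : 0 ≤ postVar k v z p :=
  (h.gaussianDesign fun o => o.elim p z).postVar_nonneg hv

/-- The inputs determined by the auxiliary randomness and the observations. -/
def inputs (Zf : ℕ → (ℕ → ℝ) × (ℕ → ℝ) → Z) (n : ℕ) (s : (ℕ → ℝ) × (ℕ → ℝ)) : Fin n → Z :=
  fun i => Zf i (s.1, trunc i s.2)

theorem measurable_inputs (n : ℕ) (i : Fin n) : Measurable fun s => inputs Zf n s i := by
  have := h.input_measurable i
  unfold inputs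
  fun_prop

/-- After the change of measure the data are pure noise, independent of `A` together with `U`. At a
frozen `ω` the inputs are therefore constants, and an independent copy `ω'` of the process is
integrated against the likelihood of a fixed design. -/
theorem lintegral_posterior (hv : v ≠ 0) (n : ℕ) {Φ : 𝔸 × ((ℕ → ℝ) × (ℕ → ℝ)) → ℝ≥0∞}
    (hΦ : Measurable Φ) :
    ∫⁻ ω, Φ (A ω, (U ω, trunc n fun j => Y j ω)) ∂P =
      ∫⁻ ω, ∫⁻ ω', Φ (A ω', (U ω, trunc n fun j => E j ω)) * designLikelihood v
        (fun o => g (A ω', o.elim (Zf n (U ω, trunc n fun j => E j ω))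
          (inputs Zf n (U ω, trunc n fun j => E j ω)))) (fun i => E i ω) ∂P ∂P := by
  have hA := h.A_measurable
  have hU := h.U_measurable
  have hE := h.noise_measurable
  have hg := h.g_measurable
  have hZ := h.input_measurable
  have hS : Measurable fun ω => (A ω, U ω) := by fun_prop
  have key := lintegral_observations (S := fun ω => (A ω, U ω)) (E := E) (Y := Y)
    (G := fun i p => g (p.1.1, Zf i (p.1.2, p.2))) hv hS hE h.noise_law h.noise_indep
    (fun i => by have := hZ i; fun_prop) h.obs n (Φ := fun p => Φ (p.1.1, (p.1.2, p.2)))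
    (by fun_prop)
  refine key.trans ?_
  have hin := h.measurable_inputs n
  set Ψ : ((ℕ → ℝ) × (ℕ → ℝ)) × 𝔸 → ℝ≥0∞ := fun q => Φ (q.2, q.1) *
    designLikelihood v (fun o : Option (Fin n) => g (q.2, o.elim (Zf n q.1) (inputs Zf n q.1)))
      (fun i => q.1.2 i) with hΨdef
  have hΨ : Measurable Ψ := by
    have h1 : Measurable fun q : ((ℕ → ℝ) × (ℕ → ℝ)) × 𝔸 =>
        (fun o : Option (Fin n) => g (q.2, o.elim (Zf n q.1) (inputs Zf n q.1))) := by
      refine measurable_pi_lambda _ fun o => ?_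
      cases o with
      | none =>
        have := hZ n
        simp only [Option.elim_none]; fun_prop
      | some i =>
        have := hin i
        simp only [Option.elim_some]; fun_prop
    exact (hΦ.comp (measurable_snd.prodMk measurable_fst)).mul
      (measurable_designLikelihood h1 (by fun_prop))
  have hX : Measurable fun ω => (U ω, trunc n fun j => E j ω) := by fun_prop
  have hind : IndepFun (fun ω => (U ω, trunc n fun j => E j ω)) A P :=
    h.indep.comp (φ := fun s : (ℕ → ℝ) × (ℕ → ℝ) => (s.1, trunc n s.2)) (ψ := fun a => a)
      (by fun_prop) measurable_id
  have e1 : ∀ ω, (fun i : Fin n => trunc n (fun j => E j ω) i) = fun i : Fin n => E i ω := by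
    intro ω; ext i
    rw [trunc_of_lt i.2]
  calc _ = ∫⁻ ω, Ψ ((U ω, trunc n fun j => E j ω), A ω) ∂P := by
        congr 1; ext ω
        simp only [hΨdef, designLikelihood, inputs, Option.elim_some]
        rw [Finset.prod_range]
        congr 1
        refine Finset.prod_congr rfl fun i _ => ?_
        rw [trunc_trunc_of_le i.2.le, trunc_of_lt i.2]
    _ = ∫⁻ ω, ∫⁻ a, Ψ ((U ω, trunc n fun j => E j ω), a) ∂(P.map A) ∂P :=
        lintegral_comp_prodMk_of_indepFun hX hA hind hΨ
    _ = _ := by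
        congr 1; ext ω
        rw [lintegral_map (by fun_prop) hA]
        simp only [hΨdef, e1]

/-- Posterior confidence bound under adaptive sampling: at a point `p` determined by the past, the
conditional probability that the confidence interval fails is at most `exp (-b / 2)`. -/
theorem lintegral_tail_le (hv : v ≠ 0) (n : ℕ) {p : (ℕ → ℝ) × (ℕ → ℝ) → Z} (hp : Measurable p)
    {b : (ℕ → ℝ) × (ℕ → ℝ) → ℝ} (hb : Measurable b) (hb0 : ∀ s, 0 ≤ b s)
    {C : (ℕ → ℝ) × (ℕ → ℝ) → ℝ≥0∞} (hC : Measurable C) :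
    ∫⁻ ω, (fun q : 𝔸 × ((ℕ → ℝ) × (ℕ → ℝ)) => C q.2 * {q : 𝔸 × ((ℕ → ℝ) × (ℕ → ℝ)) |
        √(b q.2) * postSd k v (inputs Zf n q.2) (p q.2) <
          |g (q.1, p q.2) - postMean k v (inputs Zf n q.2) (fun i => q.2.2 i) (p q.2)|}.indicator 1 q)
        (A ω, (U ω, trunc n fun j => Y j ω)) ∂P ≤
      ∫⁻ ω, C (U ω, trunc n fun j => Y j ω) *
        ENNReal.ofReal (Real.exp (-b (U ω, trunc n fun j => Y j ω) / 2)) ∂P := by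
  have hg := h.g_measurable
  have hin := h.measurable_inputs n
  have hsd := measurable_postSd (z := fun i s => inputs Zf n s i) h.kernel_measurable v hin hp
  have hmean := measurable_postMean (z := fun i s => inputs Zf n s i) h.kernel_measurable v hin
    (y := fun s (i : Fin n) => s.2 i) (by fun_prop) hp
  set T : Set (𝔸 × ((ℕ → ℝ) × (ℕ → ℝ))) := {q | √(b q.2) * postSd k v (inputs Zf n q.2) (p q.2) <
          |g (q.1, p q.2) - postMean k v (inputs Zf n q.2) (fun i => q.2.2 i) (p q.2)|} with hT
  have hTm : MeasurableSet T := by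
    refine measurableSet_lt ?_ ?_
    · exact ((Real.continuous_sqrt.measurable.comp (hb.comp measurable_snd))).mul
        (hsd.comp measurable_snd)
    · have : Measurable fun q : 𝔸 × ((ℕ → ℝ) × (ℕ → ℝ)) =>
          g (q.1, p q.2) - postMean k v (inputs Zf n q.2) (fun i => q.2.2 i) (p q.2) :=
        (hg.comp (by fun_prop)).sub (hmean.comp measurable_snd)
      exact measurable_norm.comp this
  have hT1 : Measurable (T.indicator (1 : 𝔸 × ((ℕ → ℝ) × (ℕ → ℝ)) → ℝ≥0∞)) :=
    measurable_one.indicator hTm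
  rw [h.lintegral_posterior hv n (Φ := fun q => C q.2 * T.indicator 1 q) (by fun_prop),
    h.lintegral_posterior hv n (Φ := fun q => C q.2 * ENNReal.ofReal (Real.exp (-b q.2 / 2)))
      (by fun_prop)]
  -- Both sides now have the same outer integral, and the fixed-design bound holds at every `ω`,
  -- with the weight `C` constant.
  refine lintegral_mono fun ω => ?_
  set s := (U ω, trunc n fun j => E j ω) with hs
  set q : Option (Fin n) → Z := fun o => o.elim (p s) (inputs Zf n s) with hq
  have hd := h.gaussianDesign q
  have hle := hd.lintegral_tail_le hv (hb0 s) (fun i => E i ω)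
  have hlik := hd.measurable_designLikelihood_process (v := v) (fun i => E i ω)
  -- The likelihood reads only the inputs `some i`, so the query point at `none` can be changed from
  -- `Zf n s` to `p s`.
  have e0 : ∀ ω', designLikelihood v (fun o : Option (Fin n) =>
      g (A ω', o.elim (Zf n s) (inputs Zf n s))) (fun i => E i ω) =
      designLikelihood v (fun o => g (A ω', q o)) (fun i => E i ω) := fun ω' => rfl
  have e1 : (fun i : Fin n => s.2 i) = fun i : Fin n => E i ω := by
    ext i
    simp only [hs]
    rw [trunc_of_lt i.2]
  have e2 : ∀ ω', T.indicator (1 : 𝔸 × ((ℕ → ℝ) × (ℕ → ℝ)) → ℝ≥0∞) (A ω', s) =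
      (GaussianDesign.tailSet (fun o o' => k (q o) (q o')) v (b s)).indicator 1
        (fun i => E i ω, fun o => g (A ω', q o)) := by
    intro ω'
    have : (A ω', s) ∈ T ↔ (fun i : Fin n => E i ω, fun o => g (A ω', q o)) ∈
        GaussianDesign.tailSet (fun o o' => k (q o) (q o')) v (b s) := by
      simp only [hT, Set.mem_ofPred_eq, GaussianDesign.tailSet, e1]
      rfl
    by_cases h1 : (A ω', s) ∈ T
    · rw [Set.indicator_of_mem h1, Set.indicator_of_mem (this.1 h1)]; rfl
    · rw [Set.indicator_of_notMem h1, Set.indicator_of_notMem (fun h2 => h1 (this.2 h2))]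
  simp only [e0, e2]
  simp only [mul_assoc]
  have hm : Measurable fun ω' => (GaussianDesign.tailSet (fun o o' => k (q o) (q o')) v
      (b s)).indicator 1 (fun i : Fin n => E i ω, fun o => g (A ω', q o)) *
        designLikelihood v (fun o => g (A ω', q o)) (fun i => E i ω) :=
    (hd.measurable_tail_mul_likelihood (b s)).comp
      (measurable_prodMk_left (x := fun i : Fin n => E i ω))
  rw [lintegral_const_mul _ hm, lintegral_const_mul _ (by fun_prop), lintegral_const_mul _ hlik]
  gcongr

end AdaptiveDesign

end AdaptiveDesign

/-! ### Domination by the randomized confidence parameter -/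

section Domination

variable {Ω' Θ H : Type*} [MeasurableSpace Ω'] [MeasurableSpace Θ] [MeasurableSpace H]
  {P : Measure Ω'} [IsProbabilityMeasure P]

/-- If the failure probability of `𝒢 (b)` given `σ (T)` is at most the tail of an independent
variable `B`, then any `D` bounded by `V (B)` on `𝒢 (B)` is stochastically dominated by `V (B)`. -/
theorem measure_gt_le_measure_gt {T : Ω' → Θ} (hT : Measurable T) {B : Ω' → ℝ}
    (hB : Measurable B) (hind : IndepFun T B P) {σ : Θ → H} (hσ : Measurable σ)
    {D : Θ → ℝ} (hD : Measurable D) {V : H × ℝ → ℝ} (hV : Measurable V)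
    {𝒢 : Set (Θ × ℝ)} (hG : MeasurableSet 𝒢)
    (hmono : ∀ θ b b', b ≤ b' → (θ, b) ∈ 𝒢 → (θ, b') ∈ 𝒢)
    (hDV : ∀ᵐ ω ∂P, (T ω, B ω) ∈ 𝒢 → D (T ω) ≤ V (σ (T ω), B ω)) {c₀ : ℝ}
    (htail : ∀ b, c₀ ≤ b → P.map B (Set.Ioi b) = ENNReal.ofReal (Real.exp (-(b - c₀) / 2)))
    (hfail : ∀ b : H → ℝ, Measurable b → (∀ x, c₀ ≤ b x) → ∀ C : H → ℝ≥0∞, Measurable C →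
      ∫⁻ ω, C (σ (T ω)) * 𝒢ᶜ.indicator 1 (T ω, b (σ (T ω))) ∂P ≤
        ∫⁻ ω, C (σ (T ω)) * ENNReal.ofReal (Real.exp (-(b (σ (T ω)) - c₀) / 2)) ∂P)
    (c : ℝ) : P {ω | c < D (T ω)} ≤ P {ω | c < V (σ (T ω), B ω)} := by
  have hΛ : IsProbabilityMeasure (P.map B) := Measure.isProbabilityMeasure_map hB.aemeasurable
  have hprod := (indepFun_iff_map_prod_eq_prod_map_map hT.aemeasurable hB.aemeasurable).1 hind
  have hVset : MeasurableSet {q : H × ℝ | c < V q} := measurableSet_lt measurable_const hV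
  -- This is the conditional probability of `V > c` given the past `x`.
  set p : H → ℝ≥0∞ := fun x => P.map B (Prod.mk x ⁻¹' {q : H × ℝ | c < V q}) with hp
  have hpm : Measurable p := measurable_measure_prodMk_left hVset
  have hp1 : ∀ x, p x ≤ 1 := fun x => prob_le_one
  have hpt : ∀ x, p x ≠ ∞ := fun x => ((hp1 x).trans_lt ENNReal.one_lt_top).ne
  have hVP : ∫⁻ ω, p (σ (T ω)) ∂P = P {ω | c < V (σ (T ω), B ω)} := by
    have h1 : Measurable fun q : Θ × ℝ =>
        ({q : H × ℝ | c < V q}.indicator (1 : H × ℝ → ℝ≥0∞)) (σ q.1, q.2) :=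
      (measurable_one.indicator hVset).comp (by fun_prop)
    have h2 := lintegral_comp_prodMk_of_indepFun hT hB hind h1
    have h3 : ∫⁻ ω, ({q : H × ℝ | c < V q}.indicator (1 : H × ℝ → ℝ≥0∞)) (σ (T ω), B ω) ∂P =
        P {ω | c < V (σ (T ω), B ω)} := by
      rw [← lintegral_indicator_one (s := {ω | c < V (σ (T ω), B ω)})]
      · rfl
      · exact measurableSet_lt measurable_const (hV.comp (by fun_prop))
    rw [← h3, h2]
    congr 1; ext ω
    simp only [hp]
    rw [← lintegral_indicator_one (measurable_prodMk_left hVset)]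
    rfl
  have hnull : ∀ᵐ ω ∂P, ∀ᵐ b ∂(P.map B), (T ω, b) ∈ 𝒢 → D (T ω) ≤ V (σ (T ω), b) := by
    have hs : MeasurableSet {q : Θ × ℝ | q ∈ 𝒢 → D q.1 ≤ V (σ q.1, q.2)} := by
      have : {q : Θ × ℝ | q ∈ 𝒢 → D q.1 ≤ V (σ q.1, q.2)} =
          𝒢ᶜ ∪ {q : Θ × ℝ | D q.1 ≤ V (σ q.1, q.2)} := by
        ext q; simp [imp_iff_not_or]
      rw [this]
      exact hG.compl.union (measurableSet_le (hD.comp measurable_fst) (hV.comp (by fun_prop)))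
    have h1 : ∀ᵐ q ∂(P.map fun ω => (T ω, B ω)), q ∈ 𝒢 → D q.1 ≤ V (σ q.1, q.2) :=
      (ae_map_iff (hT.prodMk hB).aemeasurable hs).2 hDV
    rw [hprod] at h1
    exact ae_of_ae_map hT.aemeasurable (Measure.ae_ae_of_ae_prod h1)
  rw [← hVP]
  refine ENNReal.le_of_forall_pos_le_add fun η hη _ => ?_
  have hη0 : (0 : ℝ) < η := hη
  -- The slack `η` makes `r` positive, so that its logarithm defines a level, and larger than `p`
  -- where `r < 1`, which yields the contradiction below.
  set r : H → ℝ := fun x => min 1 ((p x).toReal + η) with hr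
  have hrm : Measurable r := measurable_const.min (hpm.ennreal_toReal.add_const _)
  have hr0 : ∀ x, 0 < r x := fun x => lt_min one_pos (by positivity)
  -- This is the level exceeded by `B` with probability exactly `r`.
  set b : H → ℝ := fun x => c₀ - 2 * Real.log (r x) with hb
  have hbm : Measurable b := by fun_prop
  have hbc : ∀ x, c₀ ≤ b x := fun x => by
    have := Real.log_nonpos (hr0 x).le (min_le_left _ _)
    simp only [hb]; linarith
  have hexp : ∀ x, Real.exp (-(b x - c₀) / 2) = r x := fun x => by
    rw [show -(b x - c₀) / 2 = Real.log (r x) by simp only [hb]; ring, Real.exp_log (hr0 x)]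
  have hone : MeasurableSet {x | r x < 1} := measurableSet_lt hrm measurable_const
  -- Pasts with `r = 1` need no argument, since the probability of `D > c` is at most `1` there.
  set C : H → ℝ≥0∞ := {x | r x < 1}.indicator 1 with hC
  have hCm : Measurable C := measurable_one.indicator hone
  have hf := hfail b hbm hbc C hCm
  simp only [hexp] at hf
  have hDset : MeasurableSet {ω | c < D (T ω)} := measurableSet_lt measurable_const (hD.comp hT)
  have hpoint : ∀ᵐ ω ∂P, {ω | c < D (T ω)}.indicator (1 : Ω' → ℝ≥0∞) ω ≤
      C (σ (T ω)) * 𝒢ᶜ.indicator 1 (T ω, b (σ (T ω))) +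
        {x | r x < 1}ᶜ.indicator 1 (σ (T ω)) := by
    filter_upwards [hnull] with ω hω
    by_cases hDc : c < D (T ω)
    swap
    · rw [Set.indicator_of_notMem (by exact hDc)]; exact zero_le
    rw [Set.indicator_of_mem (by exact hDc)]
    by_cases hr1 : r (σ (T ω)) < 1
    swap
    · rw [Set.indicator_of_mem (s := {x | r x < 1}ᶜ) (by exact hr1)]
      exact le_add_self
    -- If the intervals held at level `b`, they would hold at all larger levels. Almost every `B >
    -- b` would then give `V > c`, so that `r ≤ p`.
    have hnot : (T ω, b (σ (T ω))) ∈ 𝒢ᶜ := by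
      intro hmem
      have hsub : P.map B (Set.Ioi (b (σ (T ω)))) ≤ p (σ (T ω)) := by
        apply measure_mono_ae
        filter_upwards [hω] with b' hb' hlt
        exact hDc.trans_le (hb' (hmono _ _ _ (le_of_lt hlt) hmem))
      rw [htail _ (hbc _), hexp] at hsub
      have hrr : r (σ (T ω)) = (p (σ (T ω))).toReal + η := by
        rcases min_choice 1 ((p (σ (T ω))).toReal + η) with h | h
        · exact absurd h hr1.ne
        · exact h
      rw [hrr, ENNReal.ofReal_le_iff_le_toReal (hpt _)] at hsub
      linarith
    rw [hC, Set.indicator_of_mem (by exact hr1), Set.indicator_of_mem hnot]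
    simp
  calc P {ω | c < D (T ω)}
      = ∫⁻ ω, {ω | c < D (T ω)}.indicator 1 ω ∂P := (lintegral_indicator_one hDset).symm
    _ ≤ ∫⁻ ω, (C (σ (T ω)) * 𝒢ᶜ.indicator 1 (T ω, b (σ (T ω))) +
        {x | r x < 1}ᶜ.indicator 1 (σ (T ω))) ∂P := lintegral_mono_ae hpoint
    _ = ∫⁻ ω, C (σ (T ω)) * 𝒢ᶜ.indicator 1 (T ω, b (σ (T ω))) ∂P +
        ∫⁻ ω, {x | r x < 1}ᶜ.indicator 1 (σ (T ω)) ∂P :=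
        lintegral_add_right _ ((measurable_one.indicator hone.compl).comp (hσ.comp hT))
    _ ≤ ∫⁻ ω, C (σ (T ω)) * ENNReal.ofReal (r (σ (T ω))) ∂P +
        ∫⁻ ω, {x | r x < 1}ᶜ.indicator 1 (σ (T ω)) ∂P := by gcongr
    _ = ∫⁻ ω, (C (σ (T ω)) * ENNReal.ofReal (r (σ (T ω))) +
        {x | r x < 1}ᶜ.indicator 1 (σ (T ω))) ∂P :=
        (lintegral_add_right _
          ((measurable_one.indicator hone.compl).comp (hσ.comp hT))).symm
    _ ≤ ∫⁻ ω, (p (σ (T ω)) + η) ∂P := by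
        refine lintegral_mono fun ω => ?_
        have hle : ENNReal.ofReal (r (σ (T ω))) ≤ p (σ (T ω)) + η := by
          refine (ENNReal.ofReal_le_ofReal (min_le_right _ _)).trans ?_
          rw [ENNReal.ofReal_add ENNReal.toReal_nonneg hη0.le, ENNReal.ofReal_toReal (hpt _),
            ENNReal.ofReal_coe_nnreal]
        by_cases hr1 : r (σ (T ω)) < 1
        · rw [hC, Set.indicator_of_mem (by exact hr1),
            Set.indicator_of_notMem (s := {x | r x < 1}ᶜ) (by simpa using hr1)]
          simpa using hle
        · rw [hC, Set.indicator_of_notMem (by exact hr1),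
            Set.indicator_of_mem (s := {x | r x < 1}ᶜ) (by exact hr1)]
          have : r (σ (T ω)) = 1 := le_antisymm (min_le_left _ _) (not_lt.1 hr1)
          rw [this, ENNReal.ofReal_one] at hle
          simpa using hle
    _ = ∫⁻ ω, p (σ (T ω)) ∂P + η := by
        rw [lintegral_add_right _ measurable_const, lintegral_const, measure_univ, mul_one]

end Domination

/-! ### Domination for the adaptive design -/

namespace AdaptiveDesign

variable {Ω' 𝔸 Z : Type*} [MeasurableSpace Ω'] [MeasurableSpace 𝔸] [MeasurableSpace Z]
  {P : Measure Ω'} [IsProbabilityMeasure P] {k : Z → Z → ℝ} {v : ℝ≥0} {A : Ω' → 𝔸}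
  {g : 𝔸 × Z → ℝ} {U : Ω' → ℕ → ℝ} {E Y : ℕ → Ω' → ℝ} {Zf : ℕ → (ℕ → ℝ) × (ℕ → ℝ) → Z}
  (h : AdaptiveDesign k v A g U E Y Zf P)
include h

theorem inputs_trunc {m n : ℕ} (hmn : m ≤ n) (u y : ℕ → ℝ) :
    inputs Zf m (trunc n u, y) = inputs Zf m (u, y) := by
  ext i
  simp only [inputs]
  rw [← h.input_trunc, trunc_trunc_of_le (by omega), h.input_trunc]

/-- The first `n` observations unroll into a function of `A`, `U₀, …, U_{n-1}` and the noises, all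
independent of `U_n`. -/
theorem indepFun_past (n : ℕ) :
    IndepFun (fun ω => (A ω, (trunc n (U ω), trunc n fun j => Y j ω))) (fun ω => U ω n) P := by
  have hg := h.g_measurable
  have hZ := h.input_measurable
  obtain ⟨F, hF, hFY⟩ := exists_measurable_trunc_observations (P := P)
    (S := fun ω => (A ω, trunc n (U ω))) (E := E) (Y := Y)
    (G := fun i p => g (p.1.1, Zf i (p.1.2, p.2))) (fun i => by have := hZ i; fun_prop) n (by
      filter_upwards [h.obs] with ω hω i hi
      rw [hω i]
      congr 2
      rw [← h.input_trunc i (trunc n (U ω)), trunc_trunc_of_le (by omega), h.input_trunc])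
  have h1 := (h.U_indep n).comp
    (φ := fun s : (𝔸 × (ℕ → ℝ)) × (ℕ → ℝ) => (s.1.1, (s.1.2, F (s.1, trunc n s.2))))
    (ψ := fun x : ℝ => x) (by fun_prop) measurable_id
  refine h1.congr ?_ Filter.EventuallyEq.rfl
  filter_upwards [hFY] with ω hω
  simp only [Function.comp_apply]
  rw [hω]

/-- Stochastic domination of a quantity `D` controlled by the confidence intervals at the points
`p j` (chosen from the past). -/
theorem measure_gt_le {n : ℕ} (hv : v ≠ 0) (hY : Measurable fun ω => trunc n fun j => Y j ω)
    {ι : Type*} [Fintype ι] {p : ι → (ℕ → ℝ) × (ℕ → ℝ) → Z} (hp : ∀ j, Measurable (p j))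
    {κ : ℝ} (hκ : Fintype.card ι ≤ κ) (hκ1 : 1 ≤ κ)
    (htail : ∀ b, 2 * Real.log κ ≤ b → P.map (fun ω => U ω n) (Set.Ioi b) =
      ENNReal.ofReal (Real.exp (-(b - 2 * Real.log κ) / 2)))
    {D : 𝔸 × ((ℕ → ℝ) × (ℕ → ℝ)) → ℝ} (hD : Measurable D)
    {V : ((ℕ → ℝ) × (ℕ → ℝ)) × ℝ → ℝ} (hV : Measurable V)
    (hDV : ∀ᵐ ω ∂P, (∀ j, |g (A ω, p j (trunc n (U ω), trunc n fun j => Y j ω)) -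
        postMean k v (inputs Zf n (U ω, trunc n fun j => Y j ω)) (fun i => Y i ω)
          (p j (trunc n (U ω), trunc n fun j => Y j ω))| ≤
        √(U ω n) * postSd k v (inputs Zf n (U ω, trunc n fun j => Y j ω))
          (p j (trunc n (U ω), trunc n fun j => Y j ω))) →
      D (A ω, (trunc n (U ω), trunc n fun j => Y j ω)) ≤
        V ((trunc n (U ω), trunc n fun j => Y j ω), U ω n)) (c : ℝ) :
    P {ω | c < D (A ω, (trunc n (U ω), trunc n fun j => Y j ω))} ≤
      P {ω | c < V ((trunc n (U ω), trunc n fun j => Y j ω), U ω n)} := by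
  have hA := h.A_measurable
  have hU := h.U_measurable
  have hg := h.g_measurable
  have hin := h.measurable_inputs n
  have hκ0 : 0 < κ := by linarith
  have hc0 : 0 ≤ 2 * Real.log κ := by have := Real.log_nonneg hκ1; linarith
  set μ : ι → (ℕ → ℝ) × (ℕ → ℝ) → ℝ := fun j s =>
    postMean k v (inputs Zf n s) (fun i => s.2 i) (p j s) with hμ
  set sd : ι → (ℕ → ℝ) × (ℕ → ℝ) → ℝ := fun j s => postSd k v (inputs Zf n s) (p j s) with hsd
  have hμm : ∀ j, Measurable (μ j) := fun j =>
    measurable_postMean (z := fun i s => inputs Zf n s i) h.kernel_measurable v hin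
      (y := fun s (i : Fin n) => s.2 i) (by fun_prop) (hp j)
  have hsdm : ∀ j, Measurable (sd j) := fun j =>
    measurable_postSd (z := fun i s => inputs Zf n s i) h.kernel_measurable v hin (hp j)
  have hT : ∀ j, MeasurableSet {q : (𝔸 × ((ℕ → ℝ) × (ℕ → ℝ))) × ℝ |
      |g (q.1.1, p j q.1.2) - μ j q.1.2| ≤ √q.2 * sd j q.1.2} := by
    intro j
    have := hμm j
    have := hsdm j
    have := hp j
    have h1 : Measurable fun q : (𝔸 × ((ℕ → ℝ) × (ℕ → ℝ))) × ℝ =>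
      g (q.1.1, p j q.1.2) - μ j q.1.2 := by fun_prop
    exact measurableSet_le (measurable_norm.comp h1) (by fun_prop)
  set 𝒢 : Set ((𝔸 × ((ℕ → ℝ) × (ℕ → ℝ))) × ℝ) := {q | ∀ j,
      |g (q.1.1, p j q.1.2) - μ j q.1.2| ≤ √q.2 * sd j q.1.2} with hGdef
  have hG : MeasurableSet 𝒢 := by
    rw [hGdef, Set.ofPred_forall]
    exact MeasurableSet.iInter hT
  have hμeq : ∀ j ω, μ j (trunc n (U ω), trunc n fun j => Y j ω) =
      postMean k v (inputs Zf n (U ω, trunc n fun j => Y j ω)) (fun i => Y i ω)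
          (p j (trunc n (U ω), trunc n fun j => Y j ω)) := by
    intro j ω
    simp only [hμ]
    rw [h.inputs_trunc le_rfl]
    congr 1
    ext i
    exact trunc_of_lt i.2 _
  have hsdeq : ∀ j ω, sd j (trunc n (U ω), trunc n fun j => Y j ω) =
      postSd k v (inputs Zf n (U ω, trunc n fun j => Y j ω))
          (p j (trunc n (U ω), trunc n fun j => Y j ω)) := by
    intro j ω
    simp only [hsd]
    rw [h.inputs_trunc le_rfl]
  refine measure_gt_le_measure_gt
    (T := fun ω => (A ω, (trunc n (U ω), trunc n fun j => Y j ω))) (B := fun ω => U ω n)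
    (σ := Prod.snd) (𝒢 := 𝒢) (c₀ := 2 * Real.log κ) (by fun_prop) (by fun_prop)
    (h.indepFun_past n) measurable_snd hD hV hG ?_ ?_ htail ?_ c
  · intro θ b b' hbb hb j
    exact (hb j).trans (mul_le_mul_of_nonneg_right (Real.sqrt_le_sqrt hbb) (Real.sqrt_nonneg _))
  · filter_upwards [hDV] with ω hω hmem
    refine hω fun j => ?_
    rw [← hμeq, ← hsdeq]
    exact hmem j
  · intro b hb hbc C hC
    have hkey : ∀ j, ∫⁻ ω, C (trunc n (U ω), trunc n fun j => Y j ω) *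
        {q : (𝔸 × ((ℕ → ℝ) × (ℕ → ℝ))) × ℝ | |g (q.1.1, p j q.1.2) - μ j q.1.2| ≤
          √q.2 * sd j q.1.2}ᶜ.indicator 1 ((A ω, (trunc n (U ω), trunc n fun j => Y j ω)),
            b (trunc n (U ω), trunc n fun j => Y j ω)) ∂P ≤
        ∫⁻ ω, C (trunc n (U ω), trunc n fun j => Y j ω) * ENNReal.ofReal
          (Real.exp (-b (trunc n (U ω), trunc n fun j => Y j ω) / 2)) ∂P := by
      intro j
      have hj := hp j
      -- Composing with `trunc n` ensures that the query point, the level and the weight see only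
      -- the confidence parameters of earlier rounds.
      have := h.lintegral_tail_le hv n (p := fun s => p j (trunc n s.1, s.2)) (by fun_prop)
        (b := fun s => b (trunc n s.1, s.2)) (by fun_prop) (fun s => hc0.trans (hbc _))
        (C := fun s => C (trunc n s.1, s.2)) (by fun_prop)
      refine le_trans (le_of_eq ?_) this
      congr 1; ext ω
      simp only
      congr 1
      apply Set.indicator_eq_indicator
      swap
      · rfl
      simp only [Set.mem_compl_iff, Set.mem_ofPred_eq, not_le]
      rw [hμeq, hsdeq]
      have : (fun i : Fin n => trunc n (fun j => Y j ω) i) = fun i : Fin n => Y i ω := by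
        ext i; exact trunc_of_lt i.2 _
      rw [this]
    have hmm : ∀ j, Measurable fun ω => C (trunc n (U ω), trunc n fun j => Y j ω) *
        {q : (𝔸 × ((ℕ → ℝ) × (ℕ → ℝ))) × ℝ | |g (q.1.1, p j q.1.2) - μ j q.1.2| ≤
          √q.2 * sd j q.1.2}ᶜ.indicator 1 ((A ω, (trunc n (U ω), trunc n fun j => Y j ω)),
            b (trunc n (U ω), trunc n fun j => Y j ω)) := by
      intro j
      refine Measurable.mul (by fun_prop) ?_
      exact (measurable_one.indicator (hT j).compl).comp (by fun_prop)
    -- Union bound over the points `p j`; their number is at most `κ`.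
    calc _ ≤ ∫⁻ ω, ∑ j, C (trunc n (U ω), trunc n fun j => Y j ω) *
        {q : (𝔸 × ((ℕ → ℝ) × (ℕ → ℝ))) × ℝ | |g (q.1.1, p j q.1.2) - μ j q.1.2| ≤
          √q.2 * sd j q.1.2}ᶜ.indicator 1 ((A ω, (trunc n (U ω), trunc n fun j => Y j ω)),
            b (trunc n (U ω), trunc n fun j => Y j ω)) ∂P := by
          refine lintegral_mono fun ω => ?_
          simp only
          rw [← Finset.mul_sum]
          gcongr
          by_cases hmem : ((A ω, (trunc n (U ω), trunc n fun j => Y j ω)),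
            b (trunc n (U ω), trunc n fun j => Y j ω)) ∈ 𝒢
          · rw [Set.indicator_of_notMem (by simpa using hmem)]; exact zero_le
          · rw [Set.indicator_of_mem (by exact hmem)]
            obtain ⟨j, hj⟩ := not_forall.1 hmem
            refine le_trans ?_ (Finset.single_le_sum (fun _ _ => zero_le) (Finset.mem_univ j))
            rw [Set.indicator_of_mem (by exact hj)]
      _ = ∑ j, ∫⁻ ω, _ ∂P := lintegral_finsetSum _ fun j _ => hmm j
      _ ≤ ∑ j : ι, ∫⁻ ω, C (trunc n (U ω), trunc n fun j => Y j ω) * ENNReal.ofReal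
          (Real.exp (-b (trunc n (U ω), trunc n fun j => Y j ω) / 2)) ∂P :=
          Finset.sum_le_sum fun j _ => hkey j
      _ ≤ _ := by
          rw [Finset.sum_const, Finset.card_univ, nsmul_eq_mul,
            ← lintegral_const_mul _ (by fun_prop)]
          refine lintegral_mono fun ω => ?_
          simp only
          rw [mul_left_comm]
          gcongr
          -- The factor `κ` of the union bound is absorbed by the shift `2 log κ` of the confidence
          -- parameter.
          rw [show (-(b (trunc n (U ω), trunc n fun j => Y j ω) - 2 * Real.log κ) / 2) =
            Real.log κ + -b (trunc n (U ω), trunc n fun j => Y j ω) / 2 by ring, Real.exp_add,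
            Real.exp_log hκ0, ENNReal.ofReal_mul hκ0.le]
          gcongr
          rw [← ENNReal.ofReal_natCast]
          exact ENNReal.ofReal_le_ofReal hκ

/-- Expectation version of `measure_gt_le`. -/
theorem lintegral_le {n : ℕ} (hv : v ≠ 0) (hY : Measurable fun ω => trunc n fun j => Y j ω)
    {ι : Type*} [Fintype ι] {p : ι → (ℕ → ℝ) × (ℕ → ℝ) → Z} (hp : ∀ j, Measurable (p j))
    {κ : ℝ} (hκ : Fintype.card ι ≤ κ) (hκ1 : 1 ≤ κ)
    (htail : ∀ b, 2 * Real.log κ ≤ b → P.map (fun ω => U ω n) (Set.Ioi b) =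
      ENNReal.ofReal (Real.exp (-(b - 2 * Real.log κ) / 2)))
    {D : 𝔸 × ((ℕ → ℝ) × (ℕ → ℝ)) → ℝ} (hD : Measurable D) (hD0 : ∀ q, 0 ≤ D q)
    {V : ((ℕ → ℝ) × (ℕ → ℝ)) × ℝ → ℝ} (hV : Measurable V) (hV0 : ∀ q, 0 ≤ V q)
    (hDV : ∀ᵐ ω ∂P, (∀ j, |g (A ω, p j (trunc n (U ω), trunc n fun j => Y j ω)) -
        postMean k v (inputs Zf n (U ω, trunc n fun j => Y j ω)) (fun i => Y i ω)
          (p j (trunc n (U ω), trunc n fun j => Y j ω))| ≤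
        √(U ω n) * postSd k v (inputs Zf n (U ω, trunc n fun j => Y j ω))
          (p j (trunc n (U ω), trunc n fun j => Y j ω))) →
      D (A ω, (trunc n (U ω), trunc n fun j => Y j ω)) ≤
        V ((trunc n (U ω), trunc n fun j => Y j ω), U ω n)) :
    ∫⁻ ω, ENNReal.ofReal (D (A ω, (trunc n (U ω), trunc n fun j => Y j ω))) ∂P ≤
      ∫⁻ ω, ENNReal.ofReal (V ((trunc n (U ω), trunc n fun j => Y j ω), U ω n)) ∂P := by
  have hA := h.A_measurable
  have hU := h.U_measurable
  rw [lintegral_eq_lintegral_meas_lt _ (Filter.Eventually.of_forall fun ω => hD0 _)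
      (Measurable.aemeasurable (by fun_prop)),
    lintegral_eq_lintegral_meas_lt _ (Filter.Eventually.of_forall fun ω => hV0 _)
      (Measurable.aemeasurable (by fun_prop))]
  exact lintegral_mono fun c => h.measure_gt_le hv hY hp hκ hκ1 htail hD hV hDV c

end AdaptiveDesign

/-! ### Information gain -/

section InformationGain

variable {Z : Type*} {k : Z → Z → ℝ} {v : ℝ≥0}

/-- The Schur complement of the old block in the matrix with one more row and column is `1 + v⁻¹`
times the posterior variance at the new point. -/
theorem det_one_add_kernelMatrix_succ (hk : ∀ a b, k a b = k b a)
    (hK : ∀ (n : ℕ) (z : Fin n → Z), (kernelMatrix k z).PosSemidef) (hv : v ≠ 0) (z : ℕ → Z)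
    (n : ℕ) :
    (1 + (v : ℝ)⁻¹ • kernelMatrix k fun i : Fin (n + 1) => z i).det =
      (1 + (v : ℝ)⁻¹ • kernelMatrix k fun i : Fin n => z i).det *
        (1 + (v : ℝ)⁻¹ * postVar k v (fun i : Fin n => z i) (z n)) := by
  have hv0 : (v : ℝ) ≠ 0 := by exact_mod_cast hv
  have hpd := posDef_kernelMatrix_add (hK n fun i : Fin n => z i) hv
  set K := kernelMatrix k fun i : Fin n => z i with hKdef
  set M := K + (v : ℝ) • (1 : Matrix (Fin n) (Fin n) ℝ) with hM
  have hMdet : IsUnit M.det := (Matrix.isUnit_iff_isUnit_det _).1 hpd.isUnit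
  set A : Matrix (Fin n) (Fin n) ℝ := 1 + (v : ℝ)⁻¹ • K with hA
  have hAM : A = (v : ℝ)⁻¹ • M := by
    rw [hA, hM, smul_add, smul_smul, inv_mul_cancel₀ hv0, one_smul, add_comm]
  have hdet : IsUnit A.det := by
    rw [hAM, Matrix.det_smul]
    exact ((Ne.isUnit (inv_ne_zero hv0)).pow _).mul hMdet
  let hAinv : Invertible A := Matrix.invertibleOfIsUnitDet A hdet
  have hAi : ⅟A = (v : ℝ) • M⁻¹ := by
    rw [Matrix.invOf_eq_nonsing_inv]
    refine Matrix.inv_eq_right_inv ?_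
    rw [hAM, Matrix.smul_mul, Matrix.mul_smul, smul_smul, inv_mul_cancel₀ hv0, one_smul,
      Matrix.mul_nonsing_inv _ hMdet]
  set c : Fin n → ℝ := fun i => k (z n) (z i) with hc
  have hsub : (1 + (v : ℝ)⁻¹ • kernelMatrix k fun i : Fin (n + 1) => z i).submatrix
      finSumFinEquiv finSumFinEquiv = Matrix.fromBlocks A
        (Matrix.of fun i (_ : Fin 1) => (v : ℝ)⁻¹ * c i)
        (Matrix.of fun (_ : Fin 1) i => (v : ℝ)⁻¹ * c i)
        (Matrix.of fun (_ _ : Fin 1) => 1 + (v : ℝ)⁻¹ * k (z n) (z n)) := by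
    ext i j
    rcases i with i | i <;> rcases j with j | j
    · simp [hA, hKdef, kernelMatrix, Matrix.one_apply, Fin.ext_iff]
    · have : (i : ℕ) ≠ n := i.2.ne
      simp [kernelMatrix, Fin.ext_iff, hc, hk (z i) (z n), this]
    · have : n ≠ (j : ℕ) := j.2.ne'
      simp [kernelMatrix, Fin.ext_iff, hc, this]
    · simp [kernelMatrix, Matrix.one_apply, Fin.ext_iff]
  rw [← Matrix.det_submatrix_equiv_self finSumFinEquiv, hsub, Matrix.det_fromBlocks₁₁,
    Matrix.det_fin_one, hAi, postVar]
  congr 1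
  simp only [Matrix.sub_apply, Matrix.of_apply, Matrix.mul_apply, Matrix.smul_apply, smul_eq_mul]
  rw [add_sub_assoc, mul_sub]
  congr 2
  simp only [dotProduct, Matrix.mulVec, Finset.mul_sum, Finset.sum_mul]
  rw [Finset.sum_comm]
  refine Finset.sum_congr rfl fun i _ => Finset.sum_congr rfl fun j _ => ?_
  simp only [hc, hM, hKdef]
  field_simp

theorem det_one_add_kernelMatrix (hk : ∀ a b, k a b = k b a)
    (hK : ∀ (n : ℕ) (z : Fin n → Z), (kernelMatrix k z).PosSemidef) (hv : v ≠ 0) (z : ℕ → Z)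
    (n : ℕ) :
    (1 + (v : ℝ)⁻¹ • kernelMatrix k fun i : Fin n => z i).det =
      ∏ i ∈ Finset.range n, (1 + (v : ℝ)⁻¹ * postVar k v (fun j : Fin i => z j) (z i)) := by
  induction n with
  | zero => simp
  | succ n ih => rw [det_one_add_kernelMatrix_succ hk hK hv, ih, Finset.prod_range_succ]

/-- Bernoulli's inequality `(1 + c)^s ≤ 1 + cs` for exponents in `[0, 1]`. It converts a posterior
variance into an increment of the log-determinant. -/
theorem mul_log_one_add_le {c s : ℝ} (hc : 0 ≤ c) (hs0 : 0 ≤ s) (hs1 : s ≤ 1) :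
    s * Real.log (1 + c) ≤ Real.log (1 + c * s) := by
  rw [← Real.log_rpow (by linarith)]
  apply Real.log_le_log (Real.rpow_pos_of_pos (by linarith) _)
  have := rpow_one_add_le_one_add_mul_self (s := c) (p := s) (by linarith) hs0 hs1
  linarith

variable (hk : ∀ a b, k a b = k b a)
  (hK : ∀ (n : ℕ) (z : Fin n → Z), (kernelMatrix k z).PosSemidef) (hv : v ≠ 0)
  (hpos : ∀ (n : ℕ) (z : Fin n → Z) p, 0 ≤ postVar k v z p) (hk1 : ∀ z, k z z ≤ 1)
include hk hK hv hpos hk1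

theorem log_det_eq_sum (z : ℕ → Z) (n : ℕ) :
    Real.log (1 + (v : ℝ)⁻¹ • kernelMatrix k fun i : Fin n => z i).det =
      ∑ i ∈ Finset.range n, Real.log (1 + (v : ℝ)⁻¹ * postVar k v (fun j : Fin i => z j) (z i)) := by
  rw [det_one_add_kernelMatrix hk hK hv, Real.log_prod]
  intro i _
  have := mul_nonneg (inv_nonneg.2 v.coe_nonneg) (hpos i (fun j => z j) (z i))
  positivity

/-- A real supremum bounds its members only for a bounded family. Each factor of the determinant is
at most `1 + v⁻¹`, because posterior variances are at most `1`. -/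
theorem bddAbove_log_det [Nonempty Z] (n : ℕ) : BddAbove (Set.range fun z : Fin n → Z =>
    Real.log (1 + (v : ℝ)⁻¹ • kernelMatrix k z).det) := by
  refine ⟨n * Real.log (1 + (v : ℝ)⁻¹), ?_⟩
  rintro _ ⟨z, rfl⟩
  let z' : ℕ → Z := fun i => if h : i < n then z ⟨i, h⟩ else Classical.arbitrary Z
  have hz : z = fun i : Fin n => z' i := by ext i; simp [z']
  simp only
  rw [hz, log_det_eq_sum hk hK hv hpos hk1]
  calc _ ≤ ∑ i ∈ Finset.range n, Real.log (1 + (v : ℝ)⁻¹) := by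
        refine Finset.sum_le_sum fun i _ => ?_
        have h0 := mul_nonneg (inv_nonneg.2 v.coe_nonneg) (hpos i (fun j => z' j) (z' i))
        have h1 := (postVar_le (hK i fun j : Fin i => z' j) hv (z' i)).trans (hk1 _)
        apply Real.log_le_log (by linarith)
        have := mul_le_mul_of_nonneg_left h1 (inv_nonneg.2 v.coe_nonneg)
        linarith
    _ = _ := by simp

/-- The sum of the posterior variances along a design is controlled by the information gain. -/
theorem sum_postVar_le (z : ℕ → Z) (n : ℕ) :
    ∑ i ∈ Finset.range n, postVar k v (fun j : Fin i => z j) (z i) ≤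
      2 / Real.log (1 + (v : ℝ)⁻¹) * ((1 / 2) * ⨆ z : Fin n → Z,
        Real.log (1 + (v : ℝ)⁻¹ • kernelMatrix k z).det) := by
  have : Nonempty Z := ⟨z 0⟩
  have hvinv : (0 : ℝ) < (v : ℝ)⁻¹ := inv_pos.2 (by exact_mod_cast pos_iff_ne_zero.2 hv)
  have hlog : 0 < Real.log (1 + (v : ℝ)⁻¹) := Real.log_pos (by linarith)
  have hsup := le_ciSup (bddAbove_log_det hk hK hv hpos hk1 n) (fun i : Fin n => z i)
  rw [log_det_eq_sum hk hK hv hpos hk1] at hsup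
  rw [show ∀ x : ℝ, 2 / Real.log (1 + (v : ℝ)⁻¹) * ((1 / 2) * x) = x / Real.log (1 + (v : ℝ)⁻¹) by
    intro x; field_simp, le_div_iff₀ hlog]
  refine le_trans ?_ hsup
  rw [Finset.sum_mul]
  exact Finset.sum_le_sum fun i _ => mul_log_one_add_le hvinv.le (hpos _ _ _)
    ((postVar_le (hK i fun j : Fin i => z j) hv (z i)).trans (hk1 _))

end InformationGain

/-! ### Hölder bounds -/

section Holder

variable {Ω' : Type*} [MeasurableSpace Ω'] {P : Measure Ω'} [IsProbabilityMeasure P]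
  {B s : ℕ → Ω' → ℝ}

theorem integrable_rpow_mul_rpow (hs : ∀ i, Measurable (s i))
    (hs0 : ∀ i ω, 0 ≤ s i ω) (hs1 : ∀ i ω, s i ω ≤ 1) {x : ℕ → Ω' → ℝ} {i : ℕ}
    (hx : Integrable (x i) P) {ν : ℝ} (hν : 0 < ν) :
    Integrable (fun ω => x i ω * s i ω ^ ν) P := by
  refine hx.mul_bdd (c := 1) ((hs i).pow_const ν).aestronglyMeasurable
    (Filter.Eventually.of_forall fun ω => ?_)
  rw [Real.norm_eq_abs, abs_of_nonneg (Real.rpow_nonneg (hs0 i ω) _)]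
  exact Real.rpow_le_one (hs0 i ω) (hs1 i ω) hν.le

/-- Since `0 ≤ s ≤ 1`, the exponent `ν` of `s` may be lowered to `ν' = min ν 1`. Hölder's inequality
with exponents `2/(2 - ν')` and `2/ν'`, first in probability and then over the rounds, raises `s` to
the power `2`, where `Γ` is available. -/
theorem sum_integral_rpow_le (hB : ∀ i, Measurable (B i)) (hs : ∀ i, Measurable (s i))
    (hs0 : ∀ i ω, 0 ≤ s i ω) (hs1 : ∀ i ω, s i ω ≤ 1) {t : ℕ}
    (hB0 : ∀ i < t, ∀ᵐ ω ∂P, 0 ≤ B i ω)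
    (hBint : ∀ i < t, ∀ p : ℝ, 0 < p → Integrable (fun ω => B i ω ^ p) P)
    {M : ℝ → ℝ} (hM : ∀ i < t, ∀ p, 0 < p → ∫ ω, B i ω ^ p ∂P ≤ M p)
    {Γ : ℝ} (hΓ : ∀ᵐ ω ∂P, ∑ i ∈ Finset.range t, s i ω ^ 2 ≤ Γ) {ν : ℝ} (hν : 0 < ν) :
    ∑ i ∈ Finset.range t, ∫ ω, B i ω ^ (ν / 2) * s i ω ^ ν ∂P ≤
      (t * M (ν / (2 - min ν 1))) ^ (1 - min ν 1 / 2) * Γ ^ (min ν 1 / 2) := by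
  set ν' := min ν 1 with hν'
  have hν'0 : 0 < ν' := lt_min hν one_pos
  have hν'1 : ν' ≤ 1 := min_le_right _ _
  have hν'ν : ν' ≤ ν := min_le_left _ _
  set p := 2 / (2 - ν') with hp
  set r := 2 / ν' with hr
  have hp0 : 0 < p := by apply div_pos <;> linarith
  have hr0 : 0 < r := by positivity
  have hpinv : 1 / p = 1 - ν' / 2 := by rw [hp]; field_simp
  have hrinv : 1 / r = ν' / 2 := by rw [hr]; field_simp
  have hpr : p.HolderConjugate r := by
    rw [Real.holderConjugate_iff]
    refine ⟨?_, ?_⟩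
    · rw [hp, lt_div_iff₀ (by linarith)]; linarith
    · rw [← one_div, ← one_div, hpinv, hrinv]; ring
  set m := ν / (2 - ν') with hm
  have hm0 : 0 < m := by apply div_pos <;> linarith
  have hBp : ∀ i < t, ∀ᵐ ω ∂P, (B i ω ^ (ν / 2)) ^ p = B i ω ^ m := by
    intro i hi
    filter_upwards [hB0 i hi] with ω h0
    rw [← Real.rpow_mul h0]
    congr 1
    rw [hp, hm]; field_simp
  have hsr : ∀ i ω, (s i ω ^ ν') ^ r = s i ω ^ 2 := by
    intro i ω
    rw [← Real.rpow_mul (hs0 i ω), hr, mul_div_cancel₀ _ hν'0.ne']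
    exact Real.rpow_natCast _ 2
  have hs2int : ∀ i, Integrable (fun ω => s i ω ^ 2) P := fun i =>
    Integrable.of_bound ((hs i).pow_const 2).aestronglyMeasurable 1
      (Filter.Eventually.of_forall fun ω => by
        rw [Real.norm_eq_abs, abs_of_nonneg (by positivity)]
        exact pow_le_one₀ (hs0 i ω) (hs1 i ω))
  have hterm : ∀ i < t, ∫ ω, B i ω ^ (ν / 2) * s i ω ^ ν ∂P ≤
      M m ^ (1 / p) * (∫ ω, s i ω ^ 2 ∂P) ^ (1 / r) := by
    intro i hi
    have hBi := hBint i hi (ν / 2) (by positivity)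
    calc ∫ ω, B i ω ^ (ν / 2) * s i ω ^ ν ∂P
        ≤ ∫ ω, B i ω ^ (ν / 2) * s i ω ^ ν' ∂P := by
          apply integral_mono_ae (integrable_rpow_mul_rpow (x := fun i ω => B i ω ^ (ν / 2))
            hs hs0 hs1 hBi hν) (integrable_rpow_mul_rpow (x := fun i ω => B i ω ^ (ν / 2))
            hs hs0 hs1 hBi hν'0)
          filter_upwards [hB0 i hi] with ω h0
          have : s i ω ^ ν ≤ s i ω ^ ν' := by
            rcases (hs0 i ω).eq_or_lt with h | h
            · rw [← h, Real.zero_rpow hν.ne', Real.zero_rpow hν'0.ne']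
            · exact Real.rpow_le_rpow_of_exponent_ge h (hs1 i ω) hν'ν
          exact mul_le_mul_of_nonneg_left this (Real.rpow_nonneg h0 _)
      _ ≤ (∫ ω, (B i ω ^ (ν / 2)) ^ p ∂P) ^ (1 / p) *
            (∫ ω, (s i ω ^ ν') ^ r ∂P) ^ (1 / r) := by
          apply integral_mul_le_Lp_mul_Lq_of_nonneg hpr
          · filter_upwards [hB0 i hi] with ω h0 using Real.rpow_nonneg h0 _
          · exact Filter.Eventually.of_forall fun ω => Real.rpow_nonneg (hs0 i ω) _
          · rw [← integrable_norm_rpow_iff ((hB i).pow_const _).aestronglyMeasurable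
              (by simpa using hp0) ENNReal.ofReal_ne_top, ENNReal.toReal_ofReal hp0.le]
            apply (hBint i hi m hm0).congr
            filter_upwards [hB0 i hi, hBp i hi] with ω h0 h1
            rw [Real.norm_eq_abs, abs_of_nonneg (Real.rpow_nonneg h0 _), h1]
          · rw [← integrable_norm_rpow_iff ((hs i).pow_const _).aestronglyMeasurable
              (by simpa using hr0) ENNReal.ofReal_ne_top, ENNReal.toReal_ofReal hr0.le]
            apply (hs2int i).congr
            refine Filter.Eventually.of_forall fun ω => ?_
            simp only
            rw [Real.norm_eq_abs, abs_of_nonneg (Real.rpow_nonneg (hs0 i ω) _), hsr]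
      _ ≤ _ := by
          rw [integral_congr_ae (hBp i hi)]
          simp only [hsr]
          gcongr
          · exact integral_nonneg_of_ae (by
              filter_upwards [hB0 i hi] with ω h0 using Real.rpow_nonneg h0 _)
          · exact hM i hi m hm0
  have hMnn : ∀ i < t, 0 ≤ M m := fun i hi => le_trans (integral_nonneg_of_ae (by
    filter_upwards [hB0 i hi] with ω h0 using Real.rpow_nonneg h0 _)) (hM i hi m hm0)
  have hs2nn : ∀ i, 0 ≤ ∫ ω, s i ω ^ 2 ∂P := fun i => integral_nonneg fun ω => by positivity
  calc ∑ i ∈ Finset.range t, ∫ ω, B i ω ^ (ν / 2) * s i ω ^ ν ∂P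
      ≤ ∑ i ∈ Finset.range t, M m ^ (1 / p) * (∫ ω, s i ω ^ 2 ∂P) ^ (1 / r) :=
        Finset.sum_le_sum fun i hi => hterm i (Finset.mem_range.1 hi)
    _ ≤ (∑ i ∈ Finset.range t, (M m ^ (1 / p)) ^ p) ^ (1 / p) *
          (∑ i ∈ Finset.range t, ((∫ ω, s i ω ^ 2 ∂P) ^ (1 / r)) ^ r) ^ (1 / r) := by
        apply Real.inner_le_Lp_mul_Lq_of_nonneg _ hpr
        · exact fun i hi => Real.rpow_nonneg (hMnn i (Finset.mem_range.1 hi)) _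
        · exact fun i _ => Real.rpow_nonneg (hs2nn i) _
    _ = (∑ i ∈ Finset.range t, M m) ^ (1 / p) *
          (∑ i ∈ Finset.range t, ∫ ω, s i ω ^ 2 ∂P) ^ (1 / r) := by
        congr 2
        · refine Finset.sum_congr rfl fun i hi => ?_
          rw [← Real.rpow_mul (hMnn i (Finset.mem_range.1 hi)), one_div,
            inv_mul_cancel₀ hp0.ne', Real.rpow_one]
        · refine Finset.sum_congr rfl fun i _ => ?_
          rw [← Real.rpow_mul (hs2nn i), one_div, inv_mul_cancel₀ hr0.ne', Real.rpow_one]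
    _ ≤ _ := by
        rw [hpinv, hrinv, Finset.sum_const, Finset.card_range, nsmul_eq_mul]
        have h1 : 0 ≤ ∑ i ∈ Finset.range t, ∫ ω, s i ω ^ 2 ∂P :=
          Finset.sum_nonneg fun i _ => hs2nn i
        have h2 : ∑ i ∈ Finset.range t, ∫ ω, s i ω ^ 2 ∂P ≤ Γ := by
          rw [← integral_finsetSum _ fun i _ => hs2int i]
          calc _ ≤ ∫ _, Γ ∂P := integral_mono_ae (integrable_finsetSum _ fun i _ => hs2int i)
                (integrable_const _) hΓ
            _ = Γ := by simp
        -- Without any round the sign of `M` is unknown, but both sides vanish.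
        rcases Nat.eq_zero_or_pos t with rfl | ht
        · have h3 : (1 : ℝ) - ν' / 2 ≠ 0 := by linarith
          simp [Real.zero_rpow h3]
        have := hMnn 0 ht
        gcongr

theorem eval_two_sqrt_mul (q : QForm) {a x : ℝ} (ha : 0 ≤ a) (hx : 0 ≤ x) :
    q.eval (2 * √a * x) = ∑ i, q.ζ i * q.h i (∑ j, 2 ^ q.ν i j * q.lam i j *
      (a ^ (q.ν i j / 2) * x ^ q.ν i j)) := by
  unfold QForm.eval
  refine Finset.sum_congr rfl fun i _ => ?_
  congr 2
  refine Finset.sum_congr rfl fun j _ => ?_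
  rw [Real.mul_rpow (by positivity) hx, Real.mul_rpow (by positivity) (Real.sqrt_nonneg _),
    Real.sqrt_eq_rpow, ← Real.rpow_mul ha]
  ring_nf

/-- The expected widths of the confidence intervals. -/
theorem sum_integral_eval_le (q : QForm) (hB : ∀ i, Measurable (B i)) (hs : ∀ i, Measurable (s i))
    (hs0 : ∀ i ω, 0 ≤ s i ω) (hs1 : ∀ i ω, s i ω ≤ 1) {t : ℕ} (ht : 1 ≤ t)
    (hB0 : ∀ i < t, ∀ᵐ ω ∂P, 0 ≤ B i ω)
    (hBint : ∀ i < t, ∀ p : ℝ, 0 < p → Integrable (fun ω => B i ω ^ p) P)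
    {M : ℝ → ℝ} (hM : ∀ i < t, ∀ p, 0 < p → ∫ ω, B i ω ^ p ∂P ≤ M p)
    {Γ : ℝ} (hΓ : ∀ᵐ ω ∂P, ∑ i ∈ Finset.range t, s i ω ^ 2 ≤ Γ) :
    (∀ i < t, Integrable (fun ω => q.eval (2 * √(B i ω) * s i ω)) P) ∧
    ∑ i ∈ Finset.range t, ∫ ω, q.eval (2 * √(B i ω) * s i ω) ∂P ≤
      t * ∑ l, q.ζ l * q.h l (1 / t * ∑ j, (2 : ℝ) ^ q.ν l j * q.lam l j *
        (t * M (q.ν l j / (2 - min (q.ν l j) 1))) ^ (1 - min (q.ν l j) 1 / 2) *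
        Γ ^ (min (q.ν l j) 1 / 2)) := by
  set W : Fin q.n → ℕ → Ω' → ℝ := fun l i ω => ∑ j, 2 ^ q.ν l j * q.lam l j *
      (B i ω ^ (q.ν l j / 2) * s i ω ^ q.ν l j) with hW
  have hprod : ∀ i < t, ∀ l j,
      Integrable (fun ω => B i ω ^ (q.ν l j / 2) * s i ω ^ q.ν l j) P := fun i hi l j =>
    integrable_rpow_mul_rpow (x := fun i ω => B i ω ^ (q.ν l j / 2)) hs hs0 hs1
      (hBint i hi _ (by have := q.ν_pos l j; positivity)) (q.ν_pos l j)
  have hWint : ∀ i < t, ∀ l, Integrable (W l i) P := fun i hi l =>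
    integrable_finsetSum _ fun j _ => (hprod i hi l j).const_mul _
  have hW0 : ∀ i < t, ∀ l, ∀ᵐ ω ∂P, 0 ≤ W l i ω := by
    intro i hi l
    filter_upwards [hB0 i hi] with ω h0
    refine Finset.sum_nonneg fun j _ => ?_
    have h1 := q.lam_nonneg l j
    have h2 := Real.rpow_nonneg h0 (q.ν l j / 2)
    have h3 := Real.rpow_nonneg (hs0 i ω) (q.ν l j)
    positivity
  have heval : ∀ i < t, (fun ω => q.eval (2 * √(B i ω) * s i ω)) =ᵐ[P]
      fun ω => ∑ l, q.ζ l * q.h l (W l i ω) := by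
    intro i hi
    filter_upwards [hB0 i hi] with ω h0 using eval_two_sqrt_mul q h0 (hs0 i ω)
  have hhint : ∀ i < t, ∀ l, Integrable (fun ω => q.h l (W l i ω)) P := fun i hi l =>
    (q.h_mem l).integrable_comp (hWint i hi l) (hW0 i hi l)
  have hsumint : ∀ i < t, Integrable (fun ω => ∑ l, q.ζ l * q.h l (W l i ω)) P := fun i hi =>
    integrable_finsetSum _ fun l _ => (hhint i hi l).const_mul _
  refine ⟨fun i hi => (hsumint i hi).congr (heval i hi).symm, ?_⟩
  have ht0 : (0 : ℝ) < t := by exact_mod_cast ht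
  calc ∑ i ∈ Finset.range t, ∫ ω, q.eval (2 * √(B i ω) * s i ω) ∂P
      = ∑ i ∈ Finset.range t, ∑ l, q.ζ l * ∫ ω, q.h l (W l i ω) ∂P := by
        refine Finset.sum_congr rfl fun i hi => ?_
        have hi := Finset.mem_range.1 hi
        rw [integral_congr_ae (heval i hi),
          integral_finsetSum _ fun l _ => (hhint i hi l).const_mul _]
        simp only [integral_const_mul]
    _ = ∑ l, q.ζ l * ∑ i ∈ Finset.range t, ∫ ω, q.h l (W l i ω) ∂P := by
        rw [Finset.sum_comm]
        simp only [Finset.mul_sum]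
    _ ≤ ∑ l, q.ζ l * (t * q.h l (1 / t * ∑ j, (2 : ℝ) ^ q.ν l j * q.lam l j *
        (t * M (q.ν l j / (2 - min (q.ν l j) 1))) ^ (1 - min (q.ν l j) 1 / 2) *
        Γ ^ (min (q.ν l j) 1 / 2))) := by
        refine Finset.sum_le_sum fun l _ => mul_le_mul_of_nonneg_left ?_ (q.ζ_nonneg l)
        have hWi0 : ∀ i ∈ Finset.range t, 0 ≤ ∫ ω, W l i ω ∂P := fun i hi =>
          integral_nonneg_of_ae (hW0 i (Finset.mem_range.1 hi) l)
        -- Jensen's inequality is used twice: for the expectation and for the average over the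
        -- rounds.
        calc ∑ i ∈ Finset.range t, ∫ ω, q.h l (W l i ω) ∂P
            ≤ ∑ i ∈ Finset.range t, q.h l (∫ ω, W l i ω ∂P) :=
              Finset.sum_le_sum fun i hi => (q.h_mem l).integral_comp_le
                (hWint i (Finset.mem_range.1 hi) l) (hW0 i (Finset.mem_range.1 hi) l)
          _ ≤ t * q.h l (1 / t * ∑ i ∈ Finset.range t, ∫ ω, W l i ω ∂P) := by
              have := (q.h_mem l).sum_le (Finset.range t) ⟨0, Finset.mem_range.2 ht⟩ hWi0
              rwa [Finset.card_range] at this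
          _ ≤ _ := by
              have hsum0 := Finset.sum_nonneg hWi0
              have hle : ∑ i ∈ Finset.range t, ∫ ω, W l i ω ∂P ≤
                  ∑ j, (2 : ℝ) ^ q.ν l j * q.lam l j *
                    (t * M (q.ν l j / (2 - min (q.ν l j) 1))) ^ (1 - min (q.ν l j) 1 / 2) *
                    Γ ^ (min (q.ν l j) 1 / 2) := by
                calc ∑ i ∈ Finset.range t, ∫ ω, W l i ω ∂P
                    = ∑ j, 2 ^ q.ν l j * q.lam l j * ∑ i ∈ Finset.range t,
                        ∫ ω, B i ω ^ (q.ν l j / 2) * s i ω ^ q.ν l j ∂P := by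
                      simp only [Finset.mul_sum]
                      rw [Finset.sum_comm]
                      refine Finset.sum_congr rfl fun i hi => ?_
                      simp only [hW]
                      rw [integral_finsetSum _ fun j _ =>
                        (hprod i (Finset.mem_range.1 hi) l j).const_mul _]
                      simp only [integral_const_mul]
                  _ ≤ _ := by
                      refine Finset.sum_le_sum fun j _ => ?_
                      rw [mul_assoc _ ((t * M _) ^ _)]
                      refine mul_le_mul_of_nonneg_left ?_
                        (mul_nonneg (by positivity) (q.lam_nonneg l j))
                      exact sum_integral_rpow_le hB hs hs0 hs1 hB0 hBint hM hΓ (q.ν_pos l j)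
              refine mul_le_mul_of_nonneg_left ((q.h_mem l).mono ?_ ?_ ?_) ht0.le
              · exact Set.mem_Ici.2 (by positivity)
              · exact Set.mem_Ici.2 (mul_nonneg (by positivity) (hsum0.trans hle))
              · exact mul_le_mul_of_nonneg_left hle (by positivity)
    _ = _ := by
        rw [Finset.mul_sum]
        refine Finset.sum_congr rfl fun l _ => by ring

end Holder

/-! ### Discretization -/

section Discretization

/-- The cap `m - 1` puts the right end point `a = m` into the last cell. -/
theorem le_min_floor_and_le {a : ℝ} {m : ℕ} (hm : 1 ≤ m) (ha0 : 0 ≤ a) (ham : a ≤ m) :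
    ((min ⌊a⌋₊ (m - 1) : ℕ) : ℝ) ≤ a ∧ a ≤ (min ⌊a⌋₊ (m - 1) : ℕ) + 1 := by
  refine ⟨le_trans (by exact_mod_cast min_le_left _ _) (Nat.floor_le ha0), ?_⟩
  rcases min_choice ⌊a⌋₊ (m - 1) with h | h <;> rw [h]
  · exact (Nat.lt_floor_add_one a).le
  · rw [Nat.cast_sub hm]; simpa using ham

/-- The cube is cut into `m ^ d` cells of side `r / m`. From each cell that meets `X` a point of `X`
itself is taken, so the grid stays inside the design set. -/
theorem exists_finset_grid {d : ℕ} {r : ℝ} (hr : 0 < r) {X : Set (Fin d → ℝ)}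
    (hX : X ⊆ Set.Icc (fun _ => 0) (fun _ => r)) {m : ℕ} (hm : 1 ≤ m) :
    ∃ S : Finset (Fin d → ℝ), (S : Set (Fin d → ℝ)) ⊆ X ∧ S.card ≤ m ^ d ∧
      ∀ x ∈ X, ∃ s ∈ S, ∀ j, |x j - s j| ≤ r / m := by
  classical
  have hm0 : (0 : ℝ) < m := by exact_mod_cast hm
  let idx : (Fin d → ℝ) → Fin d → Fin m := fun x j =>
    ⟨min ⌊x j * m / r⌋₊ (m - 1), by omega⟩
  let c : {c : Fin d → Fin m // ∃ x ∈ X, idx x = c} → Fin d → ℝ := fun c => c.2.choose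
  refine ⟨Finset.univ.image c, ?_, ?_, ?_⟩
  · intro x hx
    simp only [Finset.coe_image, Finset.coe_univ, Set.image_univ, Set.mem_range] at hx
    obtain ⟨y, rfl⟩ := hx
    exact y.2.choose_spec.1
  · refine Finset.card_image_le.trans ?_
    rw [Finset.card_univ]
    refine (Fintype.card_subtype_le _).trans ?_
    simp
  · intro x hx
    have hex : ∃ y ∈ X, idx y = idx x := ⟨x, hx, rfl⟩
    refine ⟨c ⟨idx x, hex⟩, Finset.mem_image_of_mem _ (Finset.mem_univ _), fun j => ?_⟩
    have hs := hex.choose_spec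
    set s := c ⟨idx x, hex⟩ with hsdef
    have hsX : s ∈ X := hs.1
    have hidx : idx s j = idx x j := congrFun hs.2 j
    have bound : ∀ y ∈ X, ((idx y j : ℕ) : ℝ) ≤ y j * m / r ∧
        y j * m / r ≤ (idx y j : ℕ) + 1 := by
      intro y hy
      have h0 := (hX hy).1 j
      have h1 := (hX hy).2 j
      simp only at h0 h1
      exact le_min_floor_and_le hm (by positivity) (by rw [div_le_iff₀ hr]; nlinarith)
    have hb1 := bound x hx
    have hb2 := bound s hsX
    rw [hidx] at hb2
    have : |x j * m / r - s j * m / r| ≤ 1 := by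
      rw [abs_le]; constructor <;> linarith [hb1.1, hb1.2, hb2.1, hb2.2]
    rw [show x j * m / r - s j * m / r = (x j - s j) * (m / r) by ring, abs_mul,
      abs_of_pos (by positivity : (0 : ℝ) < m / r), ← le_div_iff₀ (by positivity)] at this
    rwa [one_div_div] at this

/-- Mean value inequality on a convex set. For the sup norm the derivative has norm at most the sum
of the `d` partial derivatives, whence the factor `d`. -/
theorem abs_sub_le_of_partials_le {d : ℕ} {X : Set (Fin d → ℝ)} (hX : Convex ℝ X)
    {φ : (Fin d → ℝ) → ℝ} {D : (Fin d → ℝ) → Fin d → ℝ}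
    (hD : ∀ x ∈ X, HasFDerivWithinAt φ
      (∑ j, D x j • (ContinuousLinearMap.proj j : (Fin d → ℝ) →L[ℝ] ℝ)) X x) {L δ : ℝ}
    (hL : ∀ x ∈ X, ∀ j, |D x j| ≤ L) (hL0 : 0 ≤ L) (hδ : 0 ≤ δ) {x y : Fin d → ℝ}
    (hx : x ∈ X) (hy : y ∈ X) (hxy : ∀ j, |x j - y j| ≤ δ) : |φ x - φ y| ≤ d * L * δ := by
  have h1 : ∀ x ∈ X, ‖∑ j, D x j • (ContinuousLinearMap.proj j : (Fin d → ℝ) →L[ℝ] ℝ)‖ ≤ d * L := by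
    intro x hx
    calc _ ≤ ∑ j, ‖D x j • (ContinuousLinearMap.proj j : (Fin d → ℝ) →L[ℝ] ℝ)‖ := norm_sum_le _ _
      _ ≤ ∑ _j : Fin d, L := by
          refine Finset.sum_le_sum fun j _ => ?_
          rw [norm_smul]
          have hp : ‖(ContinuousLinearMap.proj j : (Fin d → ℝ) →L[ℝ] ℝ)‖ ≤ 1 := by
            refine ContinuousLinearMap.opNorm_le_bound _ zero_le_one fun z => ?_
            rw [one_mul]; exact norm_le_pi_norm z j
          calc _ ≤ L * 1 := mul_le_mul (hL x hx j) hp (norm_nonneg _) hL0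
            _ = L := mul_one L
      _ = d * L := by simp
  have h2 := hX.norm_image_sub_le_of_norm_hasFDerivWithin_le hD h1 hy hx
  rw [Real.norm_eq_abs] at h2
  refine h2.trans (mul_le_mul_of_nonneg_left ?_ (by positivity))
  exact (pi_norm_le_iff_of_nonneg hδ).2 fun j => by simpa using hxy j

variable {Ω' : Type*} [MeasurableSpace Ω'] {P : Measure Ω'} [IsProbabilityMeasure P]

/-- The layer-cake integral is cut at `c √(log A)`, where the tail bound reaches `1`. Below,
probabilities are at most `1`; above, `u² - l² ≥ (u - l)²` leaves a Gaussian integral `c √π / 2`. -/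
theorem lintegral_le_of_subGaussian_tail {M : Ω' → ℝ} (hM : Measurable M) (hM0 : ∀ ω, 0 ≤ M ω)
    {A c : ℝ} (hA : 0 ≤ A) (hc : 0 < c)
    (htail : ∀ s, 0 < s → P {ω | s < M ω} ≤ ENNReal.ofReal (A * Real.exp (-(s / c) ^ 2))) :
    ∫⁻ ω, ENNReal.ofReal (M ω) ∂P ≤
      ENNReal.ofReal (c * (√(Real.log A) + √Real.pi / 2)) := by
  set l := √(Real.log A) with hl
  have hl0 : 0 ≤ l := Real.sqrt_nonneg _
  -- For `A < 1` the square root of the negative logarithm is `0`, and the bound reads `A ≤ 1`.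
  have hAl : A ≤ Real.exp (l ^ 2) := by
    rcases hA.eq_or_lt with h | h
    · rw [← h]; positivity
    · rw [← Real.exp_log h]
      apply Real.exp_le_exp.2
      rcases le_total 0 (Real.log A) with h0 | h0
      · rw [hl, Real.sq_sqrt h0]
      · exact h0.trans (sq_nonneg _)
  rw [lintegral_eq_lintegral_meas_lt _ (Filter.Eventually.of_forall hM0) hM.aemeasurable,
    ← Set.Ioc_union_Ioi_eq_Ioi (mul_nonneg hc.le hl0), lintegral_union measurableSet_Ioi
      (Set.Ioc_disjoint_Ioi le_rfl), mul_add,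
    ENNReal.ofReal_add (by positivity) (by positivity)]
  gcongr
  · calc _ ≤ ∫⁻ _ in Set.Ioc 0 (c * l), 1 := lintegral_mono fun s => prob_le_one
      _ = _ := by simp
  · calc _ ≤ ∫⁻ s in Set.Ioi (c * l), ENNReal.ofReal (Real.exp (-(1 / c ^ 2) * (s - c * l) ^ 2)) := by
          refine setLIntegral_mono (by fun_prop) fun s hs => ?_
          have hs' : c * l < s := hs
          have hs0 : 0 < s := lt_of_le_of_lt (by positivity) hs'
          refine (htail s hs0).trans (ENNReal.ofReal_le_ofReal ?_)
          calc A * Real.exp (-(s / c) ^ 2) ≤ Real.exp (l ^ 2) * Real.exp (-(s / c) ^ 2) := by gcongr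
            _ = Real.exp (l ^ 2 - (s / c) ^ 2) := by rw [← Real.exp_add]; ring_nf
            _ ≤ _ := by
              apply Real.exp_le_exp.2
              set u := s / c with hu
              have hsu : s = c * u := by rw [hu]; field_simp
              have hul : l ≤ u := by rw [hu, le_div_iff₀ hc]; linarith
              rw [hsu, show -(1 / c ^ 2) * (c * u - c * l) ^ 2 = -(u - l) ^ 2 by field_simp]
              nlinarith
      _ = ∫⁻ s in Set.Ioi 0, ENNReal.ofReal (Real.exp (-(1 / c ^ 2) * s ^ 2)) := by
          rw [← lintegral_indicator measurableSet_Ioi, ← lintegral_indicator measurableSet_Ioi,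
            ← lintegral_add_right_eq_self _ (c * l)]
          congr 1
          ext x
          simp [Set.indicator]
      _ = ENNReal.ofReal (∫ s in Set.Ioi 0, Real.exp (-(1 / c ^ 2) * s ^ 2)) := by
          rw [ofReal_integral_eq_lintegral_ofReal]
          · exact (integrable_exp_neg_mul_sq (by positivity)).integrableOn
          · exact Filter.Eventually.of_forall fun s => (Real.exp_pos _).le
      _ ≤ _ := by
          rw [integral_gaussian_Ioi]
          apply ENNReal.ofReal_le_ofReal
          rw [show Real.pi / (1 / c ^ 2) = c ^ 2 * Real.pi by field_simp,
            Real.sqrt_mul (by positivity), Real.sqrt_sq hc.le]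
          linarith

variable {d : ℕ} {W : Type*} [Fintype W] [Nonempty W]

/-- If all `d |W|` partial derivatives are at most `L`, then `M ≤ d L δ`. A union bound gives `M` a
sub-Gaussian tail with constant `a d |W|` and scale `d δ b`. -/
theorem lintegral_discretization_le {X : Set (Fin d → ℝ)} (hXconvex : Convex ℝ X)
    {f : Ω' → (Fin d → ℝ) → W → ℝ} {a b : ℝ} (ha : 0 < a) (hb : 0 < b)
    (hpartial : HasSubGaussianPartials a b X f P) (hd : 0 < d) {δ : ℝ} (hδ : 0 < δ)
    {M : Ω' → ℝ} (hM : Measurable M) (hM0 : ∀ ω, 0 ≤ M ω)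
    (hMle : ∀ᵐ ω ∂P, ∃ x ∈ X, ∃ y ∈ X, (∀ j, |x j - y j| ≤ δ) ∧
      M ω ≤ ⨆ w, |f ω x w - f ω y w|) :
    ∫⁻ ω, ENNReal.ofReal (M ω) ∂P ≤ ENNReal.ofReal
      (d * δ * b * (√(Real.log (a * d * Fintype.card W)) + √Real.pi / 2)) := by
  obtain ⟨D, hD, htail⟩ := hpartial
  have hd0 : (0 : ℝ) < d := by exact_mod_cast hd
  refine lintegral_le_of_subGaussian_tail hM hM0 (by positivity) (by positivity) fun s hs => ?_
  set L := s / (d * δ) with hL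
  have hL0 : 0 < L := by positivity
  have hLs : d * L * δ = s := by rw [hL]; field_simp
  calc P {ω | s < M ω}
      ≤ P (⋃ q : Fin d × W, {ω | ENNReal.ofReal L < ⨆ x ∈ X, ‖D ω x q.2 q.1‖ₑ}) := by
        apply measure_mono_ae
        filter_upwards [hD, hMle] with ω hω hMω hlt
        by_contra hnot
        have hnot' : ∀ q : Fin d × W, ⨆ x ∈ X, ‖D ω x q.2 q.1‖ₑ ≤ ENNReal.ofReal L := by
          intro q
          by_contra hq
          exact hnot (Set.mem_iUnion.2 ⟨q, not_le.1 hq⟩)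
        obtain ⟨x, hx, y, hy, hxy, hle⟩ := hMω
        have hDL : ∀ w, ∀ x ∈ X, ∀ j, |D ω x w j| ≤ L := by
          intro w x hx j
          have h1 : ‖D ω x w j‖ₑ ≤ ENNReal.ofReal L :=
            (le_iSup₂ (f := fun x (_ : x ∈ X) => ‖D ω x w j‖ₑ) x hx).trans (hnot' (j, w))
          rwa [← ofReal_norm, ENNReal.ofReal_le_ofReal_iff hL0.le,
            Real.norm_eq_abs] at h1
        have h2 : ⨆ w, |f ω x w - f ω y w| ≤ s := by
          refine ciSup_le fun w => ?_
          rw [← hLs]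
          exact abs_sub_le_of_partials_le hXconvex (φ := fun v => f ω v w) (hω w) (hDL w) hL0.le
            hδ.le hx hy hxy
        exact absurd (hle.trans h2) (not_le.2 hlt)
    _ ≤ ∑ q : Fin d × W, P {ω | ENNReal.ofReal L < ⨆ x ∈ X, ‖D ω x q.2 q.1‖ₑ} :=
        measure_iUnion_fintype_le _ _
    _ ≤ ∑ _q : Fin d × W, ENNReal.ofReal (a * Real.exp (-(L / b) ^ 2)) :=
        Finset.sum_le_sum fun q _ => htail q.1 q.2 L hL0
    _ = _ := by
        rw [Finset.sum_const, Finset.card_univ, nsmul_eq_mul, Fintype.card_prod, Fintype.card_fin,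
          ← ENNReal.ofReal_natCast, ← ENNReal.ofReal_mul (by positivity)]
        congr 1
        push_cast
        have : L / b = s / (d * δ * b) := by rw [hL]; field_simp
        rw [this]
        ring

/-- The finite set of points used in round `t`. -/
theorem exists_grid {r : ℝ} {X : Set (Fin d → ℝ)}
    (hX : X ⊆ Set.Icc (fun _ => 0) (fun _ => r)) (hXconvex : Convex ℝ X)
    {f : Ω' → (Fin d → ℝ) → W → ℝ} {a b : ℝ} (ha : 0 < a) (hb : 0 < b)
    (hpartial : HasSubGaussianPartials a b X f P) {t : ℕ} (ht : 1 ≤ t) :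
    ∃ S : Finset (Fin d → ℝ), (S : Set (Fin d → ℝ)) ⊆ X ∧
      ((1 + S.card) * Fintype.card W : ℝ) ≤ kappa a b r d W t ∧
      ∀ M : Ω' → ℝ, Measurable M → (∀ ω, 0 ≤ M ω) →
        (∀ᵐ ω ∂P, ∃ x ∈ X, ∃ y ∈ X, M ω ≤ (⨆ w, |f ω x w - f ω y w|) ∧
          ∀ s ∈ S, M ω ≤ ⨆ w, |f ω x w - f ω s w|) →
        ∫⁻ ω, ENNReal.ofReal (M ω) ∂P ≤ ENNReal.ofReal (1 / (t : ℝ) ^ 2) := by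
  have ht0 : (0 : ℝ) < t := by exact_mod_cast ht
  -- For at most one point (in particular `d = 0` or `r = 0`) the empty grid suffices: the
  -- comparison of `x` with `y` already forces `M ≤ 0`. Otherwise `d` and `r` are positive and only
  -- the comparison with the grid is used.
  by_cases hsub : X.Subsingleton
  · refine ⟨∅, by simp, ?_, ?_⟩
    · unfold kappa
      gcongr
      simp
    · intro M hM hM0 hle
      have : ∀ᵐ ω ∂P, ENNReal.ofReal (M ω) = 0 := by
        filter_upwards [hle] with ω ⟨x, hx, y, hy, h1, _⟩
        rw [hsub hx hy] at h1
        rw [ENNReal.ofReal_eq_zero]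
        simpa using h1
      rw [lintegral_congr_ae this]
      simp
  · obtain ⟨x, hx, y, hy, hxy⟩ := Set.not_subsingleton_iff.1 hsub
    obtain ⟨j, hj⟩ := Function.ne_iff.1 hxy
    have hd : 0 < d := j.pos
    have hr : 0 < r := by
      have h1 := (hX hx).1 j
      have h2 := (hX hx).2 j
      have h3 := (hX hy).1 j
      have h4 := (hX hy).2 j
      simp only at h1 h2 h3 h4
      rcases lt_or_gt_of_ne hj with h | h <;> linarith
    have hd0 : (0 : ℝ) < d := by exact_mod_cast hd
    set Q := √(Real.log (a * d * Fintype.card W)) + √Real.pi / 2 with hQ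
    have hQ0 : 0 < Q := by
      have : 0 < √Real.pi := Real.sqrt_pos.2 Real.pi_pos
      have := Real.sqrt_nonneg (Real.log (a * d * Fintype.card W))
      positivity
    have harg : 0 < b * d * r * (t : ℝ) ^ 2 * Q := by positivity
    set m := ⌈b * d * r * (t : ℝ) ^ 2 * Q⌉₊ with hm
    have hm1 : 1 ≤ m := Nat.ceil_pos.2 harg
    have hmle : b * d * r * (t : ℝ) ^ 2 * Q ≤ m := Nat.le_ceil _
    have hm0 : (0 : ℝ) < m := by exact_mod_cast hm1
    obtain ⟨S, hSX, hScard, hS⟩ := exists_finset_grid hr hX hm1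
    refine ⟨S, hSX, ?_, ?_⟩
    · unfold kappa
      rw [← hQ, ← hm]
      gcongr
      exact_mod_cast hScard
    · intro M hM hM0 hle
      refine (lintegral_discretization_le hXconvex ha hb hpartial hd (δ := r / m) (by positivity)
        hM hM0 ?_).trans (ENNReal.ofReal_le_ofReal ?_)
      · filter_upwards [hle] with ω ⟨x, hx, y, hy, _, h2⟩
        obtain ⟨s, hs, hxs⟩ := hS x hx
        exact ⟨x, hx, s, hSX hs, hxs, h2 s hs⟩
      · rw [← hQ, show d * (r / m) * b * Q = (b * d * r * Q) / m by ring,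
          div_le_div_iff₀ hm0 (by positivity)]
        linarith

end Discretization

/-! ### The adaptive design generated by the algorithm -/

section Version

variable {Ω' : Type*} [MeasurableSpace Ω'] {d : ℕ} {W : Type*} [Finite W]
  [MeasurableSpace W] [DiscreteMeasurableSpace W] {P : Measure Ω'} [IsProbabilityMeasure P]
  {X : Set (Fin d → ℝ)} {f : Ω' → (Fin d → ℝ) → W → ℝ}
  {k : (Fin d → ℝ) × W → (Fin d → ℝ) × W → ℝ}

theorem measurable_uncurry_process (hfm : ∀ w, Measurable fun p : X × Ω' => f p.2 p.1 w) :
    Measurable fun p : (X × W) × Ω' => f p.2 p.1.1 p.1.2 := by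
  have h : Measurable fun q : (X × Ω') × W => f q.1.2 q.1.1 q.2 :=
    measurable_from_prod_countable_left hfm
  exact h.comp (f := fun p : (X × W) × Ω' => ((p.1.1, p.2), p.1.2)) (by fun_prop)

/-- A process with continuous paths is a jointly measurable function of its values on a countable
dense set. -/
theorem exists_measurable_version [Nonempty X]
    (hcont : ∀ᵐ ω ∂P, ∀ w, ContinuousOn (fun x => f ω x w) X) :
    ∃ (e : ℕ → X) (g : (ℕ × W → ℝ) × (X × W) → ℝ), Measurable g ∧
      ∀ᵐ ω ∂P, ∀ z : X × W, g (fun i => f ω (e i.1) i.2, z) = f ω z.1 z.2 := by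
  set e : ℕ → X := TopologicalSpace.denseSeq X
  -- The limsup along nearest points of the dense sequence is measurable everywhere, and it is the
  -- limit wherever the path is continuous.
  refine ⟨e, fun q => Filter.limsup (fun N => q.1 (SimpleFunc.nearestPtInd e N q.2.1, q.2.2))
    Filter.atTop, ?_, ?_⟩
  · refine Measurable.limsup fun N => ?_
    have h : Measurable fun q : (ℕ × W → ℝ) × (ℕ × W) => q.1 q.2 :=
      measurable_from_prod_countable_left fun i => measurable_pi_apply i
    have h2 := (SimpleFunc.nearestPtInd e N).measurable
    exact h.comp (f := fun q : (ℕ × W → ℝ) × (X × W) =>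
      (q.1, (SimpleFunc.nearestPtInd e N q.2.1, q.2.2))) (by fun_prop)
  · filter_upwards [hcont] with ω hω z
    have h1 : Filter.Tendsto (fun N => SimpleFunc.nearestPt e N z.1) Filter.atTop (nhds z.1) :=
      SimpleFunc.tendsto_nearestPt (TopologicalSpace.denseRange_denseSeq X z.1)
    have h2 : Continuous fun x : X => f ω x z.2 := (hω z.2).domRestrict
    exact ((h2.tendsto z.1).comp h1).limsup_eq

/-- The kernel is the expectation of a jointly measurable product, so its measurability need not be
assumed. -/
theorem measurable_covariance_kernel (hf : IsCentredGP X f k P) :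
    Measurable fun q : (X × W) × (X × W) => k (q.1.1, q.1.2) (q.2.1, q.2.2) := by
  have hm := measurable_uncurry_process hf.measurable
  have h1 : Measurable fun q : ((X × W) × (X × W)) × Ω' =>
      f q.2 q.1.1.1 q.1.1.2 * f q.2 q.1.2.1 q.1.2.2 :=
    (hm.comp (f := fun q : ((X × W) × (X × W)) × Ω' => (q.1.1, q.2)) (by fun_prop)).mul
      (hm.comp (f := fun q : ((X × W) × (X × W)) × Ω' => (q.1.2, q.2)) (by fun_prop))
  have h2 := (h1.stronglyMeasurable.integral_prod_right' (ν := P)).measurable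
  convert h2 using 1
  ext q
  rw [← hf.cov _ q.1.1.2, covariance, hf.mean _ q.1.1.2, hf.mean _ q.2.1.2]
  · simp
  · exact q.2.1.2

theorem hasGaussianLaw_of_finite (hf : IsCentredGP X f k P) {ι : Type*} [Fintype ι]
    (z : ι → X × W) : HasGaussianLaw (fun ω i => f ω (z i).1 (z i).2) P := by
  classical
  let L : ({i // i ∈ (Finset.univ : Finset ι)} → ℝ) →L[ℝ] ι → ℝ :=
    { toFun x i := x ⟨i, Finset.mem_univ i⟩
      map_add' x y := by ext; simp
      map_smul' m x := by ext; simp }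
  exact ((hf.gaussian.comp_right z).hasGaussianLaw Finset.univ).map L

end Version

/-! ### Independence of functions of disjoint sources -/

section Sources

theorem measurable_real_pi {Ω' ι : Type*} {m : MeasurableSpace Ω'} {F : Ω' → ι → ℝ}
    (h : ∀ i, Measurable[m] fun ω => F ω i) : Measurable[m] F :=
  measurable_pi_lambda _ h

variable {Ω' : Type*} [mΩ : MeasurableSpace Ω'] {P : Measure Ω'} {ι : Type*}
  {m : ι → MeasurableSpace Ω'} {α β : Type*} [MeasurableSpace α] [MeasurableSpace β]

theorem indepFun_of_disjoint_sources (hle : ∀ i, m i ≤ mΩ) (hm : iIndep m P) {S T : Set ι}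
    (hST : Disjoint S T) {F : Ω' → α} {G : Ω' → β} (hF : Measurable[⨆ i ∈ S, m i] F)
    (hG : Measurable[⨆ i ∈ T, m i] G) : IndepFun F G P :=
  (IndepFun_iff_Indep F G P).2 (indep_of_indep_of_le_left (indep_of_indep_of_le_right
    (indep_iSup_of_disjoint hle hm hST) hG.comap_le) hF.comap_le)

end Sources

/-! ### The execution as an adaptive design -/

section Design

variable {Ω' : Type*} [mΩ : MeasurableSpace Ω'] {d : ℕ} {W : Type*} [Fintype W] [Nonempty W]
  [MeasurableSpace W] [DiscreteMeasurableSpace W] {P : Measure Ω'} [IsProbabilityMeasure P]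
  {X : Set (Fin d → ℝ)} {f : Ω' → (Fin d → ℝ) → W → ℝ}
  {k : (Fin d → ℝ) × W → (Fin d → ℝ) × W → ℝ} {v : ℝ≥0} {ε ξ β : ℕ → Ω' → ℝ}
  {ρ : (W → ℝ) → ℝ} {R : Run Ω' d W}

theorem measurable_data (hf : IsCentredGP X f k P) (hεm : ∀ t, Measurable (ε t))
    (hβm : ∀ t, Measurable (β t)) (hR : R.IsExecution X k v f ε β ρ P) (n : ℕ) :
    Measurable (R.data f ε β n) := by
  have hm := measurable_uncurry_process hf.measurable
  induction n with
  | zero => exact measurable_pi_lambda _ fun i => i.elim0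
  | succ n ih =>
    refine measurable_pi_lambda _ fun i => ?_
    refine Fin.lastCases ?_ (fun i => ?_) i
    · have hp : Measurable fun ω => (R.data f ε β n ω, β (n + 1) ω) := ih.prodMk (hβm _)
      have hx : Measurable (R.x (n + 1)) := (hR.x_adapted n).mono hp.comap_le le_rfl
      have hw : Measurable (R.w (n + 1)) := (hR.w_adapted n).mono hp.comap_le le_rfl
      have ho : Measurable (R.obs f ε (n + 1)) :=
        (hm.comp (f := fun ω => (((⟨R.x (n + 1) ω, hR.x_mem n ω⟩ : X), R.w (n + 1) ω), ω))
          (((hx.subtype_mk).prodMk hw).prodMk measurable_id)).add (hεm _)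
      exact hx.prodMk (hw.prodMk (ho.prodMk (hβm _)))
    · exact (measurable_pi_apply i).comp ih

theorem measurable_obs (hf : IsCentredGP X f k P) (hεm : ∀ t, Measurable (ε t))
    (hβm : ∀ t, Measurable (β t)) (hR : R.IsExecution X k v f ε β ρ P) (n : ℕ) :
    Measurable (R.obs f ε (n + 1)) :=
  ((measurable_pi_apply (Fin.last n)).comp
    (measurable_data hf hεm hβm hR (n + 1))).snd.snd.fst

/-- The data are a function of the observations and of the confidence parameters. -/
theorem exists_data_eq (hX : MeasurableSet X) [Nonempty X]
    (hR : R.IsExecution X k v f ε β ρ P) :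
    ∃ φ : ∀ n, (Fin n → (Fin d → ℝ) × W × ℝ × ℝ) × ℝ → X × W, (∀ n, Measurable (φ n)) ∧
      (∀ n ω, φ n (R.data f ε β n ω, β (n + 1) ω) =
        (⟨R.x (n + 1) ω, hR.x_mem n ω⟩, R.w (n + 1) ω)) ∧
    ∀ n, ∃ D : (ℕ → ℝ) × (ℕ → ℝ) → Fin n → (Fin d → ℝ) × W × ℝ × ℝ, Measurable D ∧
      ∀ ω, R.data f ε β n ω =
        D (trunc n fun j => β (j + 1) ω, trunc n fun j => R.obs f ε (j + 1) ω) := by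
  -- Factoring adapted choices through the data requires a standard Borel target.
  have := hX.standardBorel
  have hφ : ∀ n, ∃ φ : (Fin n → (Fin d → ℝ) × W × ℝ × ℝ) × ℝ → X × W, Measurable φ ∧
      (fun ω => ((⟨R.x (n + 1) ω, hR.x_mem n ω⟩ : X), R.w (n + 1) ω)) =
        φ ∘ fun ω => (R.data f ε β n ω, β (n + 1) ω) := fun n =>
    Measurable.exists_eq_measurable_comp
      (((hR.x_adapted n).subtype_mk).prodMk (hR.w_adapted n))
  choose φ hφm hφ using hφ
  refine ⟨φ, hφm, fun n ω => (congrFun (hφ n) ω).symm, fun n => ?_⟩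
  induction n with
  | zero => exact ⟨fun _ i => i.elim0, measurable_pi_lambda _ fun i => i.elim0,
      fun ω => funext fun i => i.elim0⟩
  | succ n ih =>
    obtain ⟨D, hD, hDR⟩ := ih
    set D' : (ℕ → ℝ) × (ℕ → ℝ) → Fin n → (Fin d → ℝ) × W × ℝ × ℝ :=
      fun s => D (trunc n s.1, trunc n s.2) with hD'
    have hD'm : Measurable D' := by fun_prop
    set z : (ℕ → ℝ) × (ℕ → ℝ) → X × W := fun s => φ n (D' s, s.1 n) with hz
    have hzm : Measurable z := by
      have := hφm n
      fun_prop
    refine ⟨fun s => Fin.snoc (α := fun _ => (Fin d → ℝ) × W × ℝ × ℝ) (D' s)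
      ((z s).1, (z s).2, s.2 n, s.1 n), ?_, fun ω => ?_⟩
    · refine measurable_pi_lambda _ fun i => ?_
      refine Fin.lastCases ?_ (fun i => ?_) i
      · simp only [Fin.snoc_last]
        exact hzm.fst.subtype_val.prodMk (by fun_prop)
      · simp only [Fin.snoc_castSucc]
        fun_prop
    · have h1 : D' (trunc (n + 1) fun j => β (j + 1) ω,
          trunc (n + 1) fun j => R.obs f ε (j + 1) ω) = R.data f ε β n ω := by
        simp only [hD']
        rw [trunc_trunc_of_le n.le_succ, trunc_trunc_of_le n.le_succ, hDR]
      have h2 := congrFun (hφ n) ω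
      ext1 i
      refine Fin.lastCases ?_ (fun i => ?_) i
      · simp only [Fin.snoc_last, hz, h1]
        rw [trunc_of_lt n.lt_succ_self, trunc_of_lt n.lt_succ_self]
        simp only [Function.comp_apply] at h2
        rw [← h2]
        rfl
      · simp only [Fin.snoc_castSucc, h1]
        rfl

/-- Index `n` stands for round `n + 1`. The process is encoded by its values `A` on a countable
dense set, `U` collects the confidence parameters, and the choices become measurable functions of
`U` and the observations. -/
theorem exists_adaptiveDesign (hX : IsCompact X) [Nonempty X]
    (hf : IsCentredGP X f k P) (hεm : ∀ t, Measurable (ε t))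
    (hε : ∀ t, 1 ≤ t → HasLaw (ε t) (gaussianReal 0 v) P) (hξm : ∀ t, Measurable (ξ t))
    (hindep : iIndep (sourceSigma X f ε ξ) P)
    (hcont : ∀ᵐ ω ∂P, ∀ w, ContinuousOn (fun x => f ω x w) X) {c : ℕ → ℝ}
    (hβ : ∀ t ω, β t ω = c t + ξ t ω) (hR : R.IsExecution X k v f ε β ρ P) :
    ∃ (A : Ω' → ℕ × W → ℝ) (g : (ℕ × W → ℝ) × (X × W) → ℝ)
      (Zf : ℕ → (ℕ → ℝ) × (ℕ → ℝ) → X × W) (xh : ℕ → (ℕ → ℝ) × (ℕ → ℝ) → X),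
      AdaptiveDesign (fun z z' : X × W => k (z.1, z.2) (z'.1, z'.2)) v A g
        (fun ω i => β (i + 1) ω) (fun i => ε (i + 1)) (fun i => R.obs f ε (i + 1)) Zf P ∧
      (∀ᵐ ω ∂P, ∀ z : X × W, g (A ω, z) = f ω z.1 z.2) ∧
      (∀ n ω, Zf n (fun i => β (i + 1) ω, trunc n fun j => R.obs f ε (j + 1) ω) =
        (⟨R.x (n + 1) ω, hR.x_mem n ω⟩, R.w (n + 1) ω)) ∧
      (∀ n, Measurable (xh n)) ∧
      ∀ n ω, xh n (trunc n fun i => β (i + 1) ω, trunc n fun j => R.obs f ε (j + 1) ω) =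
        ⟨R.xhat (n + 1) ω, hR.xhat_mem n ω⟩ := by
  have hβm : ∀ t, Measurable (β t) := fun t => by
    have : β t = fun ω => c t + ξ t ω := funext (hβ t)
    rw [this]; exact (hξm t).const_add _
  have hm := measurable_uncurry_process hf.measurable
  have hfz : ∀ z : X × W, Measurable fun ω => f ω z.1 z.2 := fun z =>
    hm.comp (f := fun ω => (z, ω)) (by fun_prop)
  have := hX.measurableSet.standardBorel
  obtain ⟨e, g, hg, hgf⟩ := exists_measurable_version hcont
  obtain ⟨φ, hφm, hφ, hD⟩ := exists_data_eq hX.measurableSet hR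
  choose D hDm hD using hD
  have hψ : ∀ n, ∃ ψ : (Fin n → (Fin d → ℝ) × W × ℝ × ℝ) → X, Measurable ψ ∧
      (fun ω => (⟨R.xhat (n + 1) ω, hR.xhat_mem n ω⟩ : X)) = ψ ∘ R.data f ε β n := fun n =>
    Measurable.exists_eq_measurable_comp ((hR.xhat_adapted n).subtype_mk)
  choose ψ hψm hψ using hψ
  set A : Ω' → ℕ × W → ℝ := fun ω i => f ω (e i.1) i.2 with hA
  have hZ : ∀ n ω, φ n (D n (trunc n fun i => β (i + 1) ω,
      trunc n (trunc n fun j => R.obs f ε (j + 1) ω)), β (n + 1) ω) =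
        (⟨R.x (n + 1) ω, hR.x_mem n ω⟩, R.w (n + 1) ω) := fun n ω => by
    rw [trunc_trunc_of_le le_rfl, ← hD, hφ]
  have hle : ∀ i, sourceSigma X f ε ξ i ≤ mΩ := by
    rintro (_ | i | i)
    · exact iSup₂_le fun x hx => iSup_le fun w => (hfz (⟨x, hx⟩, w)).comap_le
    · exact (hεm _).comap_le
    · exact (hξm _).comap_le
  have hsub : ∀ {S : Set (Option (ℕ ⊕ ℕ))} {i}, i ∈ S →
      sourceSigma X f ε ξ i ≤ ⨆ i ∈ S, sourceSigma X f ε ξ i := fun {S i} hi =>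
    le_iSup₂ (f := fun i (_ : i ∈ S) => sourceSigma X f ε ξ i) i hi
  have hAS : ∀ {S : Set (Option (ℕ ⊕ ℕ))}, none ∈ S →
      Measurable[⨆ i ∈ S, sourceSigma X f ε ξ i] A := fun {S} hS => by
    refine measurable_real_pi fun i => ?_
    refine Measurable.mono (comap_measurable (fun ω => f ω (e i.1) i.2))
      (le_trans ?_ (hsub hS)) le_rfl
    exact le_iSup_of_le (e i.1 : Fin d → ℝ) (le_iSup_of_le (e i.1).2
      (le_iSup (fun w => MeasurableSpace.comap (fun ω => f ω (e i.1) w) inferInstance) i.2))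
  have hES : ∀ {S : Set (Option (ℕ ⊕ ℕ))} {j}, some (Sum.inl j) ∈ S →
      Measurable[⨆ i ∈ S, sourceSigma X f ε ξ i] (ε (j + 1)) := fun {S j} hS =>
    (comap_measurable (ε (j + 1))).mono (hsub hS) le_rfl
  have hUS : ∀ {S : Set (Option (ℕ ⊕ ℕ))} {j}, some (Sum.inr j) ∈ S →
      Measurable[⨆ i ∈ S, sourceSigma X f ε ξ i] (β (j + 1)) := fun {S j} hS => by
    have : β (j + 1) = fun ω => c (j + 1) + ξ (j + 1) ω := funext (hβ _)
    rw [this]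
    exact ((comap_measurable (ξ (j + 1))).mono (hsub hS) le_rfl).const_add _
  have htr : ∀ {S : Set (Option (ℕ ⊕ ℕ))} (n : ℕ) {s : Ω' → ℕ → ℝ},
      (∀ j < n, Measurable[⨆ i ∈ S, sourceSigma X f ε ξ i] fun ω => s ω j) →
      Measurable[⨆ i ∈ S, sourceSigma X f ε ξ i] fun ω => trunc n (s ω) := by
    intro S n s hs
    refine measurable_real_pi fun j => ?_
    unfold trunc
    split_ifs with hj
    · exact hs j hj
    · exact measurable_const
  -- The evaluated point reads `s.1 n`, the current confidence parameter, in addition to the past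
  -- data; the estimated solution does not.
  refine ⟨A, g, fun n s => φ n (D n (trunc n s.1, trunc n s.2), s.1 n),
    fun n s => ψ n (D n (trunc n s.1, trunc n s.2)), ?_, hgf, hZ, fun n => ?_, fun n ω => ?_⟩
  · refine
      { kernel_measurable := measurable_covariance_kernel hf
        A_measurable := measurable_real_pi fun i => hfz (e i.1, i.2)
        g_measurable := hg
        U_measurable := measurable_real_pi fun i => hβm _
        noise_measurable := fun i => hεm _
        input_measurable := fun n => ?_
        gaussian := fun n z => (hasGaussianLaw_of_finite hf z).congr ?_
        mean := fun z => ?_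
        cov := fun z z' => ?_
        noise_law := fun i => (hε _ (by omega)).map_eq
        noise_indep := fun n => ?_
        noise_iIndep := ?_
        indep := ?_
        U_indep := fun n => ?_
        input_trunc := fun n u y => ?_
        obs := ?_ }
    · have := hφm n
      have := hDm n
      fun_prop
    · filter_upwards [hgf] with ω hω
      ext o
      exact (hω (z o)).symm
    · rw [← hf.mean z.1 z.1.2 z.2]
      refine integral_congr_ae ?_
      filter_upwards [hgf] with ω hω using hω z
    · rw [← hf.cov _ z.1.2 _ _ z'.1.2]
      have hint : ∀ z : X × W, ∫ ω, g (A ω, z) ∂P = ∫ ω, f ω z.1 z.2 ∂P := fun z => by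
        refine integral_congr_ae ?_
        filter_upwards [hgf] with ω hω using hω z
      simp only [covariance, hint]
      refine integral_congr_ae ?_
      filter_upwards [hgf] with ω hω
      rw [hω, hω]
    · refine indepFun_of_disjoint_sources hle hindep
        (S := {some (Sum.inl n)}ᶜ) (T := {some (Sum.inl n)}) disjoint_compl_left ?_ (hES rfl)
      refine ((hAS (by simp)).prodMk (measurable_real_pi fun i => hUS (by simp))).prodMk
        (htr n fun j hj => hES ?_)
      simp [hj.ne]
    · exact hindep.precomp (g := fun i : ℕ => some (Sum.inl i)) fun i j h => by simpa using h
    · refine indepFun_of_disjoint_sources hle hindep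
        (S := {none}ᶜ) (T := {none}) disjoint_compl_left ?_ (hAS rfl)
      exact (measurable_real_pi fun i => hUS (by simp)).prodMk
        (measurable_real_pi fun i => hES (by simp))
    · refine indepFun_of_disjoint_sources hle hindep
        (S := {some (Sum.inr n)}ᶜ) (T := {some (Sum.inr n)}) disjoint_compl_left ?_ (hUS rfl)
      refine ((hAS (by simp)).prodMk (htr n fun j hj => hUS ?_)).prodMk
        (measurable_real_pi fun i => hES (by simp))
      simp [hj.ne]
    · simp only
      rw [trunc_trunc_of_le n.le_succ, trunc_of_lt n.lt_succ_self]
    · filter_upwards [hgf] with ω hω n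
      rw [hZ, hω]
      rfl
  · have := hψm n
    have := hDm n
    fun_prop
  · simp only
    rw [trunc_trunc_of_le le_rfl, trunc_trunc_of_le le_rfl, ← hD]
    exact (congrFun (hψ n) ω).symm

end Design

/-! ### Regret of a single round -/

theorem QForm.eval_nonneg (q : QForm) {a : ℝ} (ha : 0 ≤ a) : 0 ≤ q.eval a :=
  Finset.sum_nonneg fun i _ => mul_nonneg (q.ζ_nonneg i) ((q.h_mem i).nonneg
    (Finset.sum_nonneg fun j _ => mul_nonneg (q.lam_nonneg i j) (Real.rpow_nonneg ha _)))

theorem QForm.measurable_eval_comp (q : QForm) {α : Type*} [MeasurableSpace α] {φ : α → ℝ}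
    (hφ : Measurable φ) (h0 : ∀ a, 0 ≤ φ a) : Measurable fun a => q.eval (φ a) := by
  refine Finset.measurable_fun_sum _ fun i _ => Measurable.const_mul ?_ _
  have h1 : Measurable fun a => ∑ j, q.lam i j * φ a ^ q.ν i j :=
    Finset.measurable_fun_sum _ fun j _ => (hφ.pow_const _).const_mul _
  convert (q.h_mem i).measurable_comp_max.comp h1 using 2 with a
  simp only [Function.comp_apply]
  rw [max_eq_left]
  exact Finset.sum_nonneg fun j _ => mul_nonneg (q.lam_nonneg i j) (Real.rpow_nonneg (h0 a) _)

/-- If the credible sets contain the true values at `p` and at the estimated solution `xh`, the gap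
between these values is at most twice the width at the evaluated point. -/
theorem sub_le_two_mul_width {α W : Type*} {ρ : (W → ℝ) → ℝ} {X : Set α} {G : α → Set (W → ℝ)}
    {μ : α → W → ℝ} {l u : α → ℝ} (hμ : ∀ x ∈ X, μ x ∈ G x)
    (hlu : ∀ x ∈ X, l x ∈ lowerBounds (ρ '' G x) ∧ u x ∈ upperBounds (ρ '' G x))
    {xh xt x : α} (hxh : xh ∈ X) (hxt : xt ∈ X) (hmax : IsMaxOn (fun x => ρ (μ x)) X xh)
    (htil : IsMaxOn (fun x => max (u x - ⨆ x' : X, l x') 0) X xt)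
    (hx : IsMaxOn (fun x => u x - l x) {xt, xh} x) {p : α} (hp : p ∈ X) {g h : W → ℝ}
    (hg : g ∈ G p) (hh : h ∈ G xh) : ρ g - ρ h ≤ 2 * (u x - l x) := by
  have hle : ∀ x ∈ X, l x ≤ ρ (μ x) := fun x hx => (hlu x hx).1 ⟨_, hμ x hx, rfl⟩
  have hue : ∀ x ∈ X, ρ (μ x) ≤ u x := fun x hx => (hlu x hx).2 ⟨_, hμ x hx, rfl⟩
  have hlh : ∀ x : X, l x ≤ ρ (μ xh) := fun x => (hle x x.2).trans (hmax x.2)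
  have : Nonempty X := ⟨⟨p, hp⟩⟩
  have h1 : ⨆ x' : X, l x' ≤ ρ (μ xh) := ciSup_le hlh
  have h2 : l xt ≤ ⨆ x' : X, l x' :=
    le_ciSup (f := fun x' : X => l x') ⟨_, Set.forall_mem_range.2 hlh⟩ ⟨xt, hxt⟩
  -- The positive part in the acquisition function is harmless because the width at `xt` is
  -- nonnegative.
  have h3 : u p - ⨆ x' : X, l x' ≤ u xt - l xt := by
    refine (le_max_left _ 0).trans ((htil hp).trans (max_le (by linarith) ?_))
    linarith [hle xt hxt, hue xt hxt]
  have h4 : u xt - l xt ≤ u x - l x := hx (by simp)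
  have h5 : u xh - l xh ≤ u x - l x := hx (by simp)
  have h6 : ρ g ≤ u p := (hlu p hp).2 ⟨g, hg, rfl⟩
  have h7 : l xh ≤ ρ h := (hlu xh hxh).1 ⟨h, hh, rfl⟩
  linarith [hue xh hxh]

section Round

variable {Ω' : Type*} [MeasurableSpace Ω'] {d : ℕ} {W : Type*} [Fintype W] [Nonempty W]
  [MeasurableSpace W] [DiscreteMeasurableSpace W] {P : Measure Ω'} [IsProbabilityMeasure P]
  {X : Set (Fin d → ℝ)} {f : Ω' → (Fin d → ℝ) → W → ℝ}
  {k : (Fin d → ℝ) × W → (Fin d → ℝ) × W → ℝ} {v : ℝ≥0} {ε β : ℕ → Ω' → ℝ}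
  {ρ : (W → ℝ) → ℝ} {R : Run Ω' d W} {q : QForm}
  {A : Ω' → ℕ × W → ℝ} {g : (ℕ × W → ℝ) × (X × W) → ℝ}
  {Zf : ℕ → (ℕ → ℝ) × (ℕ → ℝ) → X × W} {xh : ℕ → (ℕ → ℝ) × (ℕ → ℝ) → X}

/-- The gap `D` over the grid is a function of the process and of the past only, and good intervals
bound it by twice the width at `x_t`. Stochastic domination turns this into a bound of expectations.
-/
theorem lintegral_gap_le (hρ : Measurable ρ) (hv : v ≠ 0)
    (hR : R.IsExecution X k v f ε β ρ P) (hbounds : R.BoundsValid X k v f ε β ρ P)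
    (hwidth : R.WidthBound k v β q.eval P)
    (hYm : ∀ n, Measurable (R.obs f ε (n + 1)))
    (h : AdaptiveDesign (fun z z' : X × W => k (z.1, z.2) (z'.1, z'.2)) v A g
        (fun ω i => β (i + 1) ω) (fun i => ε (i + 1)) (fun i => R.obs f ε (i + 1)) Zf P)
    (hgf : ∀ᵐ ω ∂P, ∀ z : X × W, g (A ω, z) = f ω z.1 z.2)
    (hZ : ∀ n ω, Zf n (fun i => β (i + 1) ω, trunc n fun j => R.obs f ε (j + 1) ω) =
        (⟨R.x (n + 1) ω, hR.x_mem n ω⟩, R.w (n + 1) ω))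
    (hxhm : ∀ n, Measurable (xh n))
    (hxh : ∀ n ω, xh n (trunc n fun i => β (i + 1) ω, trunc n fun j => R.obs f ε (j + 1) ω) =
        ⟨R.xhat (n + 1) ω, hR.xhat_mem n ω⟩)
    (n : ℕ) (S : Finset (Fin d → ℝ)) (hS : (S : Set (Fin d → ℝ)) ⊆ X) {κ : ℝ}
    (hκ : ((1 + S.card) * Fintype.card W : ℝ) ≤ κ)
    (htail : ∀ b, 2 * Real.log κ ≤ b → P.map (β (n + 1)) (Set.Ioi b) =
      ENNReal.ofReal (Real.exp (-(b - 2 * Real.log κ) / 2))) :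
    ∃ D : Ω' → ℝ, Measurable D ∧ (∀ ω, 0 ≤ D ω) ∧
      (∀ᵐ ω ∂P, ∀ s ∈ S, ρ (f ω s) - ρ (f ω (R.xhat (n + 1) ω)) ≤ D ω) ∧
      ∫⁻ ω, ENNReal.ofReal (D ω) ∂P ≤ ∫⁻ ω, ENNReal.ofReal (2 * q.eval (2 * √(β (n + 1) ω) *
        R.sd k v n ω (R.x (n + 1) ω) (R.w (n + 1) ω))) ∂P := by
  set Y : ℕ → Ω' → ℝ := fun i => R.obs f ε (i + 1) with hYdef
  set U : Ω' → ℕ → ℝ := fun ω i => β (i + 1) ω with hUdef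
  have hU := h.U_measurable
  have hA := h.A_measurable
  have hg := h.g_measurable
  have hY : Measurable fun ω => trunc n fun j => Y j ω := by
    have : ∀ j, Measurable (Y j) := hYm
    fun_prop
  -- The estimated solution is `none`. It is compared with itself in `D`, which makes `D`
  -- nonnegative, and it accounts for the `1 +` in `κ`.
  let pt : Option S → (ℕ → ℝ) × (ℕ → ℝ) → X := fun o s => o.elim (xh n s) fun x => ⟨x, hS x.2⟩
  have hpt : ∀ o, Measurable (pt o) := by
    rintro (_ | x)
    · exact hxhm n
    · exact measurable_const
  let Φ : Option S → (ℕ × W → ℝ) × ((ℕ → ℝ) × (ℕ → ℝ)) → ℝ := fun o s =>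
    ρ fun w => g (s.1, (pt o s.2, w))
  have hΦ : ∀ o, Measurable (Φ o) := fun o => by
    have := hpt o
    exact hρ.comp (measurable_pi_lambda _ fun w => by fun_prop)
  let D : (ℕ × W → ℝ) × ((ℕ → ℝ) × (ℕ → ℝ)) → ℝ := fun s => ⨆ o, (Φ o s - Φ none s)
  have hDm : Measurable D := Measurable.iSup fun o => (hΦ o).sub (hΦ none)
  have hDle : ∀ o s, Φ o s - Φ none s ≤ D s := fun o s =>
    le_ciSup (f := fun o => Φ o s - Φ none s) (Set.finite_range _).bddAbove o
  have hD0 : ∀ s, 0 ≤ D s := fun s => by simpa using hDle none s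
  have hin := h.measurable_inputs n
  have hZm := h.input_measurable n
  -- The evaluated point as a function of the past and of the current confidence parameter, which is
  -- written into position `n`.
  let next : ((ℕ → ℝ) × (ℕ → ℝ)) × ℝ → X × W := fun s =>
    Zf n (Function.update s.1.1 n s.2, s.1.2)
  have hnext : Measurable next := by
    have h1 : Measurable fun s : ((ℕ → ℝ) × (ℕ → ℝ)) × ℝ => Function.update s.1.1 n s.2 :=
      measurable_update'.comp (f := fun s : ((ℕ → ℝ) × (ℕ → ℝ)) × ℝ => (s.1.1, s.2))
        (by fun_prop)
    exact hZm.comp (h1.prodMk (by fun_prop))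
  let sdn : ((ℕ → ℝ) × (ℕ → ℝ)) × ℝ → ℝ := fun s =>
    postSd (fun z z' : X × W => k (z.1, z.2) (z'.1, z'.2)) v
      (AdaptiveDesign.inputs Zf n s.1) (next s)
  have hsdn : Measurable sdn :=
    measurable_postSd (z := fun i (s : ((ℕ → ℝ) × (ℕ → ℝ)) × ℝ) =>
      AdaptiveDesign.inputs Zf n s.1 i) h.kernel_measurable v
      (fun i => (hin i).comp measurable_fst) hnext
  have hV0 : ∀ s : ((ℕ → ℝ) × (ℕ → ℝ)) × ℝ, 0 ≤ 2 * √s.2 * sdn s := fun s =>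
    mul_nonneg (by positivity) (Real.sqrt_nonneg _)
  let V : ((ℕ → ℝ) × (ℕ → ℝ)) × ℝ → ℝ := fun s => 2 * q.eval (2 * √s.2 * sdn s)
  have hVm : Measurable V :=
    (q.measurable_eval_comp (by fun_prop) hV0).const_mul _
  have hinputs : ∀ ω i, AdaptiveDesign.inputs Zf n (U ω, trunc n fun j => Y j ω) i =
      (⟨R.x (i + 1) ω, hR.x_mem i ω⟩, R.w (i + 1) ω) := fun ω i => by
    simp only [AdaptiveDesign.inputs]
    rw [trunc_trunc_of_le i.2.le, hZ]
  have hsd : ∀ ω (p : X × W), postSd (fun z z' : X × W => k (z.1, z.2) (z'.1, z'.2)) v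
      (AdaptiveDesign.inputs Zf n (U ω, trunc n fun j => Y j ω)) p = R.sd k v n ω p.1 p.2 := by
    intro ω p
    rw [funext (hinputs ω)]
    rfl
  have hmean : ∀ ω (p : X × W), postMean (fun z z' : X × W => k (z.1, z.2) (z'.1, z'.2)) v
      (AdaptiveDesign.inputs Zf n (U ω, trunc n fun j => Y j ω)) (fun i => Y i ω) p =
        R.mu k v f ε n ω p.1 p.2 := by
    intro ω p
    rw [funext (hinputs ω)]
    rfl
  have hnextU : ∀ ω, next ((trunc n (U ω), trunc n fun j => Y j ω), U ω n) =
      (⟨R.x (n + 1) ω, hR.x_mem n ω⟩, R.w (n + 1) ω) := fun ω => by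
    simp only [next]
    rw [← trunc_succ, h.input_trunc, hZ]
  have hVU : ∀ ω, V ((trunc n (U ω), trunc n fun j => Y j ω), U ω n) =
      2 * q.eval (2 * √(β (n + 1) ω) * R.sd k v n ω (R.x (n + 1) ω) (R.w (n + 1) ω)) := by
    intro ω
    simp only [V, sdn]
    rw [hnextU, h.inputs_trunc le_rfl, hsd]
  have hptn : ∀ ω, pt none (trunc n (U ω), trunc n fun j => Y j ω) =
      ⟨R.xhat (n + 1) ω, hR.xhat_mem n ω⟩ := hxh n
  have hcard : (Fintype.card (Option S × W) : ℝ) ≤ κ := by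
    rw [Fintype.card_prod, Fintype.card_option, Fintype.card_coe]
    push_cast
    linarith
  have hκ1 : 1 ≤ κ := by
    refine le_trans ?_ hκ
    have h1 : (1 : ℝ) ≤ Fintype.card W := by exact_mod_cast Fintype.card_pos
    have h2 : (0 : ℝ) ≤ S.card := Nat.cast_nonneg _
    nlinarith
  have hΦU : ∀ᵐ ω ∂P, ∀ o, Φ o (A ω, (trunc n (U ω), trunc n fun j => Y j ω)) =
      ρ (f ω (pt o (trunc n (U ω), trunc n fun j => Y j ω))) := by
    filter_upwards [hgf] with ω hω o
    simp only [Φ, hω]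
  have main := h.lintegral_le hv hY (p := fun (j : Option S × W) s => (pt j.1 s, j.2))
    (fun j => (hpt j.1).prodMk measurable_const) hcard hκ1 htail hDm hD0 hVm
    (fun s => mul_nonneg zero_le_two (q.eval_nonneg (hV0 s))) (by
      filter_upwards [hΦU, hgf, hbounds, hR.xhat_max, hR.xtil_max, hR.x_max, hR.w_max, hwidth]
        with ω hω hgω hb hxm htm hm hwm hwd hcred
      simp only [hsd, hmean, hgω] at hcred
      rw [hVU]
      have hmem : ∀ o, f ω (pt o (trunc n (U ω), trunc n fun j => Y j ω)) ∈
          R.credibleSet k v f ε β n ω (pt o (trunc n (U ω), trunc n fun j => Y j ω)) := by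
        intro o w
        have := abs_le.1 (hcred (o, w))
        simp only [hUdef] at this
        exact ⟨by linarith [this.1], by linarith [this.2]⟩
      have hmu : ∀ x ∈ X, R.mu k v f ε n ω x ∈ R.credibleSet k v f ε β n ω x := by
        intro x _ w
        have : 0 ≤ √(β (n + 1) ω) * R.sd k v n ω x w :=
          mul_nonneg (Real.sqrt_nonneg _) (Real.sqrt_nonneg _)
        exact ⟨by linarith, by linarith⟩
      have hsup : ⨆ w, R.sd k v n ω (R.x (n + 1) ω) w =
          R.sd k v n ω (R.x (n + 1) ω) (R.w (n + 1) ω) :=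
        le_antisymm (ciSup_le fun w => Real.sqrt_le_sqrt (hwm n w))
          (le_ciSup (f := fun w => R.sd k v n ω (R.x (n + 1) ω) w)
            (Set.finite_range _).bddAbove _)
      have hwd' := hwd n
      rw [hsup] at hwd'
      refine ciSup_le fun o => ?_
      rw [hω, hω]
      refine (sub_le_two_mul_width hmu (hb n) (hR.xhat_mem n ω) (hR.xtil_mem n ω) (hxm n) (htm n)
        (hm n) (pt o _).2 (hmem o) ?_).trans (mul_le_mul_of_nonneg_left hwd' zero_le_two)
      simpa only [hptn] using hmem none)
  refine ⟨fun ω => D (A ω, (trunc n (U ω), trunc n fun j => Y j ω)), by fun_prop,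
    fun ω => hD0 _, ?_, ?_⟩
  · filter_upwards [hΦU] with ω hω s hs
    have := hDle (some ⟨s, hs⟩) (A ω, (trunc n (U ω), trunc n fun j => Y j ω))
    rw [hω, hω, hptn] at this
    exact this
  · simpa only [hVU] using main

end Round

/-! ### Discretization error and gap combined -/

section RoundRegret

variable {Ω' : Type*} [MeasurableSpace Ω'] {d : ℕ} {W : Type*} [Fintype W] [Nonempty W]
  [MeasurableSpace W] [DiscreteMeasurableSpace W] {P : Measure Ω'} [IsProbabilityMeasure P]
  {X : Set (Fin d → ℝ)} {f : Ω' → (Fin d → ℝ) → W → ℝ} {ρ : (W → ℝ) → ℝ} {q₁ : ℝ → ℝ}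

theorem integrable_of_lintegral_ofReal_le {M : Ω' → ℝ} (hM : Measurable M) (hM0 : ∀ ω, 0 ≤ M ω)
    {c : ℝ≥0∞} (hc : c ≠ ⊤) (h : ∫⁻ ω, ENNReal.ofReal (M ω) ∂P ≤ c) : Integrable M P :=
  (lintegral_ofReal_ne_top_iff_integrable hM.aestronglyMeasurable
    (Filter.Eventually.of_forall hM0)).1 (ne_top_of_le_ne_top hc h)

theorem measurable_comp_point (hfm : ∀ w, Measurable fun p : X × Ω' => f p.2 p.1 w)
    {x : Ω' → Fin d → ℝ} (hx : Measurable x) (hxX : ∀ ω, x ω ∈ X) (w : W) :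
    Measurable fun ω => f ω (x ω) w :=
  (hfm w).comp (f := fun ω => ((⟨x ω, hxX ω⟩ : X), ω)) (hx.subtype_mk.prodMk measurable_id)

/-- Simple regret in one round: discretization error plus the gap over the finite set `S`. -/
theorem integral_regret_le (hfm : ∀ w, Measurable fun p : X × Ω' => f p.2 p.1 w)
    (hρ : Measurable ρ) (hq₁ : IsConcaveModulus q₁)
    (hρq₁ : ∀ᵐ ω ∂P, ∀ x ∈ X, ∀ x' ∈ X,
      |ρ (f ω x) - ρ (f ω x')| ≤ q₁ (⨆ w, |f ω x w - f ω x' w|))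
    {xs xh : Ω' → Fin d → ℝ} (hxs : Measurable xs) (hxsX : ∀ ω, xs ω ∈ X)
    (hmax : ∀ᵐ ω ∂P, IsMaxOn (fun x => ρ (f ω x)) X (xs ω))
    (hxh : Measurable xh) (hxhX : ∀ ω, xh ω ∈ X)
    {S : Finset (Fin d → ℝ)} (hS : (S : Set (Fin d → ℝ)) ⊆ X) {τ : ℝ} (hτ : 0 ≤ τ)
    (hgrid : ∀ M : Ω' → ℝ, Measurable M → (∀ ω, 0 ≤ M ω) →
      (∀ᵐ ω ∂P, ∃ x ∈ X, ∃ y ∈ X, M ω ≤ (⨆ w, |f ω x w - f ω y w|) ∧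
        ∀ s ∈ S, M ω ≤ ⨆ w, |f ω x w - f ω s w|) →
      ∫⁻ ω, ENNReal.ofReal (M ω) ∂P ≤ ENNReal.ofReal τ)
    {D V : Ω' → ℝ} (hD : Measurable D) (hD0 : ∀ ω, 0 ≤ D ω)
    (hDle : ∀ᵐ ω ∂P, ∀ s ∈ S, ρ (f ω s) - ρ (f ω (xh ω)) ≤ D ω)
    (hV : Integrable V P) (hV0 : ∀ ω, 0 ≤ V ω)
    (hDV : ∫⁻ ω, ENNReal.ofReal (D ω) ∂P ≤ ∫⁻ ω, ENNReal.ofReal (V ω) ∂P) :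
    Integrable (fun ω => ρ (f ω (xs ω)) - ρ (f ω (xh ω))) P ∧
      ∫ ω, ρ (f ω (xs ω)) - ρ (f ω (xh ω)) ∂P ≤ q₁ τ + ∫ ω, V ω ∂P := by
  let pt : Option S → Ω' → Fin d → ℝ := fun o ω => o.elim (xh ω) fun s => s
  have hptX : ∀ o ω, pt o ω ∈ X := by
    rintro (_ | s) ω
    · exact hxhX ω
    · exact hS s.2
  have hpt : ∀ o, Measurable (pt o) := by
    rintro (_ | s)
    · exact hxh
    · exact measurable_const
  have hfs := fun w => measurable_comp_point hfm hxs hxsX w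
  have hfp := fun o w => measurable_comp_point hfm (hpt o) (hptX o) w
  let δ : Option S → Ω' → ℝ := fun o ω => ⨆ w, |f ω (xs ω) w - f ω (pt o ω) w|
  have hδ : ∀ o, Measurable (δ o) := fun o =>
    Measurable.iSup fun w => measurable_norm.comp ((hfs w).sub (hfp o w))
  have hδ0 : ∀ o ω, 0 ≤ δ o ω := fun o ω => Real.iSup_nonneg fun w => abs_nonneg _
  -- Including `x̂_t` keeps the infimum over a nonempty set when the grid is empty.
  let M : Ω' → ℝ := fun ω => ⨅ o, δ o ω
  have hM : Measurable M := Measurable.iInf hδ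
  have hM0 : ∀ ω, 0 ≤ M ω := fun ω => Real.iInf_nonneg fun o => hδ0 o ω
  have hMle : ∀ o ω, M ω ≤ δ o ω := fun o ω =>
    ciInf_le (f := fun o => δ o ω) (Set.finite_range _).bddBelow o
  have hMint : ∫⁻ ω, ENNReal.ofReal (M ω) ∂P ≤ ENNReal.ofReal τ :=
    hgrid M hM hM0 (Filter.Eventually.of_forall fun ω => ⟨xs ω, hxsX ω, xh ω, hxhX ω,
      hMle none ω, fun s hs => hMle (some ⟨s, hs⟩) ω⟩)
  have hMi := integrable_of_lintegral_ofReal_le hM hM0 ENNReal.ofReal_ne_top hMint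
  have hMτ : ∫ ω, M ω ∂P ≤ τ := by
    rw [integral_eq_lintegral_of_nonneg_ae (Filter.Eventually.of_forall hM0)
      hM.aestronglyMeasurable]
    exact ENNReal.toReal_le_of_le_ofReal hτ hMint
  have hVl : ∫⁻ ω, ENNReal.ofReal (V ω) ∂P = ENNReal.ofReal (∫ ω, V ω ∂P) :=
    (ofReal_integral_eq_lintegral_ofReal hV (Filter.Eventually.of_forall hV0)).symm
  rw [hVl] at hDV
  have hDi := integrable_of_lintegral_ofReal_le hD hD0 ENNReal.ofReal_ne_top hDV
  have hDle' : ∫ ω, D ω ∂P ≤ ∫ ω, V ω ∂P := by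
    rw [integral_eq_lintegral_of_nonneg_ae (Filter.Eventually.of_forall hD0)
      hD.aestronglyMeasurable]
    exact ENNReal.toReal_le_of_le_ofReal (integral_nonneg hV0) hDV
  have hM0' : ∀ᵐ ω ∂P, 0 ≤ M ω := Filter.Eventually.of_forall hM0
  have hqi := hq₁.integrable_comp hMi hM0'
  have hqle : ∫ ω, q₁ (M ω) ∂P ≤ q₁ τ :=
    (hq₁.integral_comp_le hMi hM0').trans
      (hq₁.mono (Set.mem_Ici.2 (integral_nonneg hM0)) hτ hMτ)
  have hreg0 : ∀ᵐ ω ∂P, 0 ≤ ρ (f ω (xs ω)) - ρ (f ω (xh ω)) := by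
    filter_upwards [hmax] with ω hω
    exact sub_nonneg.2 (hω (hxhX ω))
  have hreg : ∀ᵐ ω ∂P, ρ (f ω (xs ω)) - ρ (f ω (xh ω)) ≤ q₁ (M ω) + D ω := by
    filter_upwards [hρq₁, hDle] with ω hω hDω
    -- The regret is split at the point closest to the optimum: the modulus `q₁` pays for the first
    -- part and `D` for the second.
    obtain ⟨o, ho⟩ := exists_eq_ciInf_of_finite (f := fun o => δ o ω)
    have h1 : ρ (f ω (xs ω)) - ρ (f ω (pt o ω)) ≤ q₁ (M ω) := by
      have := hω (xs ω) (hxsX ω) (pt o ω) (hptX o ω)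
      rw [show M ω = δ o ω from ho.symm]
      exact (le_abs_self _).trans this
    have h2 : ρ (f ω (pt o ω)) - ρ (f ω (xh ω)) ≤ D ω := by
      rcases o with _ | s
      · simpa [pt] using hD0 ω
      · exact hDω s s.2
    linarith
  have hm : Measurable fun ω => ρ (f ω (xs ω)) - ρ (f ω (xh ω)) :=
    (hρ.comp (measurable_pi_lambda _ hfs)).sub
      (hρ.comp (measurable_pi_lambda _ fun w => hfp none w))
  have hint : Integrable (fun ω => ρ (f ω (xs ω)) - ρ (f ω (xh ω))) P := by
    refine (hqi.add hDi).mono' hm.aestronglyMeasurable ?_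
    filter_upwards [hreg0, hreg] with ω h0 h1
    rw [Real.norm_eq_abs, abs_of_nonneg h0]
    exact h1
  refine ⟨hint, ?_⟩
  calc _ ≤ ∫ ω, q₁ (M ω) + D ω ∂P := integral_mono_ae hint (hqi.add hDi) hreg
    _ = ∫ ω, q₁ (M ω) ∂P + ∫ ω, D ω ∂P := integral_add hqi hDi
    _ ≤ _ := add_le_add hqle hDle'

end RoundRegret

/-! ### The confidence parameter -/

section Kappa

variable {W : Type*} [Fintype W]

theorem one_le_kappa [Nonempty W] (a b r : ℝ) (d t : ℕ) : 1 ≤ kappa a b r d W t := by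
  have h1 : (1 : ℝ) ≤ Fintype.card W := by exact_mod_cast Fintype.card_pos
  have h2 : (1 : ℝ) ≤ 1 + (⌈b * d * r * (t : ℝ) ^ 2 *
    (√(Real.log (a * d * Fintype.card W)) + √Real.pi / 2)⌉₊ : ℝ) ^ d := by
    have : (0 : ℝ) ≤ (⌈b * d * r * (t : ℝ) ^ 2 *
      (√(Real.log (a * d * Fintype.card W)) + √Real.pi / 2)⌉₊ : ℝ) ^ d := by positivity
    linarith
  exact one_le_mul_of_one_le_of_one_le h2 h1

/-- Only `d * r ≥ 0` is required, since in dimension `0` the side `r` may be negative. -/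
theorem kappa_mono {a b r : ℝ} (hb : 0 ≤ b) {d : ℕ} (hr : 0 ≤ d * r) {s t : ℕ} (hst : s ≤ t) :
    kappa a b r d W s ≤ kappa a b r d W t := by
  unfold kappa
  have hst' : (s : ℝ) ≤ t := by exact_mod_cast hst
  have h : 0 ≤ b * d * r := by rw [mul_assoc]; exact mul_nonneg hb hr
  gcongr

variable {Ω' : Type*} [MeasurableSpace Ω'] {P : Measure Ω'} [IsProbabilityMeasure P]
  {ξ β : Ω' → ℝ} {c : ℝ}

theorem map_add_chiSquared_Ioi (hξm : Measurable ξ) (hξ : HasLaw ξ (chiSquared 2) P)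
    (hβ : ∀ ω, β ω = c + ξ ω) {b : ℝ} (hb : c ≤ b) :
    P.map β (Set.Ioi b) = ENNReal.ofReal (Real.exp (-(b - c) / 2)) := by
  have e : β = fun ω => c + ξ ω := funext hβ
  rw [← chiSquared_two_Ioi (by linarith), ← hξ.map_eq, Measure.map_apply hξm measurableSet_Ioi,
    e, Measure.map_apply (hξm.const_add c) measurableSet_Ioi]
  congr 1
  ext ω
  simp only [Set.mem_preimage, Set.mem_Ioi]
  constructor <;> intro h <;> linarith

theorem integral_add_chiSquared_rpow (hξm : Measurable ξ) (hξ : HasLaw ξ (chiSquared 2) P)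
    (hβ : ∀ ω, β ω = c + ξ ω) {p : ℝ} (hp : 0 < p) :
    Integrable (fun ω => β ω ^ p) P ∧ ∫ ω, β ω ^ p ∂P = ∫ x, (c + x) ^ p ∂chiSquared 2 := by
  have e : (fun ω => β ω ^ p) = (fun x => (c + x) ^ p) ∘ ξ := by
    ext ω; simp [hβ]
  have hm : Measurable fun x : ℝ => (c + x) ^ p := by fun_prop
  rw [e, ← hξ.map_eq]
  refine ⟨(integrable_map_measure hm.aestronglyMeasurable hξm.aemeasurable).1 ?_,
    (integral_map hξm.aemeasurable hm.aestronglyMeasurable).symm⟩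
  rw [hξ.map_eq]
  exact integrable_chiSquared_two_rpow hp

theorem integral_chiSquared_rpow_mono {c c' : ℝ} (hc : 0 ≤ c) (hcc : c ≤ c') {p : ℝ}
    (hp : 0 < p) : ∫ x, (c + x) ^ p ∂chiSquared 2 ≤ ∫ x, (c' + x) ^ p ∂chiSquared 2 := by
  refine integral_mono_ae (integrable_chiSquared_two_rpow hp)
    (integrable_chiSquared_two_rpow hp) ?_
  filter_upwards [ae_nonneg_chiSquared_two] with x hx
  exact Real.rpow_le_rpow (by positivity) (by linarith) hp.le

end Kappa

/-! ### Summation of the discretization errors and form of the information gain -/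

theorem sum_inv_sq_le (t : ℕ) :
    ∑ i ∈ Finset.range t, 1 / ((i + 1 : ℕ) : ℝ) ^ 2 ≤ Real.pi ^ 2 / 6 := by
  -- The term of index `0` is `1 / 0 = 0`, so shifting the series keeps its sum.
  have h := (hasSum_nat_add_iff' 1).2 hasSum_zeta_two
  simp only [Finset.range_one, Finset.sum_singleton, Nat.cast_zero, ne_eq, OfNat.ofNat_ne_zero,
    not_false_eq_true, zero_pow, div_zero, sub_zero] at h
  exact sum_le_hasSum _ (fun i _ => by positivity) h

theorem IsConcaveModulus.sum_inv_sq_le {h : ℝ → ℝ} (hh : IsConcaveModulus h) {t : ℕ}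
    (ht : 1 ≤ t) : ∑ i ∈ Finset.range t, h (1 / ((i + 1 : ℕ) : ℝ) ^ 2) ≤
      t * h (Real.pi ^ 2 / (6 * t)) := by
  have ht0 : (0 : ℝ) < t := by exact_mod_cast ht
  have h1 := hh.sum_le (Finset.range t) (Finset.nonempty_range_iff.2 (by omega))
    (x := fun i => 1 / ((i + 1 : ℕ) : ℝ) ^ 2) (fun i _ => by positivity)
  rw [Finset.card_range] at h1
  refine h1.trans (mul_le_mul_of_nonneg_left (hh.mono ?_ ?_ ?_) ht0.le)
  · exact Set.mem_Ici.2
      (mul_nonneg (by positivity) (Finset.sum_nonneg fun i _ => by positivity))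
  · simp only [Set.mem_Ici]; positivity
  · calc _ ≤ 1 / (t : ℝ) * (Real.pi ^ 2 / 6) :=
        mul_le_mul_of_nonneg_left (RobustBO.sum_inv_sq_le t) (by positivity)
      _ = _ := by field_simp

theorem iSup_log_det_prod_univ {d : ℕ} {W : Type*} (X : Set (Fin d → ℝ))
    (k : (Fin d → ℝ) × W → (Fin d → ℝ) × W → ℝ) (v : ℝ≥0) (n : ℕ) :
    (1 / 2) * ⨆ z : Fin n → X × W, Real.log (1 + (v : ℝ)⁻¹ • kernelMatrix
      (fun z z' : X × W => k (z.1, z.2) (z'.1, z'.2)) z).det =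
        maxInfoGain k v (X ×ˢ Set.univ) n := by
  unfold maxInfoGain
  congr 1
  let e : X × W ≃ (X ×ˢ (Set.univ : Set W) : Set ((Fin d → ℝ) × W)) :=
    { toFun := fun z => ⟨(z.1, z.2), z.1.2, trivial⟩
      invFun := fun z => (⟨z.1.1, z.2.1⟩, z.1.2)
      left_inv := fun z => rfl
      right_inv := fun z => rfl }
  exact Equiv.iSup_congr (Equiv.arrowCongr (Equiv.refl _) e) fun z => rfl

end RobustBO

/-! ### The regret bound -/

open RobustBO
theorem mainTheorem8
    {Ω' : Type*} [MeasurableSpace Ω'] (P : Measure Ω') [IsProbabilityMeasure P]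
    -- design set `X ⊆ [0,r]^d`, finite set `W` of environmental variables
    {d : ℕ} {W : Type*} [Fintype W] [Nonempty W] [MeasurableSpace W] [DiscreteMeasurableSpace W]
    (r : ℝ) (X : Set (Fin d → ℝ)) (hXr : X ⊆ Set.Icc (fun _ => 0) (fun _ => r))
    (hXcompact : IsCompact X) (hXconvex : Convex ℝ X)
    -- robustness measure
    (ρ : (W → ℝ) → ℝ) (hρ : Measurable ρ)
    -- regularity assumption: Gaussian process prior, Gaussian noise
    (k : (Fin d → ℝ) × W → (Fin d → ℝ) × W → ℝ)
    (hk : ∀ x ∈ X, ∀ w, k (x, w) (x, w) ≤ 1)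
    (f : Ω' → (Fin d → ℝ) → W → ℝ) (hf : IsCentredGP X f k P)
    (noiseVar : ℝ≥0) (hnoise : 0 < noiseVar)
    (ε : ℕ → Ω' → ℝ) (hεm : ∀ t, Measurable (ε t))
    (hε : ∀ t, 1 ≤ t → HasLaw (ε t) (gaussianReal 0 noiseVar) P)
    -- randomization of the confidence parameter
    (ξ : ℕ → Ω' → ℝ) (hξm : ∀ t, Measurable (ξ t))
    (hξ : ∀ t, 1 ≤ t → HasLaw (ξ t) (chiSquared 2) P)
    (hindep : iIndep (sourceSigma X f ε ξ) P)
    -- tails of the partial derivatives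
    (a₁ b₁ : ℝ) (ha₁ : 0 < a₁) (hb₁ : 0 < b₁) (hpartial : HasSubGaussianPartials a₁ b₁ X f P)
    -- modulus of `ρ` along `f`
    (q₁ : ℝ → ℝ) (hq₁ : IsConcaveModulus q₁)
    (hρq₁ : ∀ᵐ ω ∂P, ∀ x ∈ X, ∀ x' ∈ X,
      |ρ (f ω x) - ρ (f ω x')| ≤ q₁ (⨆ w, |f ω x w - f ω x' w|))
    (β : ℕ → Ω' → ℝ) (hβ : ∀ t ω, β t ω = 2 * Real.log (kappa a₁ b₁ r d W t) + ξ t ω)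
    -- the algorithm, the validity of its bounds, and the width condition
    (R : Run Ω' d W) (hR : R.IsExecution X k noiseVar f ε β ρ P)
    (hbounds : R.BoundsValid X k noiseVar f ε β ρ P)
    (q : QForm) (hwidth : R.WidthBound k noiseVar β q.eval P)
    -- optimal solution
    (xstar : Ω' → Fin d → ℝ) (hxstarm : Measurable xstar) (hxstarX : ∀ ω, xstar ω ∈ X)
    (hxstar : ∀ᵐ ω ∂P, IsMaxOn (fun x => ρ (f ω x)) X (xstar ω))
    (t : ℕ) (ht : 1 ≤ t) :
    Integrable (R.cumRegret f ρ xstar t) P ∧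
    (∀ i j, Integrable (fun ω => β t ω ^ (q.ν i j / (2 - min (q.ν i j) 1))) P) ∧
    ∫ ω, R.cumRegret f ρ xstar t ω ∂P ≤
      t * q₁ (Real.pi ^ 2 / (6 * t)) +
      2 * t * ∑ i, q.ζ i * q.h i (1 / t * ∑ j, (2 : ℝ) ^ q.ν i j * q.lam i j *
        (t * ∫ ω, β t ω ^ (q.ν i j / (2 - min (q.ν i j) 1)) ∂P) ^ (1 - min (q.ν i j) 1 / 2) *
        (2 / Real.log (1 + (noiseVar : ℝ)⁻¹) *
          maxInfoGain k noiseVar (X ×ˢ Set.univ) t) ^ (min (q.ν i j) 1 / 2)) := by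
  have hΩ : Nonempty Ω' := by
    by_contra h
    rw [not_nonempty_iff] at h
    have := P.eq_zero_of_isEmpty
    exact IsProbabilityMeasure.ne_zero P this
  have : Nonempty X := ⟨⟨_, hxstarX (Classical.arbitrary Ω')⟩⟩
  have hv : noiseVar ≠ 0 := hnoise.ne'
  -- In positive dimension a point of `X` forces `r ≥ 0`.
  have hdr : 0 ≤ (d : ℝ) * r := by
    rcases Nat.eq_zero_or_pos d with h0 | h0
    · simp [h0]
    · have hx := hXr (hxstarX (Classical.arbitrary Ω'))
      exact mul_nonneg (Nat.cast_nonneg _) ((hx.1 ⟨0, h0⟩).trans (hx.2 ⟨0, h0⟩))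
  have hcont : ∀ᵐ ω ∂P, ∀ w, ContinuousOn (fun x => f ω x w) X := by
    obtain ⟨D, hD, -⟩ := hpartial
    filter_upwards [hD] with ω hω w x hx using (hω w x hx).continuousWithinAt
  have hc0 : ∀ s, 0 ≤ 2 * Real.log (kappa a₁ b₁ r d W s) := fun s =>
    mul_nonneg zero_le_two (Real.log_nonneg (one_le_kappa _ _ _ _ _))
  have hβm : ∀ s, Measurable (β s) := fun s => by
    rw [funext (hβ s)]
    exact (hξm s).const_add _
  have hβint : ∀ s, 1 ≤ s → ∀ p : ℝ, 0 < p → Integrable (fun ω => β s ω ^ p) P ∧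
      ∫ ω, β s ω ^ p ∂P =
        ∫ x, (2 * Real.log (kappa a₁ b₁ r d W s) + x) ^ p ∂chiSquared 2 := fun s hs p hp =>
    integral_add_chiSquared_rpow (hξm s) (hξ s hs) (hβ s) hp
  have hβ0 : ∀ s, 1 ≤ s → ∀ᵐ ω ∂P, 0 ≤ β s ω := fun s hs => by
    have h1 := ae_nonneg_chiSquared_two
    rw [← (hξ s hs).map_eq] at h1
    filter_upwards [ae_of_ae_map (hξm s).aemeasurable h1] with ω hω
    rw [hβ]
    exact add_nonneg (hc0 s) hω
  have hexp : ∀ i j, 0 < q.ν i j / (2 - min (q.ν i j) 1) := fun i j =>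
    div_pos (q.ν_pos i j) (by linarith [min_le_right (q.ν i j) 1])
  obtain ⟨A, g, Zf, xh, h, hgf, hZ, hxhm, hxh⟩ :=
    exists_adaptiveDesign hXcompact hf hεm hε hξm hindep hcont hβ hR
  have hdata := measurable_data hf hεm hβm hR
  have hxhat : ∀ n, Measurable (R.xhat (n + 1)) := fun n =>
    (hR.xhat_adapted n).mono (hdata n).comap_le le_rfl
  set k' : X × W → X × W → ℝ := fun z z' => k (z.1, z.2) (z'.1, z'.2) with hk'
  let z : Ω' → ℕ → X × W := fun ω n => (⟨R.x (n + 1) ω, hR.x_mem n ω⟩, R.w (n + 1) ω)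
  have hz : ∀ n, Measurable fun ω => z ω n := fun n => by
    have hp := (hdata n).prodMk (hβm (n + 1))
    exact (((hR.x_adapted n).mono hp.comap_le le_rfl).subtype_mk).prodMk
      ((hR.w_adapted n).mono hp.comap_le le_rfl)
  let s : ℕ → Ω' → ℝ := fun n ω => R.sd k noiseVar n ω (R.x (n + 1) ω) (R.w (n + 1) ω)
  have hsz : ∀ n ω, s n ω = postSd k' noiseVar (fun i : Fin n => z ω i) (z ω n) :=
    fun n ω => rfl
  have hsm : ∀ n, Measurable (s n) := fun n =>
    measurable_postSd (z := fun (i : Fin n) ω => z ω i) h.kernel_measurable noiseVar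
      (fun i => hz i) (hz n)
  have hs0 : ∀ n ω, 0 ≤ s n ω := fun n ω => Real.sqrt_nonneg _
  have hk1 : ∀ z : X × W, k' z z ≤ 1 := fun z => hk _ z.1.2 _
  have hksymm : ∀ z z', k' z z' = k' z' z := fun z z' => by
    rw [← h.cov, ← h.cov, covariance_comm]
  have hpos : ∀ (n : ℕ) (z : Fin n → X × W) p, 0 ≤ postVar k' noiseVar z p := fun n z p =>
    h.postVar_nonneg hv z p
  have hs1 : ∀ n ω, s n ω ≤ 1 := fun n ω => by
    rw [hsz, postSd, Real.sqrt_le_one]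
    exact (postVar_le (h.posSemidef _) hv _).trans (hk1 _)
  have hΓ : ∀ ω, ∑ i ∈ Finset.range t, s i ω ^ 2 ≤ 2 / Real.log (1 + (noiseVar : ℝ)⁻¹) *
      maxInfoGain k noiseVar (X ×ˢ Set.univ) t := fun ω => by
    rw [← iSup_log_det_prod_univ]
    refine le_of_eq_of_le ?_
      (sum_postVar_le hksymm (fun n z => h.posSemidef z) hv hpos hk1 (z ω) t)
    refine Finset.sum_congr rfl fun i _ => ?_
    rw [hsz, postSd, Real.sq_sqrt (hpos _ _ _)]
  obtain ⟨hVint, hVsum⟩ := sum_integral_eval_le q (B := fun i => β (i + 1)) (fun i => hβm _)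
    hsm hs0 hs1 ht (fun i _ => hβ0 _ (by omega)) (fun i _ p hp => (hβint _ (by omega) p hp).1)
    -- Since `κ` grows with the round and the variables `ξ` have one law, the moments of `β_t` bound
    -- those of all earlier rounds.
    (M := fun p => ∫ ω, β t ω ^ p ∂P) (fun i hi p hp => by
      rw [(hβint _ (by omega) p hp).2, (hβint _ ht p hp).2]
      refine integral_chiSquared_rpow_mono (hc0 _) ?_ hp
      have h1 := one_le_kappa (W := W) a₁ b₁ r d (i + 1)
      have h2 := kappa_mono (W := W) (a := a₁) hb₁.le hdr (Nat.succ_le_of_lt hi)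
      exact mul_le_mul_of_nonneg_left (Real.log_le_log (by linarith) h2) zero_le_two)
    (Filter.Eventually.of_forall hΓ)
  have hround : ∀ n < t, Integrable (fun ω => ρ (f ω (xstar ω)) - ρ (f ω (R.xhat (n + 1) ω))) P ∧
      ∫ ω, ρ (f ω (xstar ω)) - ρ (f ω (R.xhat (n + 1) ω)) ∂P ≤ q₁ (1 / ((n + 1 : ℕ) : ℝ) ^ 2) +
        ∫ ω, 2 * q.eval (2 * √(β (n + 1) ω) * s n ω) ∂P := fun n hn => by
    obtain ⟨S, hSX, hScard, hgrid⟩ := exists_grid hXr hXconvex ha₁ hb₁ hpartial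
      (Nat.le_add_left 1 n)
    obtain ⟨D, hD, hD0, hDle, hDV⟩ := lintegral_gap_le hρ hv hR hbounds hwidth
      (measurable_obs hf hεm hβm hR) h hgf hZ hxhm hxh n S hSX hScard
      (fun b hb => map_add_chiSquared_Ioi (hξm _) (hξ _ (by omega)) (hβ _) hb)
    -- Round `n + 1` uses its own grid, of precision `1 / (n + 1)²`.
    exact integral_regret_le hf.measurable hρ hq₁ hρq₁ hxstarm hxstarX hxstar (hxhat n)
      (hR.xhat_mem n) hSX (by positivity) hgrid hD hD0 hDle ((hVint n hn).const_mul 2)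
      (fun ω => mul_nonneg zero_le_two (q.eval_nonneg
        (mul_nonneg (by positivity) (hs0 n ω)))) hDV
  have hregret : R.cumRegret f ρ xstar t = fun ω => ∑ n ∈ Finset.range t,
      (ρ (f ω (xstar ω)) - ρ (f ω (R.xhat (n + 1) ω))) := by
    ext ω
    rw [Run.cumRegret, ← Finset.Ico_add_one_right_eq_Icc, Finset.sum_Ico_eq_sum_range]
    exact Finset.sum_congr rfl fun n _ => by rw [add_comm 1 n]
  refine ⟨?_, fun i j => (hβint t ht _ (hexp i j)).1, ?_⟩
  · rw [hregret]
    exact integrable_finsetSum _ fun n hn => (hround n (Finset.mem_range.1 hn)).1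
  · rw [hregret, integral_finsetSum _ fun n hn => (hround n (Finset.mem_range.1 hn)).1]
    calc _ ≤ ∑ n ∈ Finset.range t, (q₁ (1 / ((n + 1 : ℕ) : ℝ) ^ 2) +
          ∫ ω, 2 * q.eval (2 * √(β (n + 1) ω) * s n ω) ∂P) :=
          Finset.sum_le_sum fun n hn => (hround n (Finset.mem_range.1 hn)).2
      _ = ∑ n ∈ Finset.range t, q₁ (1 / ((n + 1 : ℕ) : ℝ) ^ 2) + 2 *
          ∑ n ∈ Finset.range t, ∫ ω, q.eval (2 * √(β (n + 1) ω) * s n ω) ∂P := by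
          simp only [integral_const_mul, Finset.sum_add_distrib, Finset.mul_sum]
      _ ≤ _ := by
          rw [mul_assoc 2]
          exact add_le_add (hq₁.sum_inv_sq_le ht) (mul_le_mul_of_nonneg_left hVsum zero_le_two)
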